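/- All graphs are finite, simple, undirected, nonempty and without isolated vertices. For $G=(V,E)$ with $n$ vertices and $m$ edges, the degeneracy is $d=\max_{H\subseteq G}\delta_H$, where $H$ ranges over the nonempty subgraphs and $\delta_H$ is the minimum degree of $H$. A degeneracy ordering is an ordering $\pi=\langle v_1,\dots,v_n\rangle$ of $V$ in which each vertex $v$ has at most $d$ neighbours that come before it; $N_\pi^{<}(v)$ denotes the set of these neighbours. A DCC representation of $G$ is a pair $(\mathcal C,\mathcal L)$, where $\mathcal C=\{C_\ell\}_{\ell\in I}$ is a family of cliques of $G$ such that each edge lies in some $C_\ell$, and $\mathcal L=\{L_v\}_{v\in V}$ is its incidence dual, i.e. $L_v=\{\ell\in I: v\in C_\ell\}$ and $\bigcup_v L_v=I$. It is succinct if no two or more of the cliques $C_\ell$ (with distinct labels) have a union that is a clique, and $\|\mathcal C\|:=\sum_{\ell\in I}|C_\ell|=O(m)$. **Algorithm Local-Admissibility.** Put $\mathcal C=\emptyset$ and $M_v=N(v)$ for all $v\in V$. Let $\pi$ be a degeneracy ordering, and compute the sets $N_\pi^{<}(v)$. For $i=n$ down to $2$, if $M_{v_i}\neq\emptyset$: 1.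 let $S=\{v_i\}\cup\{u\in N_\pi^{<}(v_i): M_u\cap(N_\pi^{<}(v_i)\cup\{v_i\})\ne\emptyset\}$; 2. let $Q_1,\dots,Q_r$ be the colour classes of a first-fit greedy colouring of the complement of $G[M_{v_i}]$ (vertices in any order); 3. for each $j$, create a clique with a new label, $C=Q_j\cup\{v_i\}$, and replace $M_u$ by $M_u\setminus C$ for all $u\in C$; 4. for each label $\ell$ created in this iteration let $D_\ell=C_\ell\cup\{u\in S\setminus C_\ell: u\text{ is adjacent to all of }C_\ell\}$, and for $u\in S$ let $A_u$ be the set of those labels $\ell$ with $u\in D_\ell$; 5. for each edge $\{u,w\}$ of $G[S]$ (in any order) with $w\in M_u$ and $A_u\cap A_w\ne\emptyset$ at the time it is processed: select any $\ell\in A_u\cap A_w$; add $u,w$ to $C_\ell$; for each $t\in D_\ell\setminus C_\ell$ that is not adjacent to both $u$ and $w$, remove $t$ from $D_\ell$ and $\ell$ from $A_t$; replace $M_x$ by $M_x\setminus C_\ell$ for $x\in\{u,w\}$ and $M_y$ by $M_y\setminus\{u,w\}$ for $y\in C_\ell$; 6. add the cliques created in this iteration to $\mathcal C$, and discard $S$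 and all $Q_j$, $D_\ell$, $A_u$. Finally compute $L_v=\{\ell: v\in C_\ell\}$ for all $v$, and return $(\mathcal C,\mathcal L)$. Time is the number of elementary steps of a machine whose memory holds finite sets and registers, where a membership test, an insertion, a deletion, or picking an element of a set counts as one step (that is, the polylogarithmic cost of one set operation is suppressed), and a loop over a set costs one step per element in addition to its body. Space is the largest number of words (set elements and nonzero registers, the input and the output included) in use at any moment. **Statement.** For every $G$ and every way of making the arbitrary choices above, Local-Admissibility returns a succinct DCC representation $(\mathcal C,\mathcal L)$ of $G$, using $O(d^2\cdot\min\{|\mathcal C|,m\})$ time and $O(m)$ space, where $|\mathcal C|=|I|$ is the number of cliques. This holds when $\pi$ is computed within these bounds, by repeatedly removing a vertex of minimum degree (with a bucket queue, ties broken arbitrarily) and reversing the order of removal, and also when $\pi$ is any given degeneracy ordering. All implied constants are absolute. -/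

import Mathlib

namespace LocalAdmissibility

/-! ### Graph notions -/

section Graph

variable {V : Type}

/-- The degeneracy `max_{H ⊆ G} δ_H`: the largest `k` such that some nonempty subgraph has minimum
degree at least `k`. -/
noncomputable def degeneracy (G : SimpleGraph V) : ℕ :=
  sSup {k | ∃ H : G.Subgraph, H.verts.Nonempty ∧ ∀ v ∈ H.verts, k ≤ (H.neighborSet v).ncard}

/-- `π v` is the (zero-based) position of `v`; every vertex has at most `degeneracy G` neighbours
that appear before it. -/
def IsDegeneracyOrdering [Fintype V] (G : SimpleGraph V) (π : V ≃ Fin (Fintype.card V)) : Prop :=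
  ∀ v, {u | G.Adj u v ∧ π u < π v}.ncard ≤ degeneracy G

/-- The data of a pair `(𝓒, 𝓛)`: vertex sets `C ℓ` indexed by the labels `ℓ ∈ labels`, and label
sets `L v` indexed by the vertices. -/
structure CoverPair (V : Type) where
  labels : Finset ℕ
  C : ℕ → Finset V
  L : V → Finset ℕ

namespace CoverPair

/-- The family `(C ℓ)` consists of cliques, and every edge lies in one of them. -/
def IsCliqueCover (R : CoverPair V) (G : SimpleGraph V) : Prop :=
  (∀ ℓ ∈ R.labels, G.IsClique (R.C ℓ)) ∧
  ∀ u v, G.Adj u v → ∃ ℓ ∈ R.labels, u ∈ R.C ℓ ∧ v ∈ R.C ℓ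

/-- `𝓛` is the incidence dual of `𝓒`: `⋃ L v` is the label set and `L v = {ℓ | v ∈ C ℓ}`. -/
def IsIncidenceDual (R : CoverPair V) : Prop :=
  (∀ ℓ, ℓ ∈ R.labels ↔ ∃ v, ℓ ∈ R.L v) ∧
  ∀ v ℓ, ℓ ∈ R.L v ↔ ℓ ∈ R.labels ∧ v ∈ R.C ℓ

/-- A dual clique cover representation of `G`. -/
def IsDCC (R : CoverPair V) (G : SimpleGraph V) : Prop :=
  R.IsCliqueCover G ∧ R.IsIncidenceDual

/-- No two or more of the cliques have a union that is a clique. -/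
def IsCompositionMinimal (R : CoverPair V) (G : SimpleGraph V) : Prop :=
  ∀ J ⊆ R.labels, 2 ≤ J.card → ¬ G.IsClique (⋃ ℓ ∈ J, (R.C ℓ : Set V))

/-- `‖𝓒‖`, the total number of vertex-clique assignments. -/
def coverSize (R : CoverPair V) : ℕ := ∑ ℓ ∈ R.labels, (R.C ℓ).card

/-- A succinct DCC representation, with `K` as the constant in the bound `‖𝓒‖ = O(m)`. -/
def IsSuccinctDCC [Fintype V] (R : CoverPair V) (G : SimpleGraph V) [DecidableRel G.Adj]
    [DecidableEq V] (K : ℕ) : Prop :=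
  R.IsDCC G ∧ R.IsCompositionMinimal G ∧ R.coverSize ≤ K * G.edgeFinset.card

end CoverPair

end Graph

/-! ### The machine model

A unit-cost machine whose memory holds finite sets (of vertices, of labels, or of vertex pairs) and
natural-number registers, both at indexed addresses. Set membership tests, insertions, deletions and
picking an arbitrary element take one step, so the polylogarithmic cost of one set operation is
suppressed; registers can only be reset, incremented, decremented, copied and read. A loop over a
set copies it first and visits the elements in an arbitrary order. -/

/-- Addresses of the sets in memory. -/
inductive Loc (V : Type) : Type
  /-- the vertex set (input) -/
  | verts
  /-- the neighbourhood `N(v)` (input) -/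
  | nbr (v : V)
  /-- the cell of the `i`-th vertex of the ordering `π = ⟨v₁, …, vₙ⟩`: it holds `{vᵢ}` -/
  | ord (i : ℕ)
  /-- the neighbours of `v` along edges that are still uncovered -/
  | M (v : V)
  /-- the backward neighbourhood of `v` -/
  | back (v : V)
  /-- the clique with label `ℓ` (output) -/
  | C (ℓ : ℕ)
  /-- the labels of the cliques that contain `v` (output) -/
  | L (v : V)
  /-- the local vertex set `Sᵢ` -/
  | S
  /-- the colour classes of the local colouring -/
  | Q (j : ℕ)
  /-- the local admissibility duals -/
  | D (ℓ : ℕ)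
  /-- the local admissibility sets -/
  | A (v : V)
  /-- the edges of the local subgraph `G[Sᵢ]` -/
  | edges
  /-- the selected label, if any -/
  | sel
  /-- the vertices that become inadmissible by an extension -/
  | T
  /-- the remaining vertices of remaining degree `k` during peeling -/
  | bucket (k : ℕ)
  /-- the vertices already peeled -/
  | gone

/-- The type of the elements of the set at an address. -/
abbrev Loc.Elem {V : Type} : Loc V → Type
  | .L _ => ℕ
  | .A _ => ℕ
  | .sel => ℕ
  | .edges => V × V
  | _ => V

/-- Addresses of the registers. -/
inductive Reg (V : Type) : Type
  /-- the number of vertices -/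
  | numV
  /-- the position of `v` in the ordering, counted from `1` -/
  | pos (v : V)
  /-- the number of cliques constructed so far -/
  | numC
  /-- the number of colour classes of the local colouring -/
  | numQ
  /-- whether the current vertex has been coloured -/
  | placed
  /-- the number of failed adjacency tests -/
  | bad
  /-- the remaining degree of `v` during peeling -/
  | deg (v : V)
  /-- the next position to be filled during peeling -/
  | cnt
  /-- the current bucket during peeling -/
  | ptr

/-- A memory state. -/
structure State (V : Type) where
  sets : (a : Loc V) → Finset a.Elem
  reg : Reg V → ℕ

/-- The number of words in use: the elements of all stored sets and the nonzero registers. -/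
noncomputable def State.size {V : Type} (s : State V) : ℕ∞ :=
  {q : (a : Loc V) × a.Elem | q.2 ∈ s.sets q.1}.encard + {r : Reg V | s.reg r ≠ 0}.encard

open Classical in
/-- The state after the set at address `a` is replaced. -/
noncomputable def State.setSet {V : Type} (s : State V) (a : Loc V) (X : Finset a.Elem) : State V :=
  ⟨Function.update s.sets a X, s.reg⟩

open Classical in
/-- The state after the register `r` is replaced. -/
noncomputable def State.setReg {V : Type} (s : State V) (r : Reg V) (x : ℕ) : State V :=
  ⟨s.sets, Function.update s.reg r x⟩

/-- Programs. A value obtained from memory is passed on as an argument of the rest of the program,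
which uses such values only as elements, as parts of addresses (with a bounded number of additions),
as loop bounds and in comparisons; these uses are part of the step that obtains the value. -/
inductive Cmd (V : Type) : Type
  | skip : Cmd V
  | seq (c₁ c₂ : Cmd V) : Cmd V
  | insert (a : Loc V) (x : a.Elem) : Cmd V
  | erase (a : Loc V) (x : a.Elem) : Cmd V
  | ifMem (a : Loc V) (x : a.Elem) (c₁ c₂ : Cmd V) : Cmd V
  /-- run `body x` for an arbitrary element `x` of the set, or `c` if the set is empty -/
  | pick (a : Loc V) (body : a.Elem → Cmd V) (c : Cmd V) : Cmd V
  | forEach (a : Loc V) (body : a.Elem → Cmd V) : Cmd V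
  | reset (r : Reg V) : Cmd V
  | incr (r : Reg V) : Cmd V
  | decr (r : Reg V) : Cmd V
  /-- copy register `r'` into register `r` -/
  | copy (r r' : Reg V) : Cmd V
  | read (r : Reg V) (body : ℕ → Cmd V) : Cmd V
  /-- run `body 0`, …, `body (k - 1)` in this order -/
  | forRange (k : ℕ) (body : ℕ → Cmd V) : Cmd V

/-- The result of a run: the final state, the number of steps, and the largest number of words in
use at any moment of the run. -/
structure Outcome (V : Type) where
  final : State V
  time : ℕ
  space : ℕ∞

section Semantics

variable {V : Type}

/-- An elementary step from `s` to `s'`. -/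
noncomputable def step (s s' : State V) : Outcome V := ⟨s', 1, max s.size s'.size⟩

/-- The outcome `o` preceded by one step that does not change the memory. -/
def Outcome.tick (o : Outcome V) : Outcome V := ⟨o.final, 1 + o.time, o.space⟩

/-- The outcome of the run `o₁` followed by the run `o₂`. -/
noncomputable def Outcome.andThen (o₁ o₂ : Outcome V) : Outcome V :=
  ⟨o₂.final, o₁.time + o₂.time, max o₁.space o₂.space⟩

/-- The outcomes of running `f x` for the entries `x` of a list in turn, with one step of overhead
for each entry and one for leaving the loop. -/
noncomputable def iter {α : Type} (f : α → State V → Set (Outcome V)) :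
    List α → State V → Set (Outcome V)
  | [], s => {step s s}
  | x :: l, s => {o | ∃ o₁ ∈ f x s, ∃ o₂ ∈ iter f l o₁.final, o = (o₁.andThen o₂).tick}

open Classical in
/-- The set of possible outcomes of a program from a state. -/
noncomputable def exec : Cmd V → State V → Set (Outcome V)
  | .skip, s => {step s s}
  | .seq c₁ c₂, s => {o | ∃ o₁ ∈ exec c₁ s, ∃ o₂ ∈ exec c₂ o₁.final, o = o₁.andThen o₂}
  | .insert a x, s => {step s (s.setSet a (insert x (s.sets a)))}
  | .erase a x, s => {step s (s.setSet a ((s.sets a).erase x))}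
  | .ifMem a x c₁ c₂, s =>
      {o | ∃ o' ∈ (if x ∈ s.sets a then exec c₁ s else exec c₂ s), o = o'.tick}
  | .pick a body c, s =>
      {o | (∃ x ∈ s.sets a, ∃ o' ∈ exec (body x) s, o = o'.tick) ∨
        (s.sets a = ∅ ∧ ∃ o' ∈ exec c s, o = o'.tick)}
  | .forEach a body, s =>
      -- the copy of the set that is being traversed is charged to the space
      {o | ∃ l : List a.Elem, l.Nodup ∧ (∀ x, x ∈ l ↔ x ∈ s.sets a) ∧
        ∃ o' ∈ iter (fun x => exec (body x)) l s,
          o = ⟨o'.final, o'.time, o'.space + (s.sets a).card⟩}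
  | .reset r, s => {step s (s.setReg r 0)}
  | .incr r, s => {step s (s.setReg r (s.reg r + 1))}
  | .decr r, s => {step s (s.setReg r (s.reg r - 1))}
  | .copy r r', s => {step s (s.setReg r (s.reg r'))}
  | .read r body, s => {o | ∃ o' ∈ exec (body (s.reg r)) s, o = o'.tick}
  | .forRange k body, s =>
      -- one word for the loop counter
      {o | ∃ o' ∈ iter (fun i => exec (body i)) (List.range k) s,
        o = ⟨o'.final, o'.time, o'.space + 1⟩}

end Semantics

/-! ### The algorithm -/

section Algorithm

variable {V : Type}

/-- Run a list of programs one after the other. -/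
def block : List (Cmd V) → Cmd V
  | [] => .skip
  | c :: cs => .seq c (block cs)

/-- Remove all elements of a set. -/
def clear (a : Loc V) : Cmd V := .forEach a fun x => .erase a x

/-- A linear-time computation of a degeneracy ordering: repeatedly remove a vertex of minimum
degree from the remaining graph, and list the vertices in reverse order of removal. The vertices are
kept in buckets by remaining degree. The pointer to the current bucket moves up by one at an empty
bucket and down by one after a removal, so `3 n` moves suffice. -/
def peeling : Cmd V := block [
  .forEach .verts fun v => block [
    .forEach (.nbr v) fun _ => .incr (.deg v),
    .read (.deg v) fun k => .insert (.bucket k) v],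
  .copy .cnt .numV,
  .read .numV fun n => .forRange (3 * n) fun _ =>
    .read .ptr fun k => .pick (.bucket k)
      (fun v => block [
        .erase (.bucket k) v,
        .insert .gone v,
        .read .cnt fun i => .insert (.ord i) v,
        .copy (.pos v) .cnt,
        .decr .cnt,
        .forEach (.nbr v) fun u => .ifMem .gone u .skip
          (.read (.deg u) fun k' => block [
            .erase (.bucket k') u,
            .insert (.bucket (k' - 1)) u,
            .decr (.deg u)]),
        .decr .ptr])
      (.incr .ptr),
  clear .gone]

/-- First-fit greedy colouring of the complement of `G[M v]`: the colour classes are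
`Q 0, …, Q (r - 1)`, and each vertex joins the first class all of whose members it is adjacent to
in `G`. -/
def colouring (v : V) : Cmd V := block [
  .reset .numQ,
  .forEach (.M v) fun x => block [
    .reset .placed,
    .read .numQ fun r => .forRange r fun j => .read .placed fun b =>
      if b = 0 then block [
        .reset .bad,
        .forEach (.Q j) fun y => .ifMem (.nbr x) y .skip (.incr .bad),
        .read .bad fun k =>
          if k = 0 then block [.insert (.Q j) x, .incr .placed] else .skip]
      else .skip,
    .read .placed fun b =>
      if b = 0 then .read .numQ fun j => block [.insert (.Q j) x, .incr .numQ] else .skip]]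

/-- The extension of the clique `C ℓ` by the uncovered edge `{u, w}`. -/
def extend (ℓ : ℕ) (u w : V) : Cmd V := block [
  .insert (.C ℓ) u,
  .insert (.C ℓ) w,
  .forEach (.D ℓ) fun t => .ifMem (.C ℓ) t .skip
    (.ifMem (.nbr u) t (.ifMem (.nbr w) t .skip (.insert .T t)) (.insert .T t)),
  .forEach .T fun t => block [.erase (.D ℓ) t, .erase (.A t) ℓ, .erase .T t],
  .forEach (.C ℓ) fun y => block [
    .erase (.M u) y, .erase (.M w) y, .erase (.M y) u, .erase (.M y) w]]

/-- The subroutine Augment-LS on the cliques with labels `p, …, p + r - 1` and the vertex set `S`. -/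
def augment (p r : ℕ) : Cmd V := block [
  .forRange r fun j => .forEach (.C (p + j)) fun u => .insert (.D (p + j)) u,
  .forRange r fun j => block [
    .forEach .S fun u => .ifMem (.C (p + j)) u .skip (block [
      .reset .bad,
      .forEach (.C (p + j)) fun w => .ifMem (.nbr u) w .skip (.incr .bad),
      .read .bad fun k => if k = 0 then .insert (.D (p + j)) u else .skip]),
    .forEach (.D (p + j)) fun u => .insert (.A u) (p + j)],
  .forEach .S fun u => .forEach .S fun w => .ifMem (.nbr u) w
    (.read (.pos u) fun i => .read (.pos w) fun j =>
      if i < j then .insert .edges (u, w) else .skip)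
    .skip,
  .forEach .edges fun e => .ifMem (.M e.1) e.2
    (block [
      .forEach (.A e.1) fun ℓ => .ifMem (.A e.2) ℓ
        (.pick .sel (fun _ => .skip) (.insert .sel ℓ))
        .skip,
      .pick .sel (fun ℓ => block [.erase .sel ℓ, extend ℓ e.1 e.2]) .skip])
    .skip]

/-- Discard the local structures. -/
def discard (p r : ℕ) : Cmd V := block [
  .forEach .S fun u => clear (.A u),
  .forRange r fun j => block [clear (.D (p + j)), clear (.Q j)],
  clear .edges,
  clear .S]

/-- The iteration of the main loop for the vertex `v = vᵢ`. -/
def iteration (v : V) : Cmd V :=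
  .pick (.M v)
    (fun _ => block [
      .insert .S v,
      .forEach (.back v) fun u => block [
        .ifMem (.M u) v (.insert .S u) .skip,
        .forEach (.back v) fun x => .ifMem (.M u) x (.insert .S u) .skip],
      colouring v,
      .read .numC fun p => .read .numQ fun r => block [
        .forRange r fun j => block [
          .insert (.C (p + j)) v,
          .forEach (.Q j) fun x => .insert (.C (p + j)) x,
          .forEach (.C (p + j)) fun u => .forEach (.C (p + j)) fun x => .erase (.M u) x],
        augment p r,
        .forRange r fun _ => .incr .numC,
        discard p r]])
    .skip

/-- The algorithm Local-Admissibility; `computeOrder` is the program that is run in order to obtain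
the degeneracy ordering. -/
def localAdmissibility (computeOrder : Cmd V) : Cmd V := block [
  .forEach .verts fun _ => .incr .numV,
  .forEach .verts fun v => .forEach (.nbr v) fun u => .insert (.M v) u,
  computeOrder,
  .forEach .verts fun v => .forEach (.nbr v) fun u =>
    .read (.pos u) fun i => .read (.pos v) fun j =>
      if i < j then .insert (.back v) u else .skip,
  .read .numV fun n => .forRange (n - 1) fun k =>
    .pick (.ord (n - k)) (fun v => iteration v) .skip,
  .read .numC fun p => .forRange p fun ℓ => .forEach (.C ℓ) fun v => .insert (.L v) ℓ]

/-- The pair `(𝓒, 𝓛)` that is returned. -/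
def output (s : State V) : CoverPair V where
  labels := Finset.range (s.reg .numC)
  C ℓ := s.sets (.C ℓ)
  L v := s.sets (.L v)

variable [Fintype V] [DecidableEq V]

/-- The initial memory: it holds the vertex set and the neighbourhoods of `G` and nothing else. -/
def input (G : SimpleGraph V) [DecidableRel G.Adj] : State V where
  sets
    | .verts => Finset.univ
    | .nbr v => G.neighborFinset v
    | .ord _ | .M _ | .back _ | .C _ | .L _ | .S | .Q _ | .D _ | .A _ | .edges | .sel | .T
    | .bucket _ | .gone => ∅
  reg _ := 0

/-- The initial memory that holds, in addition, the ordering `π` of the vertices. -/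
def inputOrdered (G : SimpleGraph V) [DecidableRel G.Adj] (π : V ≃ Fin (Fintype.card V)) :
    State V where
  sets
    | .ord i => Finset.univ.filter fun v => (π v : ℕ) + 1 = i
    | a => (input G).sets a
  reg
    | .pos v => π v + 1
    | _ => 0

/-- Every run of the program `c` from the state `s` (and there is one) returns a succinct DCC
representation of `G` in `O(d² · min {|𝓒|, m})` time and `O(m)` space, with constant `K`. -/
def Correct (G : SimpleGraph V) [DecidableRel G.Adj] (K : ℕ) (c : Cmd V) (s : State V) : Prop :=
  (exec c s).Nonempty ∧
  ∀ o ∈ exec c s,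
    (output o.final).IsSuccinctDCC G K ∧
    o.time ≤ K * (degeneracy G ^ 2 * min (output o.final).labels.card G.edgeFinset.card) ∧
    o.space ≤ (K * G.edgeFinset.card : ℕ)

end Algorithm

end LocalAdmissibility

/-! Write `e` for `d + 1`; the sets `M` hold each uncovered edge as two ordered pairs.

Size. When a vertex `v` and a nonempty `Q ⊆ M v` are put into one clique, the clique gains at most
`|Q| + 1 ≤ 2|Q|` vertices, while `M` loses at least `2|Q|` pairs. So `∑ |C ℓ| + ∑ |M v|` never
exceeds its initial value `2m` (`IsPartialCover.extend`). This gives `‖𝓒‖ ≤ 2m` and, as every clique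
has at least two vertices, `|𝓒| ≤ m`; the minimum in the time bound is therefore `|𝓒|`.

Saturation (`IterationEnd.saturated`). After each iteration, no clique constructed so far remains a
clique when both ends of an uncovered edge are added. Old cliques keep this property because `M`
only shrinks. A new clique contains the current vertex `v`, so both ends of such an edge would be
neighbours of `v`. They precede `v`, because later vertices have no uncovered edges left; hence they
lie in `S` and in the dual `D ℓ`, which is maintained exactly. Then `ℓ` is a label common to both
ends, and the edge would have been covered when it was processed, since `A` and `M` only shrink.

Minimality (`IterationEnd.pairwise`). It suffices to consider two cliques. Within one iteration,
first fit gives each vertex of the later class a non-neighbour in the earlier class. Across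
iterations, the later clique contains an edge at `v` that was uncovered when its iteration began,
and saturation of the older clique applies.

Time (`wpS_iteration`, `wpS_coverEdges`). An iteration with `M v ≠ ∅` creates `r ≥ 1` cliques in
`O(e²r)` steps. The only phase dearer than `O(e²)` is the loop over the at most `e²` local edges:
each edge searches at most `r` labels, and each extension costs `O(e)` but adds a vertex to one of
`r` cliques with at most `e` vertices. All other work is `O(m)`, and `2m ≤ e²|𝓒|` because cliques
with at most `e` vertices cover all edges (`FinalInv.le_mul`).

Space. A step adds at most one word, so a phase of `O(e²)` steps needs `O(e²)` extra words
(`slow_exec`, `wp.space`), and `e² = O(m)` because a subgraph of minimum degree `d` has at least `d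
+ 1` vertices (`degeneracy_mul_le`). Where the running time is too long for this argument, the
invariants bound the memory between loop passes (`wpS_coverEdges`, `MainInv.size_le`).

Peeling (`wp_peeling`). The bucket pointer is a lower bound for all remaining degrees, so it is at
most `d` while vertices remain, and each removed vertex has minimum degree. The quantity `2|gone| +
ptr` grows with each move, which is why `3n` moves suffice. -/

namespace LocalAdmissibility

open scoped Classical

/-! ### Program logic -/

section Logic

variable {V : Type}

/-! The sets in memory, with their types. -/

def State.verts (s : State V) : Finset V := s.sets .verts

def State.nbr (s : State V) (i : V) : Finset V := s.sets (.nbr i)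

def State.ord (s : State V) (i : ℕ) : Finset V := s.sets (.ord i)

def State.M (s : State V) (i : V) : Finset V := s.sets (.M i)

def State.back (s : State V) (i : V) : Finset V := s.sets (.back i)

def State.C (s : State V) (i : ℕ) : Finset V := s.sets (.C i)

def State.L (s : State V) (i : V) : Finset ℕ := s.sets (.L i)

def State.Q (s : State V) (i : ℕ) : Finset V := s.sets (.Q i)

def State.D (s : State V) (i : ℕ) : Finset V := s.sets (.D i)

def State.A (s : State V) (i : V) : Finset ℕ := s.sets (.A i)

def State.bucket (s : State V) (i : ℕ) : Finset V := s.sets (.bucket i)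

def State.S (s : State V) : Finset V := s.sets .S

def State.T (s : State V) : Finset V := s.sets .T

def State.sel (s : State V) : Finset ℕ := s.sets .sel

def State.edges (s : State V) : Finset (V × V) := s.sets .edges

def State.gone (s : State V) : Finset V := s.sets .gone

/-! ### Reading the memory after an update -/

@[simp] theorem setSet_reg (s : State V) (a : Loc V) (X : Finset a.Elem) :
    (s.setSet a X).reg = s.reg := rfl

@[simp] theorem setReg_sets (s : State V) (r : Reg V) (k : ℕ) : (s.setReg r k).sets = s.sets := rfl

@[simp] theorem setSet_sets_self (s : State V) (a : Loc V) (X : Finset a.Elem) :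
    (s.setSet a X).sets a = X := by
  simp [State.setSet]

@[simp] theorem setSet_sets_of_ne (s : State V) {a b : Loc V} (X : Finset a.Elem) (h : b ≠ a) :
    (s.setSet a X).sets b = s.sets b := by
  simp [State.setSet, h]

@[simp] theorem setReg_reg_self (s : State V) (r : Reg V) (k : ℕ) :
    (s.setReg r k).reg r = k := by
  simp [State.setReg]

@[simp] theorem setReg_reg_of_ne (s : State V) {r r' : Reg V} (k : ℕ) (h : r' ≠ r) :
    (s.setReg r k).reg r' = s.reg r' := by
  simp [State.setReg, h]

/-- The state after the insertion of `x` into the set at address `a`. -/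
noncomputable def State.ins (s : State V) (a : Loc V) (x : a.Elem) : State V :=
  s.setSet a (insert x (s.sets a))

/-- The state after the deletion of `x` from the set at address `a`. -/
noncomputable def State.del (s : State V) (a : Loc V) (x : a.Elem) : State V :=
  s.setSet a ((s.sets a).erase x)

@[simp] theorem ins_reg (s : State V) (a : Loc V) (x : a.Elem) : (s.ins a x).reg = s.reg := rfl

@[simp] theorem del_reg (s : State V) (a : Loc V) (x : a.Elem) : (s.del a x).reg = s.reg := rfl

@[simp] theorem ins_sets_self (s : State V) (a : Loc V) (x : a.Elem) :
    (s.ins a x).sets a = insert x (s.sets a) := setSet_sets_self _ _ _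

@[simp] theorem del_sets_self (s : State V) (a : Loc V) (x : a.Elem) :
    (s.del a x).sets a = (s.sets a).erase x := setSet_sets_self _ _ _

@[simp] theorem ins_sets_of_ne (s : State V) {a b : Loc V} (x : a.Elem) (h : b ≠ a) :
    (s.ins a x).sets b = s.sets b := setSet_sets_of_ne _ _ h

@[simp] theorem del_sets_of_ne (s : State V) {a b : Loc V} (x : a.Elem) (h : b ≠ a) :
    (s.del a x).sets b = s.sets b := setSet_sets_of_ne _ _ h

@[simp] theorem sets_verts (s : State V) : s.sets .verts = s.verts := rfl

@[simp] theorem setReg_verts (s : State V) (r : Reg V) (k : ℕ) : (s.setReg r k).verts = s.verts := rfl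

@[simp] theorem sets_nbr (s : State V) (i : V) : s.sets (.nbr i) = s.nbr i := rfl

@[simp] theorem setReg_nbr (s : State V) (r : Reg V) (k : ℕ) (i : V) :
    (s.setReg r k).nbr i = s.nbr i := rfl

@[simp] theorem ins_nbr_of_ne (s : State V) {a : Loc V} (x : a.Elem) {i : V}
    (h : .nbr i ≠ a) : (s.ins a x).nbr i = s.nbr i := ins_sets_of_ne s x h

@[simp] theorem del_nbr_of_ne (s : State V) {a : Loc V} (x : a.Elem) {i : V}
    (h : .nbr i ≠ a) : (s.del a x).nbr i = s.nbr i := del_sets_of_ne s x h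

@[simp] theorem sets_ord (s : State V) (i : ℕ) : s.sets (.ord i) = s.ord i := rfl

@[simp] theorem setReg_ord (s : State V) (r : Reg V) (k : ℕ) (i : ℕ) :
    (s.setReg r k).ord i = s.ord i := rfl

@[simp] theorem ins_ord_of_ne (s : State V) {a : Loc V} (x : a.Elem) {i : ℕ}
    (h : .ord i ≠ a) : (s.ins a x).ord i = s.ord i := ins_sets_of_ne s x h

@[simp] theorem del_ord_of_ne (s : State V) {a : Loc V} (x : a.Elem) {i : ℕ}
    (h : .ord i ≠ a) : (s.del a x).ord i = s.ord i := del_sets_of_ne s x h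

@[simp] theorem mem_ins_ord (s : State V) (i j : ℕ) (x y : V) :
    y ∈ (s.ins (.ord i) x).ord j ↔ (j = i ∧ y = x) ∨ y ∈ s.ord j := by
  by_cases h : j = i
  · subst h; simp [State.ord, -sets_ord]
  · simp [h]

@[simp] theorem sets_M (s : State V) (i : V) : s.sets (.M i) = s.M i := rfl

@[simp] theorem setReg_M (s : State V) (r : Reg V) (k : ℕ) (i : V) :
    (s.setReg r k).M i = s.M i := rfl

@[simp] theorem ins_M_of_ne (s : State V) {a : Loc V} (x : a.Elem) {i : V}
    (h : .M i ≠ a) : (s.ins a x).M i = s.M i := ins_sets_of_ne s x h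

@[simp] theorem del_M_of_ne (s : State V) {a : Loc V} (x : a.Elem) {i : V}
    (h : .M i ≠ a) : (s.del a x).M i = s.M i := del_sets_of_ne s x h

@[simp] theorem mem_ins_M (s : State V) (i j : V) (x y : V) :
    y ∈ (s.ins (.M i) x).M j ↔ (j = i ∧ y = x) ∨ y ∈ s.M j := by
  by_cases h : j = i
  · subst h; simp [State.M, -sets_M]
  · simp [h]

@[simp] theorem mem_del_M (s : State V) (i j : V) (x y : V) :
    y ∈ (s.del (.M i) x).M j ↔ ¬ (j = i ∧ y = x) ∧ y ∈ s.M j := by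
  by_cases h : j = i
  · subst h; simp [State.M, -sets_M]
  · simp [h]

@[simp] theorem sets_back (s : State V) (i : V) : s.sets (.back i) = s.back i := rfl

@[simp] theorem setReg_back (s : State V) (r : Reg V) (k : ℕ) (i : V) :
    (s.setReg r k).back i = s.back i := rfl

@[simp] theorem ins_back_of_ne (s : State V) {a : Loc V} (x : a.Elem) {i : V}
    (h : .back i ≠ a) : (s.ins a x).back i = s.back i := ins_sets_of_ne s x h

@[simp] theorem mem_ins_back (s : State V) (i j : V) (x y : V) :
    y ∈ (s.ins (.back i) x).back j ↔ (j = i ∧ y = x) ∨ y ∈ s.back j := by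
  by_cases h : j = i
  · subst h; simp [State.back, -sets_back]
  · simp [h]

@[simp] theorem sets_C (s : State V) (i : ℕ) : s.sets (.C i) = s.C i := rfl

@[simp] theorem setReg_C (s : State V) (r : Reg V) (k : ℕ) (i : ℕ) :
    (s.setReg r k).C i = s.C i := rfl

@[simp] theorem ins_C_of_ne (s : State V) {a : Loc V} (x : a.Elem) {i : ℕ}
    (h : .C i ≠ a) : (s.ins a x).C i = s.C i := ins_sets_of_ne s x h

@[simp] theorem del_C_of_ne (s : State V) {a : Loc V} (x : a.Elem) {i : ℕ}
    (h : .C i ≠ a) : (s.del a x).C i = s.C i := del_sets_of_ne s x h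

@[simp] theorem ins_C_self (s : State V) (i : ℕ) (x : V) :
    (s.ins (.C i) x).C i = insert x (s.C i) := ins_sets_self _ _ _

@[simp] theorem mem_ins_C (s : State V) (i j : ℕ) (x y : V) :
    y ∈ (s.ins (.C i) x).C j ↔ (j = i ∧ y = x) ∨ y ∈ s.C j := by
  by_cases h : j = i
  · subst h; simp [State.C, -sets_C]
  · simp [h]

@[simp] theorem sets_L (s : State V) (i : V) : s.sets (.L i) = s.L i := rfl

@[simp] theorem setReg_L (s : State V) (r : Reg V) (k : ℕ) (i : V) :
    (s.setReg r k).L i = s.L i := rfl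

@[simp] theorem ins_L_of_ne (s : State V) {a : Loc V} (x : a.Elem) {i : V}
    (h : .L i ≠ a) : (s.ins a x).L i = s.L i := ins_sets_of_ne s x h

@[simp] theorem mem_ins_L (s : State V) (i j : V) (x y : ℕ) :
    y ∈ (s.ins (.L i) x).L j ↔ (j = i ∧ y = x) ∨ y ∈ s.L j := by
  by_cases h : j = i
  · subst h; simp [State.L, -sets_L]
  · simp [h]

@[simp] theorem sets_Q (s : State V) (i : ℕ) : s.sets (.Q i) = s.Q i := rfl

@[simp] theorem setReg_Q (s : State V) (r : Reg V) (k : ℕ) (i : ℕ) :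
    (s.setReg r k).Q i = s.Q i := rfl

@[simp] theorem ins_Q_of_ne (s : State V) {a : Loc V} (x : a.Elem) {i : ℕ}
    (h : .Q i ≠ a) : (s.ins a x).Q i = s.Q i := ins_sets_of_ne s x h

@[simp] theorem ins_Q_self (s : State V) (i : ℕ) (x : V) :
    (s.ins (.Q i) x).Q i = insert x (s.Q i) := ins_sets_self _ _ _

@[simp] theorem sets_D (s : State V) (i : ℕ) : s.sets (.D i) = s.D i := rfl

@[simp] theorem setReg_D (s : State V) (r : Reg V) (k : ℕ) (i : ℕ) :
    (s.setReg r k).D i = s.D i := rfl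

@[simp] theorem ins_D_of_ne (s : State V) {a : Loc V} (x : a.Elem) {i : ℕ}
    (h : .D i ≠ a) : (s.ins a x).D i = s.D i := ins_sets_of_ne s x h

@[simp] theorem del_D_of_ne (s : State V) {a : Loc V} (x : a.Elem) {i : ℕ}
    (h : .D i ≠ a) : (s.del a x).D i = s.D i := del_sets_of_ne s x h

@[simp] theorem mem_ins_D (s : State V) (i j : ℕ) (x y : V) :
    y ∈ (s.ins (.D i) x).D j ↔ (j = i ∧ y = x) ∨ y ∈ s.D j := by
  by_cases h : j = i
  · subst h; simp [State.D, -sets_D]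
  · simp [h]

@[simp] theorem mem_del_D (s : State V) (i j : ℕ) (x y : V) :
    y ∈ (s.del (.D i) x).D j ↔ ¬ (j = i ∧ y = x) ∧ y ∈ s.D j := by
  by_cases h : j = i
  · subst h; simp [State.D, -sets_D]
  · simp [h]

@[simp] theorem sets_A (s : State V) (i : V) : s.sets (.A i) = s.A i := rfl

@[simp] theorem setReg_A (s : State V) (r : Reg V) (k : ℕ) (i : V) :
    (s.setReg r k).A i = s.A i := rfl

@[simp] theorem ins_A_of_ne (s : State V) {a : Loc V} (x : a.Elem) {i : V}
    (h : .A i ≠ a) : (s.ins a x).A i = s.A i := ins_sets_of_ne s x h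

@[simp] theorem del_A_of_ne (s : State V) {a : Loc V} (x : a.Elem) {i : V}
    (h : .A i ≠ a) : (s.del a x).A i = s.A i := del_sets_of_ne s x h

@[simp] theorem mem_ins_A (s : State V) (i j : V) (x y : ℕ) :
    y ∈ (s.ins (.A i) x).A j ↔ (j = i ∧ y = x) ∨ y ∈ s.A j := by
  by_cases h : j = i
  · subst h; simp [State.A, -sets_A]
  · simp [h]

@[simp] theorem mem_del_A (s : State V) (i j : V) (x y : ℕ) :
    y ∈ (s.del (.A i) x).A j ↔ ¬ (j = i ∧ y = x) ∧ y ∈ s.A j := by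
  by_cases h : j = i
  · subst h; simp [State.A, -sets_A]
  · simp [h]

@[simp] theorem sets_bucket (s : State V) (i : ℕ) : s.sets (.bucket i) = s.bucket i := rfl

@[simp] theorem setReg_bucket (s : State V) (r : Reg V) (k : ℕ) (i : ℕ) :
    (s.setReg r k).bucket i = s.bucket i := rfl

@[simp] theorem ins_bucket_of_ne (s : State V) {a : Loc V} (x : a.Elem) {i : ℕ}
    (h : .bucket i ≠ a) : (s.ins a x).bucket i = s.bucket i := ins_sets_of_ne s x h

@[simp] theorem del_bucket_of_ne (s : State V) {a : Loc V} (x : a.Elem) {i : ℕ}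
    (h : .bucket i ≠ a) : (s.del a x).bucket i = s.bucket i := del_sets_of_ne s x h

@[simp] theorem mem_ins_bucket (s : State V) (i j : ℕ) (x y : V) :
    y ∈ (s.ins (.bucket i) x).bucket j ↔ (j = i ∧ y = x) ∨ y ∈ s.bucket j := by
  by_cases h : j = i
  · subst h; simp [State.bucket, -sets_bucket]
  · simp [h]

@[simp] theorem mem_del_bucket (s : State V) (i j : ℕ) (x y : V) :
    y ∈ (s.del (.bucket i) x).bucket j ↔ ¬ (j = i ∧ y = x) ∧ y ∈ s.bucket j := by
  by_cases h : j = i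
  · subst h; simp [State.bucket, -sets_bucket]
  · simp [h]

@[simp] theorem sets_S (s : State V) : s.sets .S = s.S := rfl

@[simp] theorem setReg_S (s : State V) (r : Reg V) (k : ℕ) : (s.setReg r k).S = s.S := rfl

@[simp] theorem ins_S_self (s : State V) (x : V) :
    (s.ins .S x).S = insert x s.S := ins_sets_self _ _ _

@[simp] theorem mem_ins_S (s : State V) (x y : V) :
    y ∈ (s.ins .S x).S ↔ y = x ∨ y ∈ s.S := by
  simp [State.S, -sets_S]

@[simp] theorem sets_T (s : State V) : s.sets .T = s.T := rfl

@[simp] theorem setReg_T (s : State V) (r : Reg V) (k : ℕ) : (s.setReg r k).T = s.T := rfl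

@[simp] theorem ins_T_of_ne (s : State V) {a : Loc V} (x : a.Elem) (h : .T ≠ a) :
    (s.ins a x).T = s.T := ins_sets_of_ne s x h

@[simp] theorem del_T_of_ne (s : State V) {a : Loc V} (x : a.Elem) (h : .T ≠ a) :
    (s.del a x).T = s.T := del_sets_of_ne s x h

@[simp] theorem del_T_self (s : State V) (x : V) :
    (s.del .T x).T = s.T.erase x := del_sets_self _ _ _

@[simp] theorem mem_ins_T (s : State V) (x y : V) :
    y ∈ (s.ins .T x).T ↔ y = x ∨ y ∈ s.T := by
  simp [State.T, -sets_T]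

@[simp] theorem sets_sel (s : State V) : s.sets .sel = s.sel := rfl

@[simp] theorem setReg_sel (s : State V) (r : Reg V) (k : ℕ) : (s.setReg r k).sel = s.sel := rfl

@[simp] theorem mem_ins_sel (s : State V) (x y : ℕ) :
    y ∈ (s.ins .sel x).sel ↔ y = x ∨ y ∈ s.sel := by
  simp [State.sel, -sets_sel]

@[simp] theorem mem_del_sel (s : State V) (x y : ℕ) :
    y ∈ (s.del .sel x).sel ↔ y ≠ x ∧ y ∈ s.sel := by
  simp [State.sel, -sets_sel]

@[simp] theorem sets_edges (s : State V) : s.sets .edges = s.edges := rfl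

@[simp] theorem setReg_edges (s : State V) (r : Reg V) (k : ℕ) : (s.setReg r k).edges = s.edges := rfl

@[simp] theorem mem_ins_edges (s : State V) (x y : V × V) :
    y ∈ (s.ins .edges x).edges ↔ y = x ∨ y ∈ s.edges := by
  simp [State.edges, -sets_edges]

@[simp] theorem sets_gone (s : State V) : s.sets .gone = s.gone := rfl

@[simp] theorem setReg_gone (s : State V) (r : Reg V) (k : ℕ) : (s.setReg r k).gone = s.gone := rfl

@[simp] theorem ins_gone_of_ne (s : State V) {a : Loc V} (x : a.Elem) (h : .gone ≠ a) :
    (s.ins a x).gone = s.gone := ins_sets_of_ne s x h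

@[simp] theorem del_gone_of_ne (s : State V) {a : Loc V} (x : a.Elem) (h : .gone ≠ a) :
    (s.del a x).gone = s.gone := del_sets_of_ne s x h

@[simp] theorem ins_gone_self (s : State V) (x : V) :
    (s.ins .gone x).gone = insert x s.gone := ins_sets_self _ _ _

@[simp] theorem setReg_pos (s : State V) (i j : V) (k : ℕ) :
    (s.setReg (.pos i) k).reg (.pos j) = if j = i then k else s.reg (.pos j) := by
  split_ifs with h
  · subst h; simp
  · simp [h]

/-! ### Existence of runs and weakest preconditions -/

theorem iter_nonempty {α : Type} {f : α → State V → Set (Outcome V)}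
    (hf : ∀ x s, (f x s).Nonempty) (l : List α) : ∀ s, (iter f l s).Nonempty := by
  induction l with
  | nil => intro s; exact ⟨_, rfl⟩
  | cons x l ih =>
    intro s
    obtain ⟨o₁, h₁⟩ := hf x s
    obtain ⟨o₂, h₂⟩ := ih o₁.final
    exact ⟨_, o₁, h₁, o₂, h₂, rfl⟩

/-- `Correct` demands a run, and `wpS_seq` needs a continuation of every run of its first half. -/
theorem exec_nonempty (c : Cmd V) : ∀ s, (exec c s).Nonempty := by
  induction c with
  | skip | insert | erase | reset | incr | decr | copy =>
    intro s; simp [exec]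
  | seq c₁ c₂ ih₁ ih₂ =>
    intro s
    obtain ⟨o₁, h₁⟩ := ih₁ s
    obtain ⟨o₂, h₂⟩ := ih₂ o₁.final
    simp only [exec]
    exact ⟨_, o₁, h₁, o₂, h₂, rfl⟩
  | ifMem a x c₁ c₂ ih₁ ih₂ =>
    intro s
    simp only [exec]
    split_ifs
    · obtain ⟨o, h⟩ := ih₁ s; exact ⟨_, o, h, rfl⟩
    · obtain ⟨o, h⟩ := ih₂ s; exact ⟨_, o, h, rfl⟩
  | pick a body c ih₁ ih₂ =>
    intro s
    simp only [exec]
    rcases (s.sets a).eq_empty_or_nonempty with h | ⟨x, hx⟩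
    · obtain ⟨o, ho⟩ := ih₂ s; exact ⟨_, .inr ⟨h, o, ho, rfl⟩⟩
    · obtain ⟨o, ho⟩ := ih₁ x s; exact ⟨_, .inl ⟨x, hx, o, ho, rfl⟩⟩
  | forEach a body ih =>
    intro s
    simp only [exec]
    obtain ⟨o, ho⟩ := iter_nonempty (fun x s => ih x s) (s.sets a).toList s
    exact ⟨_, _, (s.sets a).nodup_toList, fun x => Finset.mem_toList, o, ho, rfl⟩
  | read r body ih =>
    intro s
    simp only [exec]
    obtain ⟨o, ho⟩ := ih (s.reg r) s
    exact ⟨_, o, ho, rfl⟩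
  | forRange k body ih =>
    intro s
    simp only [exec]
    obtain ⟨o, ho⟩ := iter_nonempty (fun x s => ih x s) (List.range k) s
    exact ⟨_, o, ho, rfl⟩

/-- Every run of `c` from `s` uses at most `B` words and its final state and its number of steps
satisfy `Post`. -/
def wpS (B : ℕ∞) (c : Cmd V) (s : State V) (Post : State V → ℕ → Prop) : Prop :=
  ∀ o ∈ exec c s, o.space ≤ B ∧ Post o.final o.time

/-- The final state and the number of steps of every run of `c` from `s` satisfy `Post`. -/
abbrev wp (c : Cmd V) (s : State V) (Post : State V → ℕ → Prop) : Prop := wpS ⊤ c s Post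

theorem wpS.mono {B : ℕ∞} {c : Cmd V} {s : State V} {Post Post' : State V → ℕ → Prop}
    (h : wpS B c s Post) (hQ : ∀ s' t, Post s' t → Post' s' t) : wpS B c s Post' :=
  fun o ho => ⟨(h o ho).1, hQ _ _ (h o ho).2⟩

variable {B : ℕ∞} {s : State V} {Post : State V → ℕ → Prop}

@[simp] theorem wpS_skip : wpS B .skip s Post ↔ s.size ≤ B ∧ Post s 1 := by
  simp [wpS, exec, step]

@[simp] theorem wpS_seq {c₁ c₂ : Cmd V} : wpS B (.seq c₁ c₂) s Post ↔
    wpS B c₁ s fun s₁ t₁ => wpS B c₂ s₁ fun s₂ t₂ => Post s₂ (t₁ + t₂) := by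
  constructor
  · intro h o₁ h₁
    have hB : ∀ o₂ ∈ exec c₂ o₁.final, (o₁.andThen o₂).space ≤ B ∧
        Post o₂.final (o₁.time + o₂.time) :=
      fun o₂ h₂ => h (o₁.andThen o₂) (by simp only [exec]; exact ⟨o₁, h₁, o₂, h₂, rfl⟩)
    simp only [Outcome.andThen, max_le_iff] at hB
    -- Any run of `c₂` will do: it completes `o₁` to a run of the sequence, and the space bound of
    -- that run contains the one of `o₁`.
    obtain ⟨o₂, h₂⟩ := exec_nonempty c₂ o₁.final
    exact ⟨(hB o₂ h₂).1.1, fun o₂ h₂ => ⟨(hB o₂ h₂).1.2, (hB o₂ h₂).2⟩⟩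
  · intro h o ho
    simp only [exec] at ho
    obtain ⟨o₁, h₁, o₂, h₂, rfl⟩ := ho
    obtain ⟨a, b⟩ := h o₁ h₁
    obtain ⟨c, d⟩ := b o₂ h₂
    exact ⟨max_le a c, d⟩

@[simp] theorem wpS_insert {a : Loc V} {x : a.Elem} : wpS B (.insert a x) s Post ↔
    max s.size (s.ins a x).size ≤ B ∧ Post (s.ins a x) 1 := by
  simp [wpS, exec, step, State.ins]

@[simp] theorem wpS_erase {a : Loc V} {x : a.Elem} : wpS B (.erase a x) s Post ↔
    max s.size (s.del a x).size ≤ B ∧ Post (s.del a x) 1 := by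
  simp [wpS, exec, step, State.del]

@[simp] theorem wpS_reset {r : Reg V} : wpS B (.reset r) s Post ↔
    max s.size (s.setReg r 0).size ≤ B ∧ Post (s.setReg r 0) 1 := by
  simp [wpS, exec, step]

@[simp] theorem wpS_incr {r : Reg V} : wpS B (.incr r) s Post ↔
    max s.size (s.setReg r (s.reg r + 1)).size ≤ B ∧ Post (s.setReg r (s.reg r + 1)) 1 := by
  simp [wpS, exec, step]

@[simp] theorem wpS_decr {r : Reg V} : wpS B (.decr r) s Post ↔
    max s.size (s.setReg r (s.reg r - 1)).size ≤ B ∧ Post (s.setReg r (s.reg r - 1)) 1 := by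
  simp [wpS, exec, step]

@[simp] theorem wpS_copy {r r' : Reg V} : wpS B (.copy r r') s Post ↔
    max s.size (s.setReg r (s.reg r')).size ≤ B ∧ Post (s.setReg r (s.reg r')) 1 := by
  simp [wpS, exec, step]

@[simp] theorem wpS_read {r : Reg V} {body : ℕ → Cmd V} : wpS B (.read r body) s Post ↔
    wpS B (body (s.reg r)) s fun s' t => Post s' (1 + t) := by
  simp only [wpS, exec, Outcome.tick]
  constructor
  · exact fun h o ho => h ⟨o.final, 1 + o.time, o.space⟩ ⟨o, ho, rfl⟩
  · rintro h o ⟨o', ho, rfl⟩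
    exact h o' ho

@[simp] theorem wpS_ifMem {a : Loc V} {x : a.Elem} {c₁ c₂ : Cmd V} :
    wpS B (.ifMem a x c₁ c₂) s Post ↔
      (x ∈ s.sets a → wpS B c₁ s fun s' t => Post s' (1 + t)) ∧
      (x ∉ s.sets a → wpS B c₂ s fun s' t => Post s' (1 + t)) := by
  simp only [wpS, exec, Outcome.tick]
  constructor
  · intro h
    exact ⟨fun hx o ho => h ⟨o.final, 1 + o.time, o.space⟩ ⟨o, by simpa [hx] using ho, rfl⟩,
      fun hx o ho => h ⟨o.final, 1 + o.time, o.space⟩ ⟨o, by simpa [hx] using ho, rfl⟩⟩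
  · rintro ⟨h₁, h₂⟩ o ⟨o', ho, rfl⟩
    split_ifs at ho with hx
    · exact h₁ hx o' ho
    · exact h₂ hx o' ho

@[simp] theorem wpS_pick {a : Loc V} {body : a.Elem → Cmd V} {c : Cmd V} :
    wpS B (.pick a body c) s Post ↔
      (∀ x ∈ s.sets a, wpS B (body x) s fun s' t => Post s' (1 + t)) ∧
      (s.sets a = ∅ → wpS B c s fun s' t => Post s' (1 + t)) := by
  simp only [wpS, exec, Outcome.tick]
  constructor
  · intro h
    exact ⟨fun x hx o ho => h ⟨o.final, 1 + o.time, o.space⟩ (.inl ⟨x, hx, o, ho, rfl⟩),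
      fun he o ho => h ⟨o.final, 1 + o.time, o.space⟩ (.inr ⟨he, o, ho, rfl⟩)⟩
  · rintro ⟨h₁, h₂⟩ o (⟨x, hx, o, ho, rfl⟩ | ⟨he, o, ho, rfl⟩)
    · exact h₁ x hx o ho
    · exact h₂ he o ho

@[simp] theorem block_nil : block ([] : List (Cmd V)) = .skip := rfl

@[simp] theorem block_cons (c : Cmd V) (cs : List (Cmd V)) :
    block (c :: cs) = .seq c (block cs) := rfl

/-- The addresses of all sets and registers that `c` may write satisfy `W` and `R`. -/
def Modifies (W : Loc V → Prop) (R : Reg V → Prop) : Cmd V → Prop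
  | .skip => True
  | .seq c₁ c₂ => Modifies W R c₁ ∧ Modifies W R c₂
  | .insert a _ => W a
  | .erase a _ => W a
  | .ifMem _ _ c₁ c₂ => Modifies W R c₁ ∧ Modifies W R c₂
  | .pick _ body c => (∀ x, Modifies W R (body x)) ∧ Modifies W R c
  | .forEach _ body => ∀ x, Modifies W R (body x)
  | .reset r => R r
  | .incr r => R r
  | .decr r => R r
  | .copy r _ => R r
  | .read _ body => ∀ k, Modifies W R (body k)
  | .forRange k body => ∀ i, i < k → Modifies W R (body i)

/-- The states agree outside `W` and `R`. -/
structure Frame (W : Loc V → Prop) (R : Reg V → Prop) (s s' : State V) : Prop where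
  sets : ∀ a, ¬ W a → s'.sets a = s.sets a
  reg : ∀ r, ¬ R r → s'.reg r = s.reg r

/-- For a concrete `W` the side condition is discharged by its default `simp`, here and in the
analogues for the other sets. -/
theorem Frame.verts {W : Loc V → Prop} {R : Reg V → Prop} {s s' : State V} (h : Frame W R s s')
    (hw : ¬ W .verts := by simp) : s'.verts = s.verts := h.sets _ hw

theorem Frame.nbr {W : Loc V → Prop} {R : Reg V → Prop} {s s' : State V} (h : Frame W R s s')
    (i : V) (hw : ¬ W (.nbr i) := by simp) : s'.nbr i = s.nbr i := h.sets _ hw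

theorem Frame.ord {W : Loc V → Prop} {R : Reg V → Prop} {s s' : State V} (h : Frame W R s s')
    (i : ℕ) (hw : ¬ W (.ord i) := by simp) : s'.ord i = s.ord i := h.sets _ hw

theorem Frame.M {W : Loc V → Prop} {R : Reg V → Prop} {s s' : State V} (h : Frame W R s s')
    (i : V) (hw : ¬ W (.M i) := by simp) : s'.M i = s.M i := h.sets _ hw

theorem Frame.back {W : Loc V → Prop} {R : Reg V → Prop} {s s' : State V} (h : Frame W R s s')
    (i : V) (hw : ¬ W (.back i) := by simp) : s'.back i = s.back i := h.sets _ hw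

theorem Frame.C {W : Loc V → Prop} {R : Reg V → Prop} {s s' : State V} (h : Frame W R s s')
    (i : ℕ) (hw : ¬ W (.C i) := by simp) : s'.C i = s.C i := h.sets _ hw

theorem Frame.L {W : Loc V → Prop} {R : Reg V → Prop} {s s' : State V} (h : Frame W R s s')
    (i : V) (hw : ¬ W (.L i) := by simp) : s'.L i = s.L i := h.sets _ hw

theorem Frame.Q {W : Loc V → Prop} {R : Reg V → Prop} {s s' : State V} (h : Frame W R s s')
    (i : ℕ) (hw : ¬ W (.Q i) := by simp) : s'.Q i = s.Q i := h.sets _ hw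

theorem Frame.D {W : Loc V → Prop} {R : Reg V → Prop} {s s' : State V} (h : Frame W R s s')
    (i : ℕ) (hw : ¬ W (.D i) := by simp) : s'.D i = s.D i := h.sets _ hw

theorem Frame.A {W : Loc V → Prop} {R : Reg V → Prop} {s s' : State V} (h : Frame W R s s')
    (i : V) (hw : ¬ W (.A i) := by simp) : s'.A i = s.A i := h.sets _ hw

theorem Frame.bucket {W : Loc V → Prop} {R : Reg V → Prop} {s s' : State V} (h : Frame W R s s')
    (i : ℕ) (hw : ¬ W (.bucket i) := by simp) : s'.bucket i = s.bucket i := h.sets _ hw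

theorem Frame.S {W : Loc V → Prop} {R : Reg V → Prop} {s s' : State V} (h : Frame W R s s')
    (hw : ¬ W .S := by simp) : s'.S = s.S := h.sets _ hw

theorem Frame.T {W : Loc V → Prop} {R : Reg V → Prop} {s s' : State V} (h : Frame W R s s')
    (hw : ¬ W .T := by simp) : s'.T = s.T := h.sets _ hw

theorem Frame.sel {W : Loc V → Prop} {R : Reg V → Prop} {s s' : State V} (h : Frame W R s s')
    (hw : ¬ W .sel := by simp) : s'.sel = s.sel := h.sets _ hw

theorem Frame.edges {W : Loc V → Prop} {R : Reg V → Prop} {s s' : State V} (h : Frame W R s s')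
    (hw : ¬ W .edges := by simp) : s'.edges = s.edges := h.sets _ hw

theorem Frame.gone {W : Loc V → Prop} {R : Reg V → Prop} {s s' : State V} (h : Frame W R s s')
    (hw : ¬ W .gone := by simp) : s'.gone = s.gone := h.sets _ hw

theorem Frame.refl {W : Loc V → Prop} {R : Reg V → Prop} (s : State V) : Frame W R s s :=
  ⟨fun _ _ => rfl, fun _ _ => rfl⟩

theorem Frame.trans {W : Loc V → Prop} {R : Reg V → Prop} {s s' s'' : State V}
    (h : Frame W R s s') (h' : Frame W R s' s'') : Frame W R s s'' :=
  ⟨fun a ha => (h'.sets a ha).trans (h.sets a ha), fun r hr => (h'.reg r hr).trans (h.reg r hr)⟩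

theorem Frame.mono {W W' : Loc V → Prop} {R R' : Reg V → Prop} {s s' : State V}
    (h : Frame W R s s') (hW : ∀ a, W a → W' a) (hR : ∀ r, R r → R' r) : Frame W' R' s s' :=
  ⟨fun a ha => h.sets a fun h => ha (hW a h), fun r hr => h.reg r fun h => hr (hR r h)⟩

theorem frame_setSet {W : Loc V → Prop} {R : Reg V → Prop} (s : State V) {a : Loc V}
    (X : Finset a.Elem) (ha : W a) : Frame W R s (s.setSet a X) :=
  ⟨fun b hb => setSet_sets_of_ne s X (by rintro rfl; exact hb ha), fun _ _ => rfl⟩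

theorem frame_setReg {W : Loc V → Prop} {R : Reg V → Prop} (s : State V) {r : Reg V}
    (k : ℕ) (hr : R r) : Frame W R s (s.setReg r k) :=
  ⟨fun _ _ => rfl, fun b hb => setReg_reg_of_ne s k (by rintro rfl; exact hb hr)⟩

theorem frame_iter {α : Type} {f : α → State V → Set (Outcome V)} {W : Loc V → Prop}
    {R : Reg V → Prop} {l : List α} (hf : ∀ x ∈ l, ∀ s, ∀ o ∈ f x s, Frame W R s o.final) :
    ∀ s, ∀ o ∈ iter f l s, Frame W R s o.final := by
  induction l with
  | nil => rintro s o rfl; exact .refl _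
  | cons x l ih =>
    rintro s o ⟨o₁, h₁, o₂, h₂, rfl⟩
    have := ih (fun y hy => hf y (by simp [hy])) _ _ h₂
    exact (hf x (by simp) s o₁ h₁).trans this

/-- The write sets are computed syntactically, so loop invariants need no clauses about memory that
the loop does not touch. -/
theorem frame_exec {W : Loc V → Prop} {R : Reg V → Prop} (c : Cmd V) :
    Modifies W R c → ∀ s, ∀ o ∈ exec c s, Frame W R s o.final := by
  induction c with
  | skip => rintro - s o rfl; exact .refl _
  | insert a x => rintro h s o rfl; exact frame_setSet _ _ h
  | erase a x => rintro h s o rfl; exact frame_setSet _ _ h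
  | reset | incr | decr | copy => rintro h s o rfl; exact frame_setReg _ _ h
  | seq c₁ c₂ ih₁ ih₂ =>
    rintro ⟨m₁, m₂⟩ s o h
    simp only [exec] at h
    obtain ⟨o₁, h₁, o₂, h₂, rfl⟩ := h
    have := ih₂ m₂ _ _ h₂
    exact (ih₁ m₁ _ _ h₁).trans this
  | ifMem a x c₁ c₂ ih₁ ih₂ =>
    rintro ⟨m₁, m₂⟩ s o h
    simp only [exec] at h
    obtain ⟨o', h, rfl⟩ := h
    split_ifs at h
    · have := ih₁ m₁ _ _ h; exact this
    · have := ih₂ m₂ _ _ h; exact this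
  | pick a body c ih₁ ih₂ =>
    rintro ⟨m₁, m₂⟩ s o h
    simp only [exec] at h
    obtain ⟨x, -, o', h, rfl⟩ | ⟨-, o', h, rfl⟩ := h
    · have := ih₁ x (m₁ x) _ _ h; exact this
    · have := ih₂ m₂ _ _ h; exact this
  | forEach a body ih =>
    rintro m s o h
    simp only [exec] at h
    obtain ⟨l, -, -, o', h, rfl⟩ := h
    have := frame_iter (fun x _ => ih x (m x)) _ _ h; exact this
  | read r body ih =>
    rintro m s o h
    simp only [exec] at h
    obtain ⟨o', h, rfl⟩ := h
    have := ih _ (m _) _ _ h; exact this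
  | forRange k body ih =>
    rintro m s o h
    simp only [exec] at h
    obtain ⟨o', h, rfl⟩ := h
    have := frame_iter (fun x hx => ih x (m x (List.mem_range.1 hx))) _ _ h; exact this

theorem wpS.frame {W : Loc V → Prop} {R : Reg V → Prop} {c : Cmd V}
    (h : wpS B c s Post) (hm : Modifies W R c) :
    wpS B c s fun s' t => Post s' t ∧ Frame W R s s' :=
  fun o ho => ⟨(h o ho).1, (h o ho).2, frame_exec c hm s o ho⟩

/-! ### Loop rules -/

theorem iter_rule {α : Type} {f : α → State V → Set (Outcome V)} {l : List α}
    (I : List α → State V → ℕ → Prop)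
    (hstep : ∀ p x q s t, l = p ++ x :: q → I p s t →
      ∀ o ∈ f x s, o.space ≤ B ∧ I (p ++ [x]) o.final (t + o.time + 1))
    (hsize : ∀ p s t, I p s t → s.size ≤ B) :
    -- The step for leaving the loop is paid in advance, hence `t + 1`; this is why the loop rules
    -- below start their invariants at time `1`.
    ∀ q p s t, l = p ++ q → I p s (t + 1) →
      ∀ o ∈ iter f q s, o.space ≤ B ∧ I l o.final (t + o.time) := by
  intro q
  induction q with
  | nil =>
    rintro p s t hl h o rfl
    have := hsize _ _ _ h
    simp only [List.append_nil] at hl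
    subst hl
    simpa [step] using ⟨this, h⟩
  | cons x q ih =>
    rintro p s t hl h o ⟨o₁, h₁, o₂, h₂, rfl⟩
    obtain ⟨hs, h'⟩ := hstep p x q s _ hl h o₁ h₁
    obtain ⟨hs', h''⟩ := ih (p ++ [x]) o₁.final (t + 1 + o₁.time) (by simp [hl]) h' o₂ h₂
    refine ⟨max_le hs hs', ?_⟩
    simp only [Outcome.tick, Outcome.andThen]
    convert h'' using 1
    omega

/-- The order of traversal is arbitrary, so the invariant sees only the set of visited elements. The
body gets `B'` words; the rest of `B` holds the copy of the traversed set. -/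
theorem wpS_forEach {B' : ℕ∞} {a : Loc V} {body : a.Elem → Cmd V}
    (I : Finset a.Elem → State V → ℕ → Prop)
    (hB : B' + (s.sets a).card ≤ B)
    (h0 : I ∅ s 1)
    (hstep : ∀ P x s₁ t₁, x ∈ s.sets a → x ∉ P → P ⊆ s.sets a → I P s₁ t₁ →
      wpS B' (body x) s₁ fun s₂ t₂ => I (insert x P) s₂ (t₁ + t₂ + 1))
    (hsize : ∀ P s t, I P s t → s.size ≤ B') :
    wpS B (.forEach a body) s fun s' t => I (s.sets a) s' t := by
  intro o ho
  simp only [exec] at ho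
  obtain ⟨l, hn, hl, o', ho, rfl⟩ := ho
  have hl' : l.toFinset = s.sets a := by ext x; simp [hl]
  have := iter_rule (B := B') (l := l) (fun p => I p.toFinset) ?_
    (fun p s t h => hsize _ s t h) l [] s 0 rfl (by simpa using h0) o' ho
  · simp only [hl', zero_add] at this
    exact ⟨(add_le_add_left this.1 _).trans hB, this.2⟩
  · rintro p x q s₁ t₁ rfl h o ho
    have := hstep p.toFinset x s₁ t₁ ((hl x).1 (by simp))
      (by
        have := (List.nodup_append.1 hn).2.2
        intro hx
        exact this x (by simpa using hx) x (by simp) rfl)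
      (fun y hy => (hl y).1 (by simp [List.mem_toFinset.1 hy])) h o ho
    refine ⟨this.1, ?_⟩
    have h2 := this.2
    convert h2 using 1
    ext y
    simp

theorem wp_forEach {a : Loc V} {body : a.Elem → Cmd V}
    (I : Finset a.Elem → State V → ℕ → Prop) (h0 : I ∅ s 1)
    (hstep : ∀ P x s₁ t₁, x ∈ s.sets a → x ∉ P → P ⊆ s.sets a → I P s₁ t₁ →
      wp (body x) s₁ fun s₂ t₂ => I (insert x P) s₂ (t₁ + t₂ + 1)) :
    wp (.forEach a body) s fun s' t => I (s.sets a) s' t :=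
  wpS_forEach (B' := ⊤) I le_top h0 hstep fun _ _ _ _ => le_top

/-- A loop over a set with a bound `τ` on the time of each iteration. -/
theorem wp_forEach_const {a : Loc V} {body : a.Elem → Cmd V}
    (I : Finset a.Elem → State V → Prop) (τ : ℕ) (h0 : I ∅ s)
    (hstep : ∀ P x s₁, x ∈ s.sets a → x ∉ P → P ⊆ s.sets a → I P s₁ →
      wp (body x) s₁ fun s₂ t₂ => I (insert x P) s₂ ∧ t₂ ≤ τ) :
    wp (.forEach a body) s fun s' t => I (s.sets a) s' ∧ t ≤ (s.sets a).card * (τ + 1) + 1 := by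
  refine wp_forEach (fun P s' t => I P s' ∧ t ≤ P.card * (τ + 1) + 1) ⟨h0, by simp⟩ ?_
  rintro P x s₁ t₁ hx hxP hP ⟨hI, ht⟩
  refine (hstep P x s₁ hx hxP hP hI).mono ?_
  rintro s₂ t₂ ⟨h, h'⟩
  refine ⟨h, ?_⟩
  rw [Finset.card_insert_of_notMem hxP]
  linarith

theorem wpS_forRange {B' : ℕ∞} {k : ℕ} {body : ℕ → Cmd V}
    (I : ℕ → State V → ℕ → Prop) (hB : B' + 1 ≤ B)
    (h0 : I 0 s 1)
    (hstep : ∀ i s₁ t₁, i < k → I i s₁ t₁ →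
      wpS B' (body i) s₁ fun s₂ t₂ => I (i + 1) s₂ (t₁ + t₂ + 1))
    (hsize : ∀ i s t, I i s t → s.size ≤ B') :
    wpS B (.forRange k body) s fun s' t => I k s' t := by
  intro o ho
  simp only [exec] at ho
  obtain ⟨o', ho, rfl⟩ := ho
  have := iter_rule (B := B') (l := List.range k) (fun p => I p.length) ?_
    (fun p s t h => hsize _ s t h) (List.range k) [] s 0 rfl (by simpa using h0) o' ho
  · simp only [zero_add, List.length_range] at this
    exact ⟨(add_le_add_left this.1 _).trans hB, this.2⟩
  · rintro p x q s₁ t₁ hl h o ho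
    have hx : x = p.length := by
      have := congrArg (fun l => l[p.length]?) hl
      simp only [List.getElem?_append_right le_rfl, Nat.sub_self, List.getElem?_cons_zero] at this
      obtain ⟨_, h⟩ := List.getElem?_eq_some_iff.1 this
      simpa using h.symm
    subst hx
    have hk : p.length < k := by
      have := congrArg List.length hl
      simp at this
      omega
    simpa using hstep _ s₁ t₁ hk h o ho

theorem wp_forRange {k : ℕ} {body : ℕ → Cmd V}
    (I : ℕ → State V → ℕ → Prop) (h0 : I 0 s 1)
    (hstep : ∀ i s₁ t₁, i < k → I i s₁ t₁ →
      wp (body i) s₁ fun s₂ t₂ => I (i + 1) s₂ (t₁ + t₂ + 1)) :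
    wp (.forRange k body) s fun s' t => I k s' t :=
  wpS_forRange (B' := ⊤) I le_top h0 hstep fun _ _ _ _ => le_top

/-- A counting loop with a bound `τ` on the time of each iteration. -/
theorem wp_forRange_const {k : ℕ} {body : ℕ → Cmd V}
    (I : ℕ → State V → Prop) (τ : ℕ) (h0 : I 0 s)
    (hstep : ∀ i s₁, i < k → I i s₁ → wp (body i) s₁ fun s₂ t₂ => I (i + 1) s₂ ∧ t₂ ≤ τ) :
    wp (.forRange k body) s fun s' t => I k s' ∧ t ≤ k * (τ + 1) + 1 := by
  refine wp_forRange (fun i s' t => I i s' ∧ t ≤ i * (τ + 1) + 1) ⟨h0, by simp⟩ ?_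
  rintro i s₁ t₁ hi ⟨hI, ht⟩
  refine (hstep i s₁ hi hI).mono ?_
  rintro s₂ t₂ ⟨h, h'⟩
  refine ⟨h, ?_⟩
  linarith

/-- The frame up to the current pass is handed to the body, which can then read unmodified memory as
it was before the loop. -/
theorem wp_forEach_frame {W : Loc V → Prop} {R : Reg V → Prop} {a : Loc V}
    {body : a.Elem → Cmd V} (hm : ∀ x, Modifies W R (body x))
    (I : Finset a.Elem → State V → ℕ → Prop) (h0 : I ∅ s 1)
    (hstep : ∀ P x s₁ t₁, x ∈ s.sets a → x ∉ P → P ⊆ s.sets a → Frame W R s s₁ → I P s₁ t₁ →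
      wp (body x) s₁ fun s₂ t₂ => I (insert x P) s₂ (t₁ + t₂ + 1)) :
    wp (.forEach a body) s fun s' t => I (s.sets a) s' t ∧ Frame W R s s' := by
  refine wp_forEach (fun P s' t => I P s' t ∧ Frame W R s s') ⟨h0, .refl s⟩ ?_
  rintro P x s₁ t₁ hx hxP hP ⟨hI, hF⟩
  exact ((hstep P x s₁ t₁ hx hxP hP hF hI).frame (hm x)).mono
    fun s₂ t₂ h => ⟨h.1, hF.trans h.2⟩

theorem wp_forEach_const_frame {W : Loc V → Prop} {R : Reg V → Prop} {a : Loc V}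
    {body : a.Elem → Cmd V} (hm : ∀ x, Modifies W R (body x))
    (I : Finset a.Elem → State V → Prop) (τ : ℕ) (h0 : I ∅ s)
    (hstep : ∀ P x s₁, x ∈ s.sets a → x ∉ P → P ⊆ s.sets a → Frame W R s s₁ → I P s₁ →
      wp (body x) s₁ fun s₂ t₂ => I (insert x P) s₂ ∧ t₂ ≤ τ) :
    wp (.forEach a body) s fun s' t =>
      (I (s.sets a) s' ∧ t ≤ (s.sets a).card * (τ + 1) + 1) ∧ Frame W R s s' := by
  refine (wp_forEach_const (fun P s' => I P s' ∧ Frame W R s s') τ ⟨h0, .refl s⟩ ?_).mono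
    fun s' t h => ⟨⟨h.1.1, h.2⟩, h.1.2⟩
  rintro P x s₁ hx hxP hP ⟨hI, hF⟩
  exact ((hstep P x s₁ hx hxP hP hF hI).frame (hm x)).mono
    fun s₂ t₂ h => ⟨⟨h.1.1, hF.trans h.2⟩, h.1.2⟩

theorem wp_forRange_frame {W : Loc V → Prop} {R : Reg V → Prop} {k : ℕ} {body : ℕ → Cmd V}
    (hm : ∀ i, i < k → Modifies W R (body i)) (I : ℕ → State V → ℕ → Prop) (h0 : I 0 s 1)
    (hstep : ∀ i s₁ t₁, i < k → Frame W R s s₁ → I i s₁ t₁ →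
      wp (body i) s₁ fun s₂ t₂ => I (i + 1) s₂ (t₁ + t₂ + 1)) :
    wp (.forRange k body) s fun s' t => I k s' t ∧ Frame W R s s' := by
  refine wp_forRange (fun i s' t => I i s' t ∧ Frame W R s s') ⟨h0, .refl s⟩ ?_
  rintro i s₁ t₁ hi ⟨hI, hF⟩
  exact ((hstep i s₁ t₁ hi hF hI).frame (hm i hi)).mono
    fun s₂ t₂ h => ⟨h.1, hF.trans h.2⟩

theorem wp_forRange_const_frame {W : Loc V → Prop} {R : Reg V → Prop} {k : ℕ}
    {body : ℕ → Cmd V} (hm : ∀ i, i < k → Modifies W R (body i)) (I : ℕ → State V → Prop)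
    (τ : ℕ) (h0 : I 0 s)
    (hstep : ∀ i s₁, i < k → Frame W R s s₁ → I i s₁ →
      wp (body i) s₁ fun s₂ t₂ => I (i + 1) s₂ ∧ t₂ ≤ τ) :
    wp (.forRange k body) s fun s' t =>
      (I k s' ∧ t ≤ k * (τ + 1) + 1) ∧ Frame W R s s' := by
  refine (wp_forRange_const (fun i s' => I i s' ∧ Frame W R s s') τ ⟨h0, .refl s⟩ ?_).mono
    fun s' t h => ⟨⟨h.1.1, h.2⟩, h.1.2⟩
  rintro i s₁ hi ⟨hI, hF⟩
  exact ((hstep i s₁ hi hF hI).frame (hm i hi)).mono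
    fun s₂ t₂ h => ⟨⟨h.1.1, hF.trans h.2⟩, h.1.2⟩

/-! ### Space -/

theorem size_setSet_insert (s : State V) (a : Loc V) (x : a.Elem) :
    (s.setSet a (insert x (s.sets a))).size ≤ s.size + 1 := by
  have : {q : (a : Loc V) × a.Elem | q.2 ∈ (s.setSet a (insert x (s.sets a))).sets q.1} ⊆
      insert ⟨a, x⟩ {q : (a : Loc V) × a.Elem | q.2 ∈ s.sets q.1} := by
    rintro ⟨b, y⟩ h
    by_cases hb : b = a
    · subst hb
      simpa using h
    · right
      simpa [hb] using h
  unfold State.size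
  calc _ ≤ _ + _ := add_le_add_left ((Set.encard_le_encard this).trans (Set.encard_insert_le _ _)) _
    _ = _ := by simp only [setSet_reg]; ring

theorem size_le_of_subset {s s' : State V} (h : ∀ a, s'.sets a ⊆ s.sets a)
    (h' : ∀ r, s'.reg r ≠ 0 → s.reg r ≠ 0) : s'.size ≤ s.size :=
  add_le_add (Set.encard_le_encard fun _ hq => h _ hq) (Set.encard_le_encard fun r => h' r)

theorem size_setReg (s : State V) (r : Reg V) (k : ℕ) : (s.setReg r k).size ≤ s.size + 1 := by
  have : {r' | (s.setReg r k).reg r' ≠ 0} ⊆ insert r {r' | s.reg r' ≠ 0} := by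
    intro r' h
    by_cases hb : r' = r
    · exact .inl hb
    · right
      simpa [hb] using h
  unfold State.size
  rw [add_assoc]
  exact add_le_add_right ((Set.encard_le_encard this).trans (Set.encard_insert_le _ _)) _

/-- Loops are nested in `c` at most `k`-fold. -/
def NestingLE : ℕ → Cmd V → Prop
  | _, .skip => True
  | k, .seq c₁ c₂ => NestingLE k c₁ ∧ NestingLE k c₂
  | _, .insert _ _ => True
  | _, .erase _ _ => True
  | k, .ifMem _ _ c₁ c₂ => NestingLE k c₁ ∧ NestingLE k c₂
  | k, .pick _ body c => (∀ x, NestingLE k (body x)) ∧ NestingLE k c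
  | k, .forEach _ body => ∃ k', k = k' + 1 ∧ ∀ x, NestingLE k' (body x)
  | _, .reset _ => True
  | _, .incr _ => True
  | _, .decr _ => True
  | _, .copy _ _ => True
  | k, .read _ body => ∀ j, NestingLE k (body j)
  | k, .forRange _ body => ∃ k', k = k' + 1 ∧ ∀ i, NestingLE k' (body i)

theorem card_le_size (s : State V) (a : Loc V) : ((s.sets a).card : ℕ∞) ≤ s.size := by
  refine le_trans ?_ le_self_add
  rw [← Set.encard_coe_eq_coe_finsetCard,
    ← (sigma_mk_injective (i := a) (β := fun a : Loc V => a.Elem)).encard_image]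
  exact Set.encard_le_encard (by rintro _ ⟨x, hx, rfl⟩; exact hx)

/-- Growth of the memory by at most one word per step. -/
def Outcome.Slow (k N : ℕ) (o : Outcome V) : Prop :=
  o.final.size ≤ (N + o.time : ℕ) ∧ o.space ≤ ((k + 1) * (N + o.time) + k : ℕ)

theorem slow_step {s s' : State V} {k N : ℕ} (hs : s.size ≤ N) (h : s'.size ≤ s.size + 1) :
    (step s s').Slow k N := by
  have h' : s'.size ≤ (N + 1 : ℕ) := h.trans (by push_cast; gcongr)
  refine ⟨h', max_le (hs.trans ?_) (h'.trans ?_)⟩ <;> norm_cast <;> simp only [step] <;> nlinarith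

theorem Outcome.Slow.tick {k N : ℕ} {o : Outcome V} (h : o.Slow k N) : o.tick.Slow k N := by
  refine ⟨h.1.trans ?_, h.2.trans ?_⟩ <;> norm_cast <;> simp only [Outcome.tick]
  · omega
  · gcongr; omega

theorem Outcome.Slow.andThen {k N : ℕ} {o₁ o₂ : Outcome V} (h₁ : o₁.Slow k N)
    (h₂ : o₂.Slow k (N + o₁.time)) : (o₁.andThen o₂).Slow k N := by
  refine ⟨h₂.1.trans ?_, max_le (h₁.2.trans ?_) (h₂.2.trans ?_)⟩ <;> norm_cast <;>
    simp only [Outcome.andThen]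
  · omega
  · gcongr; omega
  · exact le_of_eq (by ring)

theorem slow_iter {α : Type} {f : α → State V → Set (Outcome V)} {k : ℕ}
    (hf : ∀ x (s : State V) (N : ℕ), s.size ≤ N → ∀ o ∈ f x s, o.Slow k N) (l : List α) :
    ∀ (s : State V) (N : ℕ), s.size ≤ N → ∀ o ∈ iter f l s, o.Slow k N := by
  induction l with
  | nil => rintro s N hs o rfl; exact slow_step hs le_self_add
  | cons x l ih =>
    rintro s N hs o ⟨o₁, h₁, o₂, h₂, rfl⟩
    have h := hf x s N hs o₁ h₁
    exact (h.andThen (ih _ _ h.1 _ h₂)).tick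

/-- The memory proper grows by at most one word per step. At most `k` copies of traversed sets are
alive at once, none larger than the memory at the time of copying: this gives the factor `k + 1`.
The summand `k` covers the loop counters. -/
theorem slow_exec (c : Cmd V) : ∀ k, NestingLE k c → ∀ (s : State V) (N : ℕ), s.size ≤ N →
    ∀ o ∈ exec c s, o.Slow k N := by
  induction c with
  | skip => rintro k - s N hs o rfl; exact slow_step hs le_self_add
  | insert a x => rintro k - s N hs o rfl; exact slow_step hs (size_setSet_insert s a x)
  | erase a x =>
    rintro k - s N hs o rfl
    have h : (s.setSet a ((s.sets a).erase x)).size ≤ s.size := by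
      refine size_le_of_subset (fun b => ?_) fun r h => h
      by_cases hb : b = a
      · subst hb
        simpa using Finset.erase_subset _ _
      · simp [hb]
    exact slow_step hs (h.trans le_self_add)
  | reset | incr | decr | copy =>
    rintro k - s N hs o rfl; exact slow_step hs (size_setReg _ _ _)
  | seq c₁ c₂ ih₁ ih₂ =>
    rintro k ⟨m₁, m₂⟩ s N hs o h
    simp only [exec] at h
    obtain ⟨o₁, h₁, o₂, h₂, rfl⟩ := h
    have h := ih₁ k m₁ s N hs o₁ h₁
    exact h.andThen (ih₂ k m₂ _ _ h.1 _ h₂)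
  | ifMem a x c₁ c₂ ih₁ ih₂ =>
    rintro k ⟨m₁, m₂⟩ s N hs o h
    simp only [exec] at h
    obtain ⟨o', h, rfl⟩ := h
    split_ifs at h
    · exact (ih₁ k m₁ _ _ hs _ h).tick
    · exact (ih₂ k m₂ _ _ hs _ h).tick
  | pick a body c ih₁ ih₂ =>
    rintro k ⟨m₁, m₂⟩ s N hs o h
    simp only [exec] at h
    obtain ⟨x, -, o', h, rfl⟩ | ⟨-, o', h, rfl⟩ := h
    · exact (ih₁ x k (m₁ x) _ _ hs _ h).tick
    · exact (ih₂ k m₂ _ _ hs _ h).tick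
  | forEach a body ih =>
    rintro k ⟨k', rfl, m⟩ s N hs o h
    simp only [exec] at h
    obtain ⟨l, -, -, o', h, rfl⟩ := h
    have := slow_iter (fun x s N hs => ih x k' (m x) s N hs) l s N hs o' h
    refine ⟨this.1, (add_le_add this.2 ((card_le_size s a).trans hs)).trans ?_⟩
    norm_cast
    simp only
    nlinarith
  | read r body ih =>
    rintro k m s N hs o h
    simp only [exec] at h
    obtain ⟨o', h, rfl⟩ := h
    exact (ih _ k (m _) _ _ hs _ h).tick
  | forRange j body ih =>
    rintro k ⟨k', rfl, m⟩ s N hs o h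
    simp only [exec] at h
    obtain ⟨o', h, rfl⟩ := h
    have := slow_iter (fun x s N hs => ih x k' (m x) s N hs) (List.range j) s N hs o' h
    refine ⟨this.1, (add_le_add_left this.2 _).trans ?_⟩
    norm_cast
    simp only
    nlinarith

/-- A run of bounded time uses little space. -/
theorem wp.space {c : Cmd V} {k N T : ℕ} (h : wp c s Post) (hQ : ∀ s' t, Post s' t → t ≤ T)
    (hk : NestingLE k c) (hs : s.size ≤ N) (hB : (((k + 1) * (N + T) + k : ℕ) : ℕ∞) ≤ B) :
    wpS B c s fun s' t => Post s' t ∧ s'.size ≤ (N + T : ℕ) := by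
  intro o ho
  have h1 := (h o ho).2
  have h2 := hQ _ _ h1
  obtain ⟨h3, h4⟩ := slow_exec c k hk s N hs o ho
  refine ⟨(h4.trans ?_).trans hB, h1, h3.trans ?_⟩
  · norm_cast; gcongr
  · norm_cast; gcongr

/-- The memory in use grows by at most the sets at the addresses `F` and the registers `R`. -/
theorem size_le_add {s s' : State V} (F : Finset (Loc V)) (R : Finset (Reg V))
    (hF : ∀ a ∉ F, s'.sets a ⊆ s.sets a) (hR : ∀ r ∉ R, s'.reg r ≠ 0 → s.reg r ≠ 0) :
    s'.size ≤ s.size + (∑ a ∈ F, (s'.sets a).card + R.card : ℕ) := by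
  have h1 : {q : (a : Loc V) × a.Elem | q.2 ∈ s'.sets q.1} ⊆
      {q | q.2 ∈ s.sets q.1} ∪ (F.sigma s'.sets : Finset ((a : Loc V) × a.Elem)) := by
    rintro ⟨b, y⟩ h
    by_cases hb : b ∈ F
    · right
      simpa [hb] using h
    · exact .inl (hF b hb h)
  have h2 : {r | s'.reg r ≠ 0} ⊆ {r | s.reg r ≠ 0} ∪ (R : Set (Reg V)) := by
    intro r h
    by_cases hr : r ∈ R
    · exact .inr hr
    · exact .inl (hR r hr h)
  have h1 := (Set.encard_le_encard h1).trans (Set.encard_union_le _ _)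
  have h2 := (Set.encard_le_encard h2).trans (Set.encard_union_le _ _)
  rw [Set.encard_coe_eq_coe_finsetCard] at h1 h2
  rw [Finset.card_sigma] at h1
  unfold State.size
  refine (add_le_add h1 h2).trans (le_of_eq ?_)
  push_cast
  ring

end Logic

/-! ### The local colouring -/

section Colouring

variable {V : Type} {G : SimpleGraph V}

/-- `Q 0, …, Q (r - 1)` are the colour classes of a first-fit colouring of the complement
of `G[X]`. -/
structure IsFirstFit (G : SimpleGraph V) (X : Finset V) (r : ℕ) (Q : ℕ → Finset V) : Prop where
  empty : ∀ j, r ≤ j → Q j = ∅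
  nonempty : ∀ j, j < r → (Q j).Nonempty
  mem_iff : ∀ x, x ∈ X ↔ ∃ j < r, x ∈ Q j
  disj : ∀ j j' x, x ∈ Q j → x ∈ Q j' → j = j'
  clique : ∀ j, G.IsClique (Q j)
  firstFit : ∀ j j', j < j' → ∀ x ∈ Q j', ∃ y ∈ Q j, ¬ G.Adj x y

theorem IsFirstFit.sum_card {X : Finset V} {r : ℕ} {Q : ℕ → Finset V} (h : IsFirstFit G X r Q) :
    ∑ j ∈ Finset.range r, (Q j).card = X.card := by
  rw [← Finset.card_biUnion]
  · congr 1
    ext x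
    simp [h.mem_iff]
  · intro j _ j' _ hne
    exact Finset.disjoint_left.2 fun x hx hx' => hne (h.disj _ _ _ hx hx')

theorem IsFirstFit.le_card {X : Finset V} {r : ℕ} {Q : ℕ → Finset V} (h : IsFirstFit G X r Q) :
    r ≤ X.card := by
  rw [← h.sum_card]
  calc r = ∑ j ∈ Finset.range r, 1 := by simp
    _ ≤ _ := Finset.sum_le_sum fun j hj =>
      Finset.card_pos.2 (h.nonempty j (Finset.mem_range.1 hj))

theorem IsFirstFit.card_le {X : Finset V} {r : ℕ} {Q : ℕ → Finset V} (h : IsFirstFit G X r Q)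
    (j : ℕ) : (Q j).card ≤ X.card := by
  by_cases hj : j < r
  · exact Finset.card_le_card fun x hx => (h.mem_iff x).2 ⟨j, hj, hx⟩
  · simp [h.empty j (not_lt.1 hj)]

theorem IsFirstFit.nil : IsFirstFit G ∅ 0 fun _ => ∅ where
  empty := by simp
  nonempty := by simp
  mem_iff := by simp
  disj := by simp
  clique := by simp
  firstFit := by simp

/-- The vertex `x` joins the class `j`, the first one that it is complete to. -/
theorem IsFirstFit.insert {X : Finset V} {r : ℕ} {Q : ℕ → Finset V} (h : IsFirstFit G X r Q)
    {x : V} (hx : x ∉ X) {j r' : ℕ} (hj : j ≤ r) (hr : r' = max r (j + 1))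
    (hadj : ∀ y ∈ Q j, G.Adj x y) (hfirst : ∀ i < j, ∃ y ∈ Q i, ¬ G.Adj x y)
    {Q' : ℕ → Finset V} (hQ' : ∀ i, Q' i = if i = j then insert x (Q j) else Q i) :
    IsFirstFit G (insert x X) r' Q' := by
  have hxQ : ∀ i, x ∉ Q i := by
    intro i hi
    by_cases hir : i < r
    · exact hx ((h.mem_iff x).2 ⟨i, hir, hi⟩)
    · simp [h.empty i (not_lt.1 hir)] at hi
  have hmem : ∀ i y, y ∈ Q' i ↔ (i = j ∧ y = x) ∨ y ∈ Q i := by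
    intro i y
    rw [hQ']
    split_ifs with hi <;> simp [hi]
  subst hr
  refine ⟨?_, ?_, ?_, ?_, ?_, ?_⟩
  · intro i hi
    have : i ≠ j := by omega
    simp [hQ', this, h.empty i (by omega)]
  · intro i hi
    by_cases hij : i = j
    · exact ⟨x, (hmem _ _).2 (.inl ⟨hij, rfl⟩)⟩
    · obtain ⟨y, hy⟩ := h.nonempty i (by omega)
      exact ⟨y, (hmem _ _).2 (.inr hy)⟩
  · intro y
    simp only [Finset.mem_insert, hmem]
    constructor
    · rintro (rfl | hy)
      · exact ⟨j, by omega, .inl ⟨rfl, rfl⟩⟩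
      · obtain ⟨i, hi, hy⟩ := (h.mem_iff y).1 hy
        exact ⟨i, by omega, .inr hy⟩
    · rintro ⟨i, -, ⟨-, rfl⟩ | hy⟩
      · exact .inl rfl
      · right
        by_cases hir : i < r
        · exact (h.mem_iff y).2 ⟨i, hir, hy⟩
        · simp [h.empty i (not_lt.1 hir)] at hy
  · intro i i' y hy hy'
    rw [hmem] at hy hy'
    rcases hy with ⟨rfl, rfl⟩ | hy <;> rcases hy' with ⟨rfl, h'⟩ | hy'
    · rfl
    · exact absurd hy' (hxQ _)
    · subst h'
      exact absurd hy (hxQ _)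
    · exact h.disj _ _ _ hy hy'
  · intro i y hy z hz hyz
    rw [Finset.mem_coe, hmem] at hy hz
    rcases hy with ⟨rfl, rfl⟩ | hy <;> rcases hz with ⟨h', rfl⟩ | hz
    · exact absurd rfl hyz
    · exact hadj z hz
    · subst h'
      exact (hadj y hy).symm
    · exact h.clique i hy hz hyz
  · intro i i' hii y hy
    rw [hmem] at hy
    rcases hy with ⟨rfl, rfl⟩ | hy
    · obtain ⟨z, hz, hz'⟩ := hfirst i hii
      exact ⟨z, (hmem _ _).2 (.inr hz), hz'⟩
    · obtain ⟨z, hz, hz'⟩ := h.firstFit i i' hii y hy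
      exact ⟨z, (hmem _ _).2 (.inr hz), hz'⟩

/-- The map `f` turns elements of a generic address into vertices; at the addresses used it is the
identity. -/
theorem wp_countBad {s : State V} (hnbr : ∀ x y, y ∈ s.nbr x ↔ G.Adj x y) (x : V)
    (a : Loc V) (f : a.Elem → V) (hbad : s.reg .bad = 0) :
    wp (.forEach a fun y => .ifMem (.nbr x) (f y) .skip (.incr .bad)) s fun s' t =>
      (s'.reg .bad = 0 ↔ ∀ y ∈ s.sets a, G.Adj x (f y)) ∧ t ≤ (s.sets a).card * 3 + 1 ∧
      s'.sets = s.sets ∧ ∀ r, r ≠ .bad → s'.reg r = s.reg r := by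
  refine (wp_forEach_const_frame (W := fun _ => False) (R := fun r => r = .bad)
    (by simp [Modifies]) (fun P s' => s'.reg .bad = 0 ↔ ∀ y ∈ P, G.Adj x (f y)) 2
    (by simp [hbad]) ?_).mono ?_
  · intro P y s₁ _ _ _ hF hI
    have hn := hF.nbr x
    simp only [wpS_ifMem, wpS_skip, wpS_incr, le_top, true_and, sets_nbr, hn, hnbr]
    constructor
    · intro hy
      simp [hI, hy]
    · intro hy
      simp [hy]
  · rintro s' t ⟨⟨h1, h2⟩, hF⟩
    exact ⟨h1, h2, funext fun a => hF.sets a (by simp), fun r hr => hF.reg r (by simpa using hr)⟩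

/-- The search for the first class that the vertex `x` is complete to. -/
theorem wp_findClass {s : State V} (hnbr : ∀ x y, y ∈ s.nbr x ↔ G.Adj x y) (x : V)
    (r : ℕ) (hplaced : s.reg .placed = 0) :
    wp (.forRange r fun j => .read .placed fun b =>
      if b = 0 then block [
        .reset .bad,
        .forEach (.Q j) fun y => .ifMem (.nbr x) y .skip (.incr .bad),
        .read .bad fun k =>
          if k = 0 then block [.insert (.Q j) x, .incr .placed] else .skip]
      else .skip) s fun s' t =>
      s'.reg .numQ = s.reg .numQ ∧
      t ≤ ∑ j ∈ Finset.range r, (3 * (s.Q j).card + 12) + 1 ∧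
      ((s'.reg .placed = 0 ∧ (∀ j, s'.Q j = s.Q j) ∧
        ∀ j < r, ∃ y ∈ s.Q j, ¬ G.Adj x y) ∨
      (s'.reg .placed ≠ 0 ∧ ∃ j < r, (∀ y ∈ s.Q j, G.Adj x y) ∧
        (∀ i < j, ∃ y ∈ s.Q i, ¬ G.Adj x y) ∧
        ∀ i, s'.Q i = if i = j then insert x (s.Q j) else s.Q i)) := by
  refine (wp_forRange_frame (W := fun a => match a with | .Q _ => True | _ => False)
    (R := fun r => match r with | .placed | .bad => True | _ => False) ?_
    (fun i s' t => t ≤ ∑ j ∈ Finset.range i, (3 * (s.Q j).card + 12) + 1 ∧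
      ((s'.reg .placed = 0 ∧ (∀ j, s'.Q j = s.Q j) ∧
        ∀ j < i, ∃ y ∈ s.Q j, ¬ G.Adj x y) ∨
      (s'.reg .placed ≠ 0 ∧ ∃ j < i, (∀ y ∈ s.Q j, G.Adj x y) ∧
        (∀ i < j, ∃ y ∈ s.Q i, ¬ G.Adj x y) ∧
        ∀ i, s'.Q i = if i = j then insert x (s.Q j) else s.Q i)))
    ?_ ?_).mono ?_
  · intro i _ k
    beta_reduce
    split_ifs <;> simp [Modifies]
    intro k
    split_ifs <;> simp [Modifies]
  · simp [hplaced]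
  · rintro i s₁ t₁ hi hF ⟨ht, ⟨hp, hQ, hno⟩ | ⟨hp, j, hj, hadj, hfirst, hQ⟩⟩
    · simp only [wpS_read, hp, if_true, block_cons, block_nil, wpS_seq, wpS_reset, le_top, true_and]
      refine (wp_countBad (G := G) (s := s₁.setReg .bad 0) (fun x y => ?_) x (.Q i) id
        (by simp)).mono ?_
      · have := hF.nbr x
        simp [this, hnbr]
      · rintro s₂ t₂ ⟨hb, ht₂, hs, hr⟩
        simp only [sets_Q, setReg_Q, setReg_sets, hQ, id] at hb ht₂ hs
        have hs₂ : ∀ j, s₂.Q j = s₁.Q j := fun j => congrFun hs (.Q j)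
        have hr' := hr .placed (by simp)
        simp only [ne_eq, reduceCtorEq, not_false_eq_true, setReg_reg_of_ne, hp] at hr'
        rw [Finset.sum_range_succ]
        split_ifs with hk
        · simp only [wpS_seq, wpS_insert, wpS_incr, wpS_skip, le_top, true_and]
          refine ⟨by omega, .inr ⟨by simp, i, by omega, hb.1 hk, hno, fun j => ?_⟩⟩
          by_cases hji : j = i
          · subst hji
            simp [hs₂, hQ]
          · simp [hji, hs₂, hQ]
        · simp only [wpS_skip, le_top, true_and]
          refine ⟨by omega, .inl ⟨hr', by simp [hs₂, hQ], fun j hj => ?_⟩⟩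
          rcases Nat.lt_succ_iff_lt_or_eq.1 hj with hj | rfl
          · exact hno j hj
          · simpa [hk] using hb
    · simp only [wpS_read, hp, if_false, wpS_skip, le_top, true_and]
      rw [Finset.sum_range_succ]
      exact ⟨by omega, .inr ⟨hp, j, by omega, hadj, hfirst, hQ⟩⟩
  · rintro s' t ⟨⟨h1, h2⟩, hF⟩
    exact ⟨hF.reg .numQ (by simp), h1, h2⟩

/-- Placing one vertex costs a constant for each class and for each vertex coloured already. The
classes are nonempty and disjoint, so there are no more classes than coloured vertices and the total
is quadratic. -/
theorem wp_colouring {s : State V} (hnbr : ∀ x y, y ∈ s.nbr x ↔ G.Adj x y) (v : V)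
    (hQ : ∀ j, s.Q j = ∅) :
    wp (colouring v) s fun s' t =>
      IsFirstFit G (s.M v) (s'.reg .numQ) (fun j => s'.Q j) ∧
      t ≤ 60 * ((s.M v).card + 1) ^ 2 := by
  set X := s.M v with hX
  simp only [colouring, block_cons, block_nil, wpS_seq, wpS_reset, wpS_skip, le_top, true_and]
  refine (wp_forEach_const_frame
    (W := fun a => match a with | .Q _ => True | _ => False)
    (R := fun r => match r with | .numQ | .placed | .bad => True | _ => False)
    (by
      intro x
      simp only [Modifies, true_and, and_true]
      refine ⟨fun k i _ j => ?_, fun j => ?_⟩ <;> split_ifs <;> simp [Modifies]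
      intro k
      split_ifs <;> simp [Modifies])
    (fun P s' => IsFirstFit G P (s'.reg .numQ) (fun j => s'.Q j))
    (24 * X.card + 20) ?_ ?_).mono ?_
  · simpa [hQ] using IsFirstFit.nil
  · intro P x s₁ hx hxP hP hF hI
    simp only [sets_M, setReg_M, ← hX] at hx hP
    simp only [wpS_seq, wpS_reset, wpS_skip, wpS_read, le_top, true_and]
    refine (wp_findClass (G := G) (fun x y => ?_) x _ (by simp)).mono ?_
    · have := hF.nbr x
      simp [this, hnbr]
    · rintro s₂ t₂ ⟨hnum, ht, h⟩
      simp only [setReg_Q, ne_eq, reduceCtorEq, not_false_eq_true, setReg_reg_of_ne] at hnum ht h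
      rw [Finset.sum_add_distrib, ← Finset.mul_sum, hI.sum_card] at ht
      simp only [Finset.sum_const, Finset.card_range, smul_eq_mul] at ht
      have h1 := hI.le_card
      have h2 := Finset.card_le_card hP
      rcases h with ⟨hp, hQ', hno⟩ | ⟨hp, j, hj, hadj, hfirst, hQ'⟩
      · simp only [hp, if_true, wpS_read]
        rw [hnum]
        simp only [wpS_seq, wpS_insert, wpS_incr, wpS_skip, le_top, true_and]
        refine ⟨hI.insert hxP (j := s₁.reg .numQ) le_rfl ?_ ?_ hno fun i => ?_, by omega⟩
        · simp [hnum]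
        · simp [hI.empty _ le_rfl]
        · by_cases hi : i = s₁.reg .numQ
          · subst hi
            simp [hQ']
          · simp [hi, hQ']
      · simp only [hp, if_false, wpS_skip, le_top, true_and]
        refine ⟨hI.insert hxP (j := j) hj.le ?_ hadj hfirst hQ', by omega⟩
        rw [hnum, max_eq_left hj]
  · rintro s' t ⟨⟨h, ht⟩, -⟩
    simp only [sets_M, setReg_M, ← hX] at h ht
    exact ⟨h, by nlinarith⟩

end Colouring

/-! ### Partial clique covers -/

section PartialCover

variable {V : Type} [Fintype V] {G : SimpleGraph V}

/-- The cliques with labels below `p` cover exactly the edges that are not recorded in `M`, and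
their total size is charged to the covered edges. -/
structure IsPartialCover (G : SimpleGraph V) (N : ℕ) (M : V → Finset V) (C : ℕ → Finset V)
    (p : ℕ) : Prop where
  mem_M : ∀ u x, x ∈ M u ↔ G.Adj u x ∧ ∀ ℓ < p, ¬ (u ∈ C ℓ ∧ x ∈ C ℓ)
  clique : ∀ ℓ, G.IsClique (C ℓ)
  empty : ∀ ℓ, p ≤ ℓ → C ℓ = ∅
  two_le : ∀ ℓ, ℓ < p → 2 ≤ (C ℓ).card
  charge : ∑ ℓ ∈ Finset.range p, (C ℓ).card + ∑ v, (M v).card ≤ N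

variable {N : ℕ} {M : V → Finset V} {C : ℕ → Finset V} {p : ℕ}

theorem IsPartialCover.symm (h : IsPartialCover G N M C p) {u x : V} (hx : x ∈ M u) :
    u ∈ M x := by
  rw [h.mem_M] at hx ⊢
  exact ⟨hx.1.symm, fun ℓ hℓ h' => hx.2 ℓ hℓ h'.symm⟩

theorem IsPartialCover.adj (h : IsPartialCover G N M C p) {u x : V} (hx : x ∈ M u) :
    G.Adj u x := ((h.mem_M u x).1 hx).1

/-- The charging argument. It serves both for a fresh clique, with `ℓ = p` and `C ℓ = ∅`, and for
the extension of an existing one, with `ℓ < p`. The clique gains at most `|Q| + 1 ≤ 2|Q|` vertices,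
paid for by the pairs between `v` and `Q` that leave `M`. -/
theorem IsPartialCover.extend (h : IsPartialCover G N M C p) {ℓ : ℕ} (hℓ : ℓ ≤ p) {v : V}
    {Q X : Finset V} (hX : ∀ x, x ∈ X ↔ x = v ∨ x ∈ Q ∨ x ∈ C ℓ) (hclique : G.IsClique X)
    (hQ : Q.Nonempty) (hQM : Q ⊆ M v) {M' : V → Finset V}
    (hM' : ∀ a x, x ∈ M' a ↔ x ∈ M a ∧ ¬ (a ∈ X ∧ x ∈ X)) {C' : ℕ → Finset V}
    (hC' : ∀ i, C' i = if i = ℓ then X else C i) {p' : ℕ} (hp' : p' = max p (ℓ + 1)) :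
    IsPartialCover G N M' C' p' := by
  subst hp'
  have hv : v ∉ Q := fun hv => (h.adj (hQM hv)).ne rfl
  have hXcard : X.card ≤ (C ℓ).card + 2 * Q.card := by
    have : X ⊆ insert v Q ∪ C ℓ := by
      intro x hx
      simpa [or_assoc] using (hX x).1 hx
    have h1 := (Finset.card_le_card this).trans (Finset.card_union_le _ _)
    have h2 := Finset.card_insert_le v Q
    have h3 := Finset.card_pos.2 hQ
    omega
  -- The row of `v` loses all of `Q`, and each row of a vertex in `Q` loses `v`. Summed over `a`,
  -- the two terms make `2 * Q.card`.
  have hMcard : ∀ a, (M' a).card + ((if a = v then Q.card else 0) + if a ∈ Q then 1 else 0) ≤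
      (M a).card := by
    intro a
    by_cases hav : a = v
    · subst hav
      have : Disjoint (M' a) Q := Finset.disjoint_left.2 fun x hx hxQ =>
        ((hM' a x).1 hx).2 ⟨(hX a).2 (.inl rfl), (hX x).2 (.inr (.inl hxQ))⟩
      simp only [if_true, hv, if_false, add_zero]
      rw [← Finset.card_union_of_disjoint this]
      exact Finset.card_le_card
        (Finset.union_subset (fun x hx => ((hM' a x).1 hx).1) hQM)
    · by_cases haQ : a ∈ Q
      · have hva : v ∉ M' a := fun hx =>
          ((hM' a v).1 hx).2 ⟨(hX a).2 (.inr (.inl haQ)), (hX v).2 (.inl rfl)⟩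
        simp only [hav, if_false, haQ, if_true, zero_add]
        rw [← Finset.card_insert_of_notMem hva]
        refine Finset.card_le_card fun x hx => ?_
        rcases Finset.mem_insert.1 hx with rfl | hx
        · exact h.symm (hQM haQ)
        · exact ((hM' a x).1 hx).1
      · simpa [hav, haQ] using Finset.card_le_card fun x hx => ((hM' a x).1 hx).1
  have hsumM : ∑ a, (M' a).card + 2 * Q.card ≤ ∑ a, (M a).card := by
    refine le_trans (le_of_eq ?_) (Finset.sum_le_sum fun a _ => hMcard a)
    rw [Finset.sum_add_distrib, Finset.sum_add_distrib]
    simp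
    ring
  have hsumC : ∑ i ∈ Finset.range (max p (ℓ + 1)), (C' i).card + (C ℓ).card =
      ∑ i ∈ Finset.range p, (C i).card + X.card := by
    -- Labels from `p` on carry empty cliques, so the larger range may be used whether `ℓ` is old or
    -- fresh.
    have h1 : ∑ i ∈ Finset.range p, (C i).card =
        ∑ i ∈ Finset.range (max p (ℓ + 1)), (C i).card := by
      refine Finset.sum_subset (Finset.range_mono (le_max_left _ _)) fun i _ hi => ?_
      simp [h.empty i (by simpa using hi)]
    have hmem : ℓ ∈ Finset.range (max p (ℓ + 1)) := by simp
    rw [h1, ← Finset.add_sum_erase _ _ hmem, ← Finset.add_sum_erase _ _ hmem]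
    have : ∑ i ∈ (Finset.range (max p (ℓ + 1))).erase ℓ, (C' i).card =
        ∑ i ∈ (Finset.range (max p (ℓ + 1))).erase ℓ, (C i).card :=
      Finset.sum_congr rfl fun i hi => by simp [hC', (Finset.mem_erase.1 hi).1]
    rw [this, hC' ℓ, if_pos rfl]
    ring
  refine ⟨fun a x => ?_, fun i => ?_, fun i hi => ?_, fun i hi => ?_, ?_⟩
  · rw [hM', h.mem_M, and_assoc]
    refine and_congr_right fun _ => ⟨fun ⟨h1, h2⟩ i hi => ?_, fun h1 => ⟨fun i hi => ?_, ?_⟩⟩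
    · rw [hC']
      split_ifs with hiℓ
      · exact h2
      · exact h1 i (by omega)
    · have := h1 i (by omega)
      rw [hC'] at this
      split_ifs at this with hiℓ
      · subst hiℓ
        exact fun h' => this ⟨(hX _).2 (.inr (.inr h'.1)), (hX _).2 (.inr (.inr h'.2))⟩
      · exact this
    · have := h1 ℓ (by omega)
      rwa [hC', if_pos rfl] at this
  · rw [hC']
    split_ifs
    · exact hclique
    · exact h.clique i
  · rw [hC', if_neg (by omega)]
    exact h.empty i (by omega)
  · rw [hC']
    split_ifs with hiℓ
    · obtain ⟨x, hx⟩ := hQ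
      have : ({v, x} : Finset V) ⊆ X := by
        intro y hy
        rw [hX]
        simp only [Finset.mem_insert, Finset.mem_singleton] at hy
        rcases hy with rfl | rfl
        · exact .inl rfl
        · exact .inr (.inl hx)
      rw [← Finset.card_pair (fun h : v = x => hv (h ▸ hx))]
      exact Finset.card_le_card this
    · exact h.two_le i (by omega)
  · have := h.charge
    omega

end PartialCover

/-! ### The extension of a clique -/

section Extend

variable {V : Type} [Fintype V] {G : SimpleGraph V}

/-- The local structures for the cliques with labels `p, …, p + r - 1`. -/
structure LocalInv (G : SimpleGraph V) (N : ℕ) (S : Finset V) (p r : ℕ) (s : State V) : Prop where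
  cover : IsPartialCover G N s.M s.C (p + r)
  subset : ∀ ℓ, p ≤ ℓ → s.C ℓ ⊆ S
  mem_D : ∀ ℓ, p ≤ ℓ → ℓ < p + r → ∀ t, t ∈ s.D ℓ ↔
    t ∈ S ∧ ∀ y ∈ s.C ℓ, t ≠ y → G.Adj t y
  mem_A : ∀ u ℓ, ℓ ∈ s.A u ↔ p ≤ ℓ ∧ ℓ < p + r ∧ u ∈ s.D ℓ

/-- The dual `D ℓ` stays exact: the new members `u` and `w` only add the requirement of being
adjacent to both, and precisely the vertices outside the clique that fail it are collected in `T`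
and removed. Every loop runs over a subset of `S`, so the time is linear in `S.card`. -/
theorem wp_extend {s : State V} (hnbr : ∀ x y, y ∈ s.nbr x ↔ G.Adj x y)
    {N : ℕ} {S : Finset V} {p r ℓ : ℕ} {u w : V} (h : LocalInv G N S p r s)
    (hT : s.T = ∅) (hp : p ≤ ℓ) (hr : ℓ < p + r) (hu : u ∈ s.D ℓ)
    (hw : w ∈ s.D ℓ) (huw : w ∈ s.M u) :
    wp (extend ℓ u w) s fun s' t => LocalInv G N S p r s' ∧ s'.T = ∅ ∧
      (∀ i, s'.C i = if i = ℓ then insert w (insert u (s.C ℓ)) else s.C i) ∧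
      (∀ x, s'.M x ⊆ s.M x) ∧ (∀ i, s'.D i ⊆ s.D i) ∧
      (∀ x, s'.A x ⊆ s.A x) ∧ t ≤ 20 * S.card + 10 := by
  obtain ⟨X, hX⟩ : ∃ X, insert w (insert u (s.C ℓ)) = X := ⟨_, rfl⟩
  have hmemX : ∀ y, y ∈ X ↔ y = w ∨ y = u ∨ y ∈ s.C ℓ := by simp [← hX]
  have hadj := h.cover.adj huw
  have hDu := (h.mem_D ℓ hp hr u).1 hu
  have hDw := (h.mem_D ℓ hp hr w).1 hw
  have hXS : X ⊆ S := by
    intro y hy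
    rcases (hmemX y).1 hy with rfl | rfl | hy
    · exact hDw.1
    · exact hDu.1
    · exact h.subset ℓ hp hy
  have hcl : G.IsClique X := by
    intro y hy z hz hyz
    rw [Finset.mem_coe, hmemX] at hy hz
    rcases hy with rfl | rfl | hy <;> rcases hz with rfl | rfl | hz
    · exact absurd rfl hyz
    · exact hadj.symm
    · exact hDw.2 z hz hyz
    · exact hadj
    · exact absurd rfl hyz
    · exact hDu.2 z hz hyz
    · exact (hDw.2 y hy hyz.symm).symm
    · exact (hDu.2 y hy hyz.symm).symm
    · exact h.cover.clique ℓ hy hz hyz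
  have hDS : s.D ℓ ⊆ S := fun t ht => ((h.mem_D ℓ hp hr t).1 ht).1
  have hDcard := Finset.card_le_card hDS
  have hXcard := Finset.card_le_card hXS
  simp only [extend, block_cons, block_nil, wpS_seq, wpS_insert, wpS_skip, le_top, true_and]
  -- the vertices that become inadmissible
  refine (wp_forEach_const_frame (W := fun a => a = .T) (R := fun _ => False)
    (by simp [Modifies])
    (fun P s' => ∀ t, t ∈ s'.T ↔ t ∈ P ∧ t ∉ X ∧ ¬ (G.Adj u t ∧ G.Adj w t)) 4 ?_ ?_).mono ?_
  · simp [hT]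
  · intro P t s₁ _ _ _ hF hI
    have hC : s₁.C ℓ = X := by
      rw [hF.C]
      simp [hX]
    have hn : ∀ x y, y ∈ s₁.nbr x ↔ G.Adj x y := fun x y => by
      rw [hF.nbr]
      simpa using hnbr x y
    simp only [wpS_ifMem, wpS_skip, wpS_insert, le_top, true_and, sets_C, sets_nbr, hC, hn,
      mem_ins_T, Finset.mem_insert, hI]
    refine ⟨fun h1 => ⟨fun y => ?_, by simp⟩,
      fun h1 => ⟨fun h2 => ⟨fun h3 => ⟨fun y => ?_, by simp⟩,
        fun h3 => ⟨fun y => ?_, by simp⟩⟩, fun h2 => ⟨fun y => ?_, by simp⟩⟩⟩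
    all_goals
      by_cases hy : y = t
      · subst hy; tauto
      · simp [hy]
  rintro s₁ t₁ ⟨⟨hT₁, ht₁⟩, hF₁⟩
  simp only [sets_D, ne_eq, reduceCtorEq, not_false_eq_true, ins_D_of_ne] at hT₁ ht₁
  have hC₁ : ∀ i, s₁.C i = if i = ℓ then X else s.C i := by
    intro i
    rw [hF₁.C]
    by_cases hi : i = ℓ
    · subst hi; simp [hX]
    · simp [hi]
  have hTcard : s₁.T.card ≤ S.card :=
    (Finset.card_le_card fun t ht => ((hT₁ t).1 ht).1).trans hDcard
  -- they are removed from the local structures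
  refine (wp_forEach_const_frame
    (W := fun a => match a with | .D _ | .A _ | .T => True | _ => False)
    (R := fun _ => False) (by simp [Modifies])
    (fun P s' => (∀ t, t ∈ s'.T ↔ t ∈ s₁.T ∧ t ∉ P) ∧
      (∀ i t, t ∈ s'.D i ↔ t ∈ s.D i ∧ ¬ (i = ℓ ∧ t ∈ P)) ∧
      (∀ x i, i ∈ s'.A x ↔ i ∈ s.A x ∧ ¬ (x ∈ P ∧ i = ℓ)))
    4 ?_ ?_).mono ?_
  · simp [hF₁.D, hF₁.A]
  · rintro P t s₂ _ htP _ _ ⟨hI1, hI2, hI3⟩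
    simp only [wpS_seq, wpS_erase, wpS_skip, le_top, true_and]
    refine ⟨⟨fun y => ?_, fun i y => ?_, fun x i => ?_⟩, le_rfl⟩
    · simp [hI1]; tauto
    · simp [hI2]; tauto
    · simp [hI3]; tauto
  rintro s₂ t₂ ⟨⟨⟨hT₂, hD₂, hA₂⟩, ht₂⟩, hF₂⟩
  replace ht₂ : t₂ ≤ S.card * 5 + 1 := ht₂.trans (Nat.add_le_add_right (Nat.mul_le_mul_right 5 hTcard) 1)
  have hC₂ : s₂.C ℓ = X := by simp [hF₂.C, hC₁]
  have hM₂ : ∀ x, s₂.M x = s.M x := by simp [hF₂.M, hF₁.M]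
  -- the newly covered edges
  refine (wp_forEach_const_frame
    (W := fun a => match a with | .M _ => True | _ => False)
    (R := fun _ => False) (by simp [Modifies])
    (fun P s' => ∀ a x, x ∈ s'.M a ↔ x ∈ s.M a ∧ ¬ ((a = u ∨ a = w) ∧ x ∈ P) ∧
      ¬ (a ∈ P ∧ (x = u ∨ x = w))) 5 ?_ ?_).mono ?_
  · simp [hM₂]
  · rintro P y s₃ _ hyP _ _ hI
    simp only [wpS_seq, wpS_erase, wpS_skip, le_top, true_and]
    refine ⟨fun a x => ?_, by simp⟩
    simp only [mem_del_M, hI, Finset.mem_insert]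
    clear * -
    grind
  rintro s₃ t₃ ⟨⟨hM₃, ht₃⟩, hF₃⟩
  simp only [sets_C, hC₂] at hM₃ ht₃
  -- The program deletes only pairs that meet `{u, w}`. This suffices, since a pair inside the old
  -- `C ℓ` is covered and thus absent from `M` already.
  have hM : ∀ a x, x ∈ s₃.M a ↔ x ∈ s.M a ∧ ¬ (a ∈ X ∧ x ∈ X) := by
    intro a x
    rw [hM₃]
    refine and_congr_right fun hx => ?_
    have := ((h.cover.mem_M a x).1 hx).2 ℓ hr
    grind
  have hC : ∀ i, s₃.C i = if i = ℓ then X else s.C i := by simp [hF₃.C, hF₂.C, hC₁]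
  have hD : ∀ i t, t ∈ s₃.D i ↔ t ∈ s.D i ∧ ¬ (i = ℓ ∧ t ∈ s₁.T) := by
    simpa [hF₃.D] using hD₂
  have hA : ∀ x i, i ∈ s₃.A x ↔ i ∈ s.A x ∧ ¬ (x ∈ s₁.T ∧ i = ℓ) := by
    simpa [hF₃.A] using hA₂
  refine ⟨⟨?_, fun i hi => ?_, fun i hi hi' t => ?_, fun x i => ?_⟩, ?_, fun i => ?_,
    fun x y hy => ((hM x y).1 hy).1, fun i t ht => ((hD i t).1 ht).1,
    fun x i hi => ((hA x i).1 hi).1, by omega⟩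
  -- The charging lemma with `Q = {w}`: the two pairs of the edge pay for up to two new vertices.
  · refine h.cover.extend hr.le (v := u) (Q := {w}) (fun y => ?_) hcl (by simp)
      (by simpa using huw) hM hC (by omega)
    simp only [hmemX, Finset.mem_singleton]
    tauto
  · rw [hC]
    split_ifs
    · exact hXS
    · exact h.subset i hi
  · rw [hD, hC]
    split_ifs with hil
    · subst hil
      simp only [true_and, hT₁, h.mem_D i hp hr]
      constructor
      · rintro ⟨⟨h1, h2⟩, h3⟩
        refine ⟨h1, fun y hy hty => ?_⟩
        by_cases htX : t ∈ X
        · exact hcl htX hy hty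
        · have : G.Adj u t ∧ G.Adj w t := by
            by_contra h4
            exact h3 ⟨⟨h1, h2⟩, htX, h4⟩
          rcases (hmemX y).1 hy with rfl | rfl | hy
          · exact this.2.symm
          · exact this.1.symm
          · exact h2 y hy hty
      · rintro ⟨h1, h2⟩
        refine ⟨⟨h1, fun y hy => h2 y ((hmemX y).2 (.inr (.inr hy)))⟩, ?_⟩
        rintro ⟨-, htX, h4⟩
        refine h4 ⟨(h2 u ((hmemX u).2 (by simp)) ?_).symm,
          (h2 w ((hmemX w).2 (by simp)) ?_).symm⟩
        · rintro rfl; exact htX ((hmemX t).2 (by simp))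
        · rintro rfl; exact htX ((hmemX t).2 (by simp))
    · simpa [hil] using h.mem_D i hi hi' t
  · rw [hA, hD, h.mem_A]
    tauto
  · ext t
    simp [hF₃.T, hT₂]
  · rw [hC, hX]

end Extend

/-! ### The steps of one iteration -/

section Steps

variable {V : Type} {G : SimpleGraph V}

theorem wp_clear {s : State V} (a : Loc V) :
    wp (clear a) s fun s' t => s'.sets a = ∅ ∧ Frame (fun b => b = a) (fun _ => False) s s' ∧
      t ≤ (s.sets a).card * 2 + 1 := by
  refine (wp_forEach_const_frame (W := fun b => b = a) (R := fun _ => False)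
    (by simp [Modifies]) (fun P s' => ∀ x, x ∈ s'.sets a ↔ x ∈ s.sets a ∧ x ∉ P) 1 ?_ ?_).mono ?_
  · simp
  · intro P x s₁ hx hxP _ _ hI
    simp only [wpS_erase, le_top, true_and]
    refine ⟨fun y => ?_, le_rfl⟩
    simp [hI]
    tauto
  · rintro s' t ⟨⟨h, ht⟩, hF⟩
    refine ⟨?_, hF, ht⟩
    ext x
    simp [h]

/-- The local vertex set is computed. -/
theorem wp_localVertices {s : State V} {v : V} (hS : ∀ u, u ∈ s.S ↔ u = v) :
    wp (.forEach (.back v) fun u => block [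
        .ifMem (.M u) v (.insert .S u) .skip,
        .forEach (.back v) fun x => .ifMem (.M u) x (.insert .S u) .skip]) s fun s' t =>
      (∀ u, u ∈ s'.S ↔ u = v ∨ u ∈ s.back v ∧ (v ∈ s.M u ∨ ∃ x ∈ s.back v, x ∈ s.M u)) ∧
      t ≤ (s.back v).card * (3 * (s.back v).card + 5) + 1 := by
  refine (wp_forEach_const_frame (W := fun b => b = .S) (R := fun _ => False)
    (by simp [Modifies])
    (fun P s' => ∀ u, u ∈ s'.S ↔
      u = v ∨ u ∈ P ∧ (v ∈ s.M u ∨ ∃ x ∈ s.back v, x ∈ s.M u))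
    (3 * (s.back v).card + 4) ?_ ?_).mono ?_
  · simp [hS]
  · intro P u s₁ _ _ _ hF hI
    have hb := hF.back v
    have hM := hF.M
    have key : ∀ s₂ : State V, (∀ y, y ∈ s₂.S ↔ y ∈ s₁.S ∨ (y = u ∧ v ∈ s.M u)) →
        (∀ y, s₂.M y = s.M y) → s₂.back v = s.back v →
        wp (.forEach (.back v) fun x => .ifMem (.M u) x (.insert .S u) .skip) s₂ fun s' t =>
          (∀ y, y ∈ s'.S ↔ y ∈ s₁.S ∨ (y = u ∧ (v ∈ s.M u ∨ ∃ x ∈ s.back v, x ∈ s.M u))) ∧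
          t ≤ 3 * (s.back v).card + 1 := by
      intro s₂ h₂ hM₂ hb₂
      refine (wp_forEach_const_frame (W := fun b => b = .S) (R := fun _ => False)
        (by simp [Modifies])
        (fun P s' => ∀ y, y ∈ s'.S ↔ y ∈ s₁.S ∨ (y = u ∧ (v ∈ s.M u ∨ ∃ x ∈ P, x ∈ s.M u)))
        2 ?_ ?_).mono ?_
      · simpa using h₂
      · intro P' x s₃ _ _ _ hF₃ hI₃
        simp only [wpS_ifMem, wpS_insert, wpS_skip, le_top, true_and, sets_M, hF₃.M, hM₂]
        constructor <;> intro hx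
        · refine ⟨fun y => ?_, le_rfl⟩
          simp only [mem_ins_S, hI₃, Finset.exists_mem_insert, hx, true_or, or_true, and_true]
          tauto
        · refine ⟨fun y => ?_, le_rfl⟩
          simp only [hI₃, Finset.exists_mem_insert, hx, false_or]
      · rintro s' t ⟨⟨h, ht⟩, -⟩
        simp only [sets_back, hb₂] at h ht
        exact ⟨h, by omega⟩
    have post : ∀ (s' : State V) t, ((∀ y, y ∈ s'.S ↔ y ∈ s₁.S ∨
        (y = u ∧ (v ∈ s.M u ∨ ∃ x ∈ s.back v, x ∈ s.M u))) ∧ t ≤ 3 * (s.back v).card + 1) →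
        (∀ y, y ∈ s'.S ↔ y = v ∨ y ∈ insert u P ∧
          (v ∈ s.M y ∨ ∃ x ∈ s.back v, x ∈ s.M y)) ∧ 1 + 1 + (t + 1) ≤ 3 * (s.back v).card + 4 := by
      rintro s' t ⟨h, ht⟩
      refine ⟨fun y => ?_, by omega⟩
      rw [h, hI]
      by_cases hy : y = u
      · subst hy
        simp only [Finset.mem_insert_self, true_and]
        tauto
      · simp [hy]
    simp only [block_cons, block_nil, wpS_seq, wpS_skip, wpS_ifMem, wpS_insert, le_top, true_and,
      sets_M, hM]
    constructor <;> intro hv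
    · refine (key _ (fun y => ?_) (by simp [hM]) (by simp [hb])).mono post
      simp [hv]
      tauto
    · refine (key _ (fun y => ?_) (by simp [hM]) (by simp [hb])).mono post
      simp [hv]
  · rintro s' t ⟨⟨h, ht⟩, -⟩
    exact ⟨h, ht⟩

variable [Fintype V]

/-- The colour classes become cliques. -/
theorem wp_create {s : State V} {v : V} {N p r : ℕ} (hfit : IsFirstFit G (s.M v) r s.Q)
    (hcov : IsPartialCover G N s.M s.C p) :
    wp (.forRange r fun j => block [
        .insert (.C (p + j)) v,
        .forEach (.Q j) fun x => .insert (.C (p + j)) x,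
        .forEach (.C (p + j)) fun u => .forEach (.C (p + j)) fun x => .erase (.M u) x]) s
      fun s' t => IsPartialCover G N s'.M s'.C (p + r) ∧ (∀ ℓ < p, s'.C ℓ = s.C ℓ) ∧
        (∀ j < r, s'.C (p + j) = insert v (s.Q j)) ∧ (∀ a, s'.M a ⊆ s.M a) ∧
        t ≤ 25 * ((s.M v).card + 1) ^ 2 := by
  set q := (s.M v).card with hq
  refine (wp_forRange_frame (W := fun a => match a with | .C _ | .M _ => True | _ => False)
    (R := fun _ => False) (by simp [Modifies])
    (fun i s' t => IsPartialCover G N s'.M s'.C (p + i) ∧ (∀ ℓ < p, s'.C ℓ = s.C ℓ) ∧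
        (∀ j < i, s'.C (p + j) = insert v (s.Q j)) ∧ (∀ a, s'.M a ⊆ s.M a) ∧
        -- A clique on `Q j` and `v` costs the square of its size, at most `(q + 1) * ((Q j).card +
        -- 1)`; the second factors add up to `q + r ≤ 2 * q`.
        t ≤ 12 * (q + 1) * (∑ j ∈ Finset.range i, ((s.Q j).card + 1)) + 1) ?_ ?_).mono ?_
  · simpa using hcov
  · rintro i s₁ t₁ hi hF ⟨hc, hold, hnew, hM, ht⟩
    simp only [block_cons, block_nil, wpS_seq, wpS_insert, wpS_skip, le_top, true_and]
    obtain ⟨X, hX⟩ : ∃ X, insert v (s.Q i) = X := ⟨_, rfl⟩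
    have hmemX : ∀ x, x ∈ X ↔ x = v ∨ x ∈ s.Q i := by simp [← hX]
    have hXcard : X.card ≤ (s.Q i).card + 1 := hX ▸ Finset.card_insert_le _ _
    have hQq : (s.Q i).card ≤ q := hfit.card_le i
    refine (wp_forEach_const_frame (W := fun a => match a with | .C _ => True | _ => False)
      (R := fun _ => False) (by simp [Modifies])
      (fun P s' => ∀ ℓ x, x ∈ s'.C ℓ ↔ (ℓ = p + i ∧ (x = v ∨ x ∈ P)) ∨ x ∈ s₁.C ℓ) 1
      ?_ ?_).mono ?_
    · simp
    · intro P x s₂ _ _ _ _ hI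
      simp only [wpS_insert, le_top, true_and]
      refine ⟨fun ℓ y => ?_, le_rfl⟩
      simp [hI]
      tauto
    rintro s₂ t₂ ⟨⟨hC₂, ht₂⟩, hF₂⟩
    have hQ : s₁.Q i = s.Q i := hF.Q i
    simp only [sets_Q, ne_eq, reduceCtorEq, not_false_eq_true, ins_Q_of_ne, hQ] at hC₂ ht₂
    have hC₂' : ∀ ℓ, s₂.C ℓ = if ℓ = p + i then X else s₁.C ℓ := by
      intro ℓ
      ext x
      split_ifs with hℓ
      · subst hℓ
        simp [hC₂, hmemX, hc.empty (p + i) le_rfl]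
      · simp [hC₂, hℓ]
    have hCi : s₂.C (p + i) = X := by simp [hC₂']
    have hM₂ : ∀ a, s₂.M a = s₁.M a := fun a => by simp [hF₂.M]
    refine (wp_forEach_const_frame (W := fun a => match a with | .M _ => True | _ => False)
      (R := fun _ => False) (by simp [Modifies])
      (fun P s' => ∀ a x, x ∈ s'.M a ↔ x ∈ s₁.M a ∧ ¬ (a ∈ P ∧ x ∈ X)) (2 * X.card + 1)
      ?_ ?_).mono ?_
    · simp [hM₂]
    · intro P u s₃ _ _ _ hF₃ hI₃
      refine (wp_forEach_const_frame (W := fun a => match a with | .M _ => True | _ => False)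
        (R := fun _ => False) (by simp [Modifies])
        (fun P' s' => ∀ a x, x ∈ s'.M a ↔ x ∈ s₃.M a ∧ ¬ (a = u ∧ x ∈ P')) 1 ?_ ?_).mono ?_
      · simp
      · intro P' x s₄ _ _ _ _ hI₄
        simp only [wpS_erase, le_top, true_and]
        refine ⟨fun a y => ?_, le_rfl⟩
        simp [hI₄]
        tauto
      · rintro s₄ t₄ ⟨⟨h₄, ht₄⟩, -⟩
        have : s₃.C (p + i) = X := by rw [hF₃.C, hCi]
        simp only [sets_C, this] at h₄ ht₄
        refine ⟨fun a x => ?_, by omega⟩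
        rw [h₄, hI₃, Finset.mem_insert]
        tauto
    rintro s₃ t₃ ⟨⟨hM₃, ht₃⟩, hF₃⟩
    simp only [sets_C, hCi] at hM₃ ht₃
    have hC₃ : ∀ ℓ, s₃.C ℓ = if ℓ = p + i then X else s₁.C ℓ := fun ℓ => by
      rw [hF₃.C, hC₂']
    have hadj : ∀ x ∈ s.Q i, G.Adj v x := fun x hx => hcov.adj ((hfit.mem_iff x).2 ⟨i, hi, hx⟩)
    refine ⟨?_, fun ℓ hℓ => ?_, fun j hj => ?_, fun a x hx => hM a ((hM₃ a x).1 hx).1, ?_⟩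
    · refine hc.extend le_rfl (v := v) (Q := s.Q i) (X := X) ?_ ?_ (hfit.nonempty i hi) ?_
        hM₃ hC₃ (by omega)
      · simp [hmemX, hc.empty (p + i) le_rfl]
      · intro x hx y hy hxy
        rw [Finset.mem_coe, hmemX] at hx hy
        rcases hx with rfl | hx <;> rcases hy with h' | hy
        · exact absurd h'.symm hxy
        · exact hadj y hy
        · subst h'; exact (hadj x hx).symm
        · exact hfit.clique i hx hy hxy
      -- The edges from `v` to `Q i` are still uncovered: they were so at the start, and the cliques
      -- made from earlier classes are disjoint from `Q i`.
      · intro x hx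
        rw [hc.mem_M]
        refine ⟨hadj x hx, fun ℓ hℓ => ?_⟩
        by_cases hp : ℓ < p
        · rw [hold ℓ hp]
          exact ((hcov.mem_M v x).1 ((hfit.mem_iff x).2 ⟨i, hi, hx⟩)).2 ℓ hp
        · obtain ⟨j, rfl⟩ := Nat.exists_eq_add_of_le (not_lt.1 hp)
          rw [hnew j (by omega), Finset.mem_insert, Finset.mem_insert]
          rintro ⟨-, h | h⟩
          · exact (hadj x hx).ne h.symm
          · have := hfit.disj _ _ _ h hx
            omega
    · rw [hC₃, if_neg (by omega), hold ℓ hℓ]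
    · rw [hC₃]
      split_ifs with h
      · rw [← hX, show j = i by omega]
      · exact hnew j (by omega)
    · rw [Finset.sum_range_succ]
      have h1 : X.card * X.card ≤ (q + 1) * ((s.Q i).card + 1) :=
        Nat.mul_le_mul (by omega) hXcard
      have h2 : (s.Q i).card + 1 ≤ (q + 1) * ((s.Q i).card + 1) := by nlinarith
      nlinarith
  · rintro s' t ⟨⟨h1, h2, h3, h4, ht⟩, -⟩
    refine ⟨h1, h2, h3, h4, ht.trans ?_⟩
    rw [Finset.sum_add_distrib, hfit.sum_card]
    have := hfit.le_card
    simp only [Finset.sum_const, Finset.card_range, smul_eq_mul, mul_one, ← hq] at this ⊢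
    nlinarith

end Steps

/-! ### Local admissibility -/

section Augment

variable {V : Type} {G : SimpleGraph V}

theorem wp_initD {s : State V} {p r : ℕ} (hD : ∀ ℓ, s.D ℓ = ∅) :
    wp (.forRange r fun j => .forEach (.C (p + j)) fun u => .insert (.D (p + j)) u) s fun s' t =>
      (∀ ℓ x, x ∈ s'.D ℓ ↔ p ≤ ℓ ∧ ℓ < p + r ∧ x ∈ s.C ℓ) ∧
      t ≤ ∑ j ∈ Finset.range r, (2 * (s.C (p + j)).card + 2) + 1 := by
  refine (wp_forRange_frame (W := fun a => match a with | .D _ => True | _ => False)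
    (R := fun _ => False) (by simp [Modifies])
    (fun i s' t => (∀ ℓ x, x ∈ s'.D ℓ ↔ p ≤ ℓ ∧ ℓ < p + i ∧ x ∈ s.C ℓ) ∧
      t ≤ ∑ j ∈ Finset.range i, (2 * (s.C (p + j)).card + 2) + 1) ?_ ?_).mono ?_
  · simp [hD]
    omega
  · rintro i s₁ t₁ hi hF ⟨hI, ht⟩
    refine (wp_forEach_const_frame (W := fun a => match a with | .D _ => True | _ => False)
      (R := fun _ => False) (by simp [Modifies])
      (fun P s' => ∀ ℓ x, x ∈ s'.D ℓ ↔ x ∈ s₁.D ℓ ∨ (ℓ = p + i ∧ x ∈ P)) 1 ?_ ?_).mono ?_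
    · simp
    · intro P x s₂ _ _ _ _ hI₂
      simp only [wpS_insert, le_top, true_and]
      refine ⟨fun ℓ y => ?_, le_rfl⟩
      simp [hI₂]
      tauto
    · rintro s₂ t₂ ⟨⟨h₂, ht₂⟩, -⟩
      simp only [sets_C, hF.C] at h₂ ht₂
      rw [Finset.sum_range_succ]
      refine ⟨fun ℓ x => ?_, by omega⟩
      rw [h₂, hI]
      by_cases hℓ : ℓ = p + i
      · subst hℓ
        simp
      · simp only [hℓ, false_and, or_false]
        constructor
        · rintro ⟨h1, h2, h3⟩
          exact ⟨h1, by omega, h3⟩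
        · rintro ⟨h1, h2, h3⟩
          exact ⟨h1, by omega, h3⟩
  · rintro s' t ⟨h, -⟩
    exact h

/-- The vertices of `S` that are admissible for one clique are added to its dual. -/
theorem wp_admissible {s : State V} (hnbr : ∀ x y, y ∈ s.nbr x ↔ G.Adj x y) (i : ℕ) :
    wp (.forEach .S fun u => .ifMem (.C i) u .skip (block [
      .reset .bad,
      .forEach (.C i) fun w => .ifMem (.nbr u) w .skip (.incr .bad),
      .read .bad fun k => if k = 0 then .insert (.D i) u else .skip])) s fun s' t =>
      (∀ ℓ x, x ∈ s'.D ℓ ↔ x ∈ s.D ℓ ∨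
        (ℓ = i ∧ x ∈ s.S ∧ x ∉ s.C i ∧ ∀ y ∈ s.C i, G.Adj x y)) ∧
      t ≤ s.S.card * (3 * (s.C i).card + 8) + 1 := by
  have hm : ∀ u, Modifies (fun a => match a with | .D _ => True | _ => False)
      (fun r => r = .bad) (Cmd.ifMem (.C i) u .skip (block [
      .reset .bad,
      .forEach (.C i) fun w => .ifMem (.nbr u) w .skip (.incr .bad),
      .read .bad fun k => if k = 0 then .insert (.D i) u else .skip]) : Cmd V) := by
    intro u
    simp only [block_cons, block_nil, Modifies, true_and, and_true, implies_true]
    intro k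
    split_ifs <;> simp [Modifies]
  refine (wp_forEach_const_frame (a := .S) hm
    (fun P s' => ∀ ℓ x, x ∈ s'.D ℓ ↔ x ∈ s.D ℓ ∨
        (ℓ = i ∧ x ∈ P ∧ x ∉ s.C i ∧ ∀ y ∈ s.C i, G.Adj x y))
    (3 * (s.C i).card + 7) ?_ ?_).mono ?_
  · simp
  · intro P u s₁ _ _ _ hF hI
    have hC := hF.C i
    simp only [wpS_ifMem, wpS_skip, block_cons, block_nil, wpS_seq, wpS_reset, wpS_read,
      le_top, true_and, sets_C, hC]
    constructor <;> intro hu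
    · refine ⟨fun ℓ x => ?_, by omega⟩
      rw [hI]
      by_cases hx : x = u
      · subst hx; simp [hu]
      · simp [hx]
    · refine (wp_countBad (G := G) (s := s₁.setReg .bad 0) (fun x y => ?_) u (.C i) id
        (by simp)).mono ?_
      · simp [hF.nbr, hnbr]
      · rintro s₂ t₂ ⟨hb, ht₂, hs, -⟩
        simp only [sets_C, setReg_C, hC, id] at hb ht₂
        have hD₂ : ∀ ℓ, s₂.D ℓ = s₁.D ℓ := fun ℓ => congrFun hs (.D ℓ)
        split_ifs with hk
        · simp only [wpS_insert, le_top, true_and]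
          refine ⟨fun ℓ x => ?_, by omega⟩
          simp only [mem_ins_D, hD₂, hI]
          by_cases hx : x = u
          · subst hx
            simp [hu]
            tauto
          · simp [hx]
        · simp only [wpS_skip, le_top, true_and]
          refine ⟨fun ℓ x => ?_, by omega⟩
          simp only [hD₂, hI]
          by_cases hx : x = u
          · subst hx
            have : ¬ ∀ y ∈ s.C i, G.Adj x y := fun h => hk (hb.2 h)
            simp [hu, this]
          · simp [hx]
  · rintro s' t ⟨h, -⟩
    exact h

theorem wp_admissibles {s : State V} (hnbr : ∀ x y, y ∈ s.nbr x ↔ G.Adj x y) {p r : ℕ}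
    (hD : ∀ ℓ x, x ∈ s.D ℓ ↔ p ≤ ℓ ∧ ℓ < p + r ∧ x ∈ s.C ℓ) (hA : ∀ x, s.A x = ∅)
    (hsub : ∀ j < r, s.C (p + j) ⊆ s.S) :
    wp (.forRange r fun j => block [
    .forEach .S fun u => .ifMem (.C (p + j)) u .skip (block [
      .reset .bad,
      .forEach (.C (p + j)) fun w => .ifMem (.nbr u) w .skip (.incr .bad),
      .read .bad fun k => if k = 0 then .insert (.D (p + j)) u else .skip]),
    .forEach (.D (p + j)) fun u => .insert (.A u) (p + j)]) s fun s' t =>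
      (∀ ℓ x, x ∈ s'.D ℓ ↔ p ≤ ℓ ∧ ℓ < p + r ∧
        (x ∈ s.C ℓ ∨ x ∈ s.S ∧ ∀ y ∈ s.C ℓ, G.Adj x y)) ∧
      (∀ x ℓ, ℓ ∈ s'.A x ↔ p ≤ ℓ ∧ ℓ < p + r ∧ x ∈ s'.D ℓ) ∧
      t ≤ ∑ j ∈ Finset.range r, (s.S.card * (3 * (s.C (p + j)).card + 10) + 4) + 1 := by
  refine (wp_forRange_frame (W := fun a => match a with | .D _ | .A _ => True | _ => False)
    (R := fun r => r = .bad) ?_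
    (fun i s' t => (∀ ℓ x, x ∈ s'.D ℓ ↔ p ≤ ℓ ∧ ℓ < p + r ∧
        -- The members of `C ℓ` are present from the start; the other admissible vertices only for
        -- labels already treated.
        (x ∈ s.C ℓ ∨ ℓ < p + i ∧ x ∈ s.S ∧ ∀ y ∈ s.C ℓ, G.Adj x y)) ∧
      (∀ x ℓ, ℓ ∈ s'.A x ↔ p ≤ ℓ ∧ ℓ < p + i ∧ x ∈ s'.D ℓ) ∧
      t ≤ ∑ j ∈ Finset.range i, (s.S.card * (3 * (s.C (p + j)).card + 10) + 4) + 1)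
    ?_ ?_).mono ?_
  · intro i _
    simp only [block_cons, block_nil, Modifies, true_and, and_true, implies_true]
    intro _ k
    split_ifs <;> simp [Modifies]
  · refine ⟨fun ℓ x => ?_, fun x ℓ => ?_, by simp⟩
    · rw [hD]
      refine and_congr_right fun h => and_congr_right fun _ => ?_
      simp [not_lt.2 h]
    · simp [hA]
      omega
  · rintro i s₁ t₁ hi hF ⟨hD₁, hA₁, ht⟩
    have hC := hF.C
    have hS := hF.S
    simp only [block_cons, block_nil, wpS_seq, wpS_skip, le_top, true_and]
    refine ((wp_admissible (G := G) (s := s₁) (by simpa [hF.nbr] using hnbr) (p + i)).frame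
      (W := fun a => match a with | .D _ => True | _ => False) (R := fun r => r = .bad) ?_).mono ?_
    · simp only [block_cons, block_nil, Modifies, true_and, and_true, implies_true]
      intro _ k
      split_ifs <;> simp [Modifies]
    rintro s₂ t₂ ⟨⟨hD₂, ht₂⟩, hF₂⟩
    simp only [hC, hS] at hD₂ ht₂
    have hDall : ∀ ℓ x, x ∈ s₂.D ℓ ↔ p ≤ ℓ ∧ ℓ < p + r ∧
        (x ∈ s.C ℓ ∨ ℓ < p + (i + 1) ∧ x ∈ s.S ∧ ∀ y ∈ s.C ℓ, G.Adj x y) := by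
      intro ℓ x
      rw [hD₂, hD₁]
      by_cases hℓ : ℓ = p + i
      · subst hℓ
        simp [hi]
        tauto
      · have : ℓ < p + (i + 1) ↔ ℓ < p + i := by omega
        simp [hℓ, this]
    have hDcard : (s₂.D (p + i)).card ≤ s.S.card := by
      refine Finset.card_le_card fun x hx => ?_
      rcases ((hDall _ _).1 hx).2.2 with h | h
      · exact hsub i hi h
      · exact h.2.1
    refine (wp_forEach_const_frame (W := fun a => match a with | .A _ => True | _ => False)
      (R := fun _ => False) (by simp [Modifies])
      (fun P s' => ∀ x ℓ, ℓ ∈ s'.A x ↔ ℓ ∈ s₁.A x ∨ (ℓ = p + i ∧ x ∈ P)) 1 ?_ ?_).mono ?_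
    · simp [hF₂.A]
    · intro P x s₃ _ _ _ _ hI
      simp only [wpS_insert, le_top, true_and]
      refine ⟨fun y ℓ => ?_, le_rfl⟩
      simp only [mem_ins_A, hI, Finset.mem_insert]
      tauto
    rintro s₃ t₃ ⟨⟨hA₃, ht₃⟩, hF₃⟩
    simp only [sets_D] at hA₃ ht₃
    rw [Finset.sum_range_succ]
    refine ⟨fun ℓ x => ?_, fun x ℓ => ?_, ?_⟩
    · rw [hF₃.D, hDall]
    · rw [hA₃, hA₁, hF₃.D, hD₂]
      by_cases hℓ : ℓ = p + i
      · subst hℓ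
        simp [hD₂]
      · have : ℓ < p + (i + 1) ↔ ℓ < p + i := by omega
        simp [hℓ, this, hD₂]
    · nlinarith
  · rintro s' t ⟨⟨h1, h2, h3⟩, -⟩
    refine ⟨fun ℓ x => ?_, h2, h3⟩
    rw [h1]
    tauto

/-- The edges of the local subgraph are collected. -/
theorem wp_localEdges {s : State V} (hnbr : ∀ x y, y ∈ s.nbr x ↔ G.Adj x y)
    (hE : s.edges = ∅) :
    wp (.forEach .S fun u => .forEach .S fun w => .ifMem (.nbr u) w
    (.read (.pos u) fun i => .read (.pos w) fun j =>
      if i < j then .insert .edges (u, w) else .skip)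
    .skip) s fun s' t =>
      (∀ u w, (u, w) ∈ s'.edges ↔
        u ∈ s.S ∧ w ∈ s.S ∧ G.Adj u w ∧ s.reg (.pos u) < s.reg (.pos w)) ∧
      t ≤ s.S.card * (s.S.card * 5 + 2) + 1 := by
  have hm : ∀ u w, Modifies (fun a => a = .edges) (fun _ => False)
    (Cmd.ifMem (.nbr u) w
    (.read (.pos u) fun i => .read (.pos w) fun j =>
      if i < j then .insert .edges (u, w) else .skip)
    .skip : Cmd V) := by
    intro u w
    simp only [Modifies, and_true]
    intro i j
    split_ifs <;> simp [Modifies]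
  refine (wp_forEach_const_frame (fun u w => hm u w)
    (fun P s' => ∀ u w, (u, w) ∈ s'.edges ↔
        u ∈ P ∧ w ∈ s.S ∧ G.Adj u w ∧ s.reg (.pos u) < s.reg (.pos w))
    (s.S.card * 5 + 1) ?_ ?_).mono ?_
  · simp [hE]
  · intro P u s₁ _ _ _ hF hI
    refine (wp_forEach_const_frame (a := .S) (hm u)
      (fun P' s' => ∀ x w, (x, w) ∈ s'.edges ↔ (x, w) ∈ s₁.edges ∨
          x = u ∧ w ∈ P' ∧ G.Adj x w ∧ s.reg (.pos x) < s.reg (.pos w)) 4 ?_ ?_).mono ?_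
    · simp
    · intro P' w s₂ _ _ _ hF₂ hI₂
      have hn : ∀ x y, y ∈ s₂.nbr x ↔ G.Adj x y := by simpa [hF₂.nbr, hF.nbr] using hnbr
      have hpos : ∀ x, s₂.reg (.pos x) = s.reg (.pos x) := fun x => by
        rw [hF₂.reg _ (by simp), hF.reg _ (by simp)]
      simp only [wpS_ifMem, wpS_read, wpS_skip, le_top, true_and, sets_nbr, hn, hpos]
      constructor <;> intro hadj
      · split_ifs with hlt
        · simp only [wpS_insert, le_top, true_and]
          refine ⟨fun x y => ?_, by omega⟩
          simp only [mem_ins_edges, hI₂, Finset.mem_insert, Prod.mk.injEq]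
          by_cases h : x = u ∧ y = w
          · obtain ⟨rfl, rfl⟩ := h
            simp [hadj, hlt]
          · by_cases hx : x = u
            · subst hx
              simp_all
            · simp [hx]
        · simp only [wpS_skip, le_top, true_and]
          refine ⟨fun x y => ?_, by omega⟩
          simp only [hI₂, Finset.mem_insert]
          by_cases h : x = u ∧ y = w
          · obtain ⟨rfl, rfl⟩ := h
            simp [hlt]
          · by_cases hx : x = u
            · subst hx
              simp_all
            · simp [hx]
      · refine ⟨fun x y => ?_, by omega⟩
        simp only [hI₂, Finset.mem_insert]
        by_cases h : x = u ∧ y = w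
        · obtain ⟨rfl, rfl⟩ := h
          simp [hadj]
        · by_cases hx : x = u
          · subst hx
            simp_all
          · simp [hx]
    · rintro s₂ t₂ ⟨⟨h₂, ht₂⟩, -⟩
      simp only [sets_S, hF.S] at h₂ ht₂
      refine ⟨fun x y => ?_, by omega⟩
      rw [h₂, hI]
      by_cases hx : x = u
      · subst hx; simp
      · simp [hx]
  · rintro s' t ⟨⟨h, ht⟩, -⟩
    exact ⟨h, by simpa using ht⟩

end Augment

/-! ### The loop over the local edges -/

section CoverEdges

variable {V : Type} [Fintype V] {G : SimpleGraph V}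

/-- The iteration of Augment-LS for the edge `{u, w}`. -/
def coverEdge (u w : V) : Cmd V := .ifMem (.M u) w
    (block [
      .forEach (.A u) fun ℓ => .ifMem (.A w) ℓ
        (.pick .sel (fun _ => .skip) (.insert .sel ℓ))
        .skip,
      .pick .sel (fun ℓ => block [.erase .sel ℓ, extend ℓ u w]) .skip])
    .skip

omit [Fintype V] in
-- The set `sel` holds at most one label: the first common label is stored, and later ones find it
-- occupied. As the traversal order is arbitrary, so is the selected label.
theorem wp_select {s : State V} (hsel : s.sel = ∅) (u w : V) :
    wp (.forEach (.A u) fun ℓ => .ifMem (.A w) ℓ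
        (.pick .sel (fun _ => .skip) (.insert .sel ℓ)) .skip) s fun s' t =>
      ((s'.sel = ∅ ∧ ∀ ℓ, ¬ (ℓ ∈ s.A u ∧ ℓ ∈ s.A w)) ∨
        ∃ ℓ, ℓ ∈ s.A u ∧ ℓ ∈ s.A w ∧ s'.sel = {ℓ}) ∧
      Frame (fun a => a = .sel) (fun _ => False) s s' ∧ t ≤ (s.A u).card * 4 + 1 := by
  refine (wp_forEach_const_frame (W := fun a => a = .sel) (R := fun _ => False)
    (by simp [Modifies])
    (fun P s' => (s'.sel = ∅ ∧ ∀ ℓ, ¬ (ℓ ∈ P ∧ ℓ ∈ s.A w)) ∨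
        ∃ ℓ, ℓ ∈ P ∧ ℓ ∈ s.A w ∧ s'.sel = {ℓ}) 3 ?_ ?_).mono ?_
  · exact .inl ⟨hsel, by simp⟩
  · intro P ℓ s₁ _ _ _ hF hI
    simp only [wpS_ifMem, wpS_pick, wpS_insert, wpS_skip, le_top, true_and, sets_A, sets_sel,
      hF.A w]
    refine ⟨fun hℓ => ⟨fun x hx => ⟨.inr ?_, le_rfl⟩, fun he => ⟨.inr ?_, le_rfl⟩⟩,
      fun hℓ => ⟨?_, by omega⟩⟩
    · rcases hI with ⟨hI, -⟩ | ⟨i, hi, hi', hI⟩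
      · simp [hI] at hx
      · exact ⟨i, (@Finset.mem_insert _ (_) _ _ _).2 (.inr hi), hi', hI⟩
    · refine ⟨ℓ, (@Finset.mem_insert _ (_) _ _ _).2 (.inl rfl), hℓ, ?_⟩
      ext i
      simp [he]
    · rcases hI with ⟨hI, hno⟩ | ⟨i, hi, hi', hI⟩
      · refine .inl ⟨hI, fun i => ?_⟩
        rintro ⟨h1, h2⟩
        rcases (@Finset.mem_insert _ (_) _ _ _).1 h1 with rfl | h1
        · exact hℓ h2
        · exact hno i ⟨h1, h2⟩
      · exact .inr ⟨i, (@Finset.mem_insert _ (_) _ _ _).2 (.inr hi), hi', hI⟩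
  · rintro s' t ⟨⟨h, ht⟩, hF⟩
    exact ⟨h, hF, ht⟩

theorem LocalInv.of_frame {s s' : State V} {N p r : ℕ} {S : Finset V} (h : LocalInv G N S p r s)
    (hC : s'.C = s.C) (hM : s'.M = s.M) (hD : s'.D = s.D) (hA : s'.A = s.A) :
    LocalInv G N S p r s' := by
  obtain ⟨h1, h2, h3, h4⟩ := h
  exact ⟨by rwa [hC, hM], by rwa [hC], by rwa [hC, hD], by rwa [hA, hD]⟩

/-- The first time bound is amortised, with the total size of the local cliques as potential: only
an extension costs more than `4 * r + 14`, and it adds a vertex. The second bound is the worst case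
for one edge and serves the space estimate. Afterwards the edge is covered or its ends have no
common label. -/
theorem wp_coverEdge {s : State V} (hnbr : ∀ x y, y ∈ s.nbr x ↔ G.Adj x y)
    {N p r e : ℕ} {S : Finset V} (h : LocalInv G N S p r s) (hT : s.T = ∅) (hsel : s.sel = ∅)
    (hS : S.card ≤ e) (u w : V) :
    wp (coverEdge u w) s fun s' t => (LocalInv G N S p r s' ∧ s'.T = ∅ ∧ s'.sel = ∅ ∧
      (∀ ℓ < p, s'.C ℓ = s.C ℓ) ∧ (∀ ℓ, s.C ℓ ⊆ s'.C ℓ) ∧ (∀ x, s'.M x ⊆ s.M x) ∧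
      (∀ ℓ, s'.D ℓ ⊆ s.D ℓ) ∧ (∀ x, s'.A x ⊆ s.A x) ∧
      (w ∈ s'.M u → ∀ ℓ, ¬ (ℓ ∈ s'.A u ∧ ℓ ∈ s'.A w))) ∧
      t + (20 * e + 30) * (∑ j ∈ Finset.range r, (s.C (p + j)).card) ≤
        4 * r + 14 + (20 * e + 30) * (∑ j ∈ Finset.range r, (s'.C (p + j)).card) ∧
      t ≤ 4 * r + 20 * e + 30 := by
  simp only [coverEdge, wpS_ifMem, sets_M]
  constructor <;> intro huw
  swap
  · simp only [wpS_skip, le_top, true_and]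
    exact ⟨⟨h, hT, hsel, by simp, fun _ => le_rfl, fun _ => le_rfl, fun _ => le_rfl,
      fun _ => le_rfl, fun h => absurd h huw⟩, by omega, by omega⟩
  have hAcard : (s.A u).card ≤ r := by
    have : s.A u ⊆ Finset.Ico p (p + r) := fun ℓ hℓ => by
      have := (h.mem_A u ℓ).1 hℓ
      simp [this.1, this.2.1]
    simpa using Finset.card_le_card this
  simp only [block_cons, block_nil, wpS_seq]
  refine (wp_select hsel u w).mono ?_
  rintro s₁ t₁ ⟨hs₁, hF, ht₁⟩
  have hC : s₁.C = s.C := funext fun i => hF.C i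
  have hM : s₁.M = s.M := funext fun i => hF.M i
  have hD : s₁.D = s.D := funext fun i => hF.D i
  have hA : s₁.A = s.A := funext fun i => hF.A i
  have hT₁ : s₁.T = ∅ := hF.T.trans hT
  simp only [wpS_pick, wpS_seq, wpS_erase, wpS_skip, le_top, true_and, sets_sel]
  rcases hs₁ with ⟨hse, hno⟩ | ⟨ℓ, hℓu, hℓw, hse⟩
  · refine ⟨fun x hx => by simp [hse] at hx, fun _ => ⟨⟨h.of_frame hC hM hD hA, hT₁, hse, fun _ _ => by rw [hC],
      fun _ => by rw [hC], fun _ => by rw [hM], fun _ => by rw [hD], fun _ => by rw [hA],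
      fun _ ℓ => by rw [hA]; exact hno ℓ⟩, ?_, by omega⟩⟩
    rw [hC]
    omega
  · refine ⟨fun i hi => ?_, by simp [hse]⟩
    obtain rfl := Finset.mem_singleton.1 (hse ▸ hi)
    obtain ⟨hp, hr, huD⟩ := (h.mem_A _ _).1 hℓu
    obtain ⟨-, -, hwD⟩ := (h.mem_A _ _).1 hℓw
    have hC₂ : (s₁.del .sel i).C = s.C := by rw [← hC]; funext; simp
    have hM₂ : (s₁.del .sel i).M = s.M := by rw [← hM]; funext; simp
    have hD₂ : (s₁.del .sel i).D = s.D := by rw [← hD]; funext; simp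
    have hA₂ : (s₁.del .sel i).A = s.A := by rw [← hA]; funext; simp
    refine ((wp_extend (G := G) (s := s₁.del .sel i) (fun x y => ?_)
      (h.of_frame hC₂ hM₂ hD₂ hA₂) (by simpa using hT₁) hp hr (by rwa [hD₂])
      (by rwa [hD₂]) (by rwa [hM₂])).frame
      (W := fun a => match a with | .C _ | .M _ | .D _ | .A _ | .T => True | _ => False)
      (R := fun _ => False) (by simp [extend, Modifies])).mono ?_
    · rw [← hnbr]
      simp [hF.nbr]
    rintro s₂ t₂ ⟨⟨hinv, hT₃, hC₃, hM₃, hD₃, hA₃, ht₃⟩, hF₃⟩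
    rw [hC₂] at hC₃
    rw [hM₂] at hM₃
    rw [hD₂] at hD₃
    rw [hA₂] at hA₃
    have hsub : ∀ j, s.C j ⊆ s₂.C j := by
      intro j
      rw [hC₃]
      split_ifs with hj
      · subst hj
        exact (Finset.subset_insert _ _).trans (Finset.subset_insert _ _)
      · exact le_rfl
    have hcov := ((h.cover.mem_M u w).1 huw).2 i hr
    -- The growth is strict because the edge was uncovered, so that `u` and `w` were not both in `C
    -- i`.
    have hsum : ∑ j ∈ Finset.range r, (s.C (p + j)).card <
        ∑ j ∈ Finset.range r, (s₂.C (p + j)).card := by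
      obtain ⟨k, rfl⟩ := Nat.exists_eq_add_of_le hp
      refine Finset.sum_lt_sum (fun j _ => Finset.card_le_card (hsub _))
        ⟨k, Finset.mem_range.2 (by omega), Finset.card_lt_card ⟨hsub _, fun hle => hcov ?_⟩⟩
      rw [hC₃, if_pos rfl] at hle
      exact ⟨hle (by simp), hle (by simp)⟩
    refine ⟨⟨hinv, hT₃, ?_, fun j hj => ?_, hsub, hM₃, hD₃, hA₃, fun hw => ?_⟩, ?_, by omega⟩
    · rw [hF₃.sel]
      ext j
      simp [hse]
    · rw [hC₃, if_neg (by omega)]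
    · refine absurd ?_ (((hinv.cover.mem_M u w).1 hw).2 i hr)
      rw [hC₃, if_pos rfl]
      simp
    · nlinarith

/-- The whole loop may take on the order of `r * e ^ 2` steps, too many to bound the space by the
time. Between two edges the invariant shows that only the `r` local cliques have grown, to at most
`e` vertices each; within one edge the worst-case time bounds the growth. -/
theorem wpS_coverEdges {B : ℕ∞} {s : State V} (hnbr : ∀ x y, y ∈ s.nbr x ↔ G.Adj x y)
    {N p r e N₀ : ℕ} {S : Finset V} (h : LocalInv G N S p r s) (hT : s.T = ∅) (hsel : s.sel = ∅)
    (hS : S.card ≤ e) (hs : s.size ≤ N₀)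
    (hB : ((4 * (N₀ + r * e + (4 * r + 20 * e + 30)) + 3 + s.edges.card : ℕ) : ℕ∞) ≤ B) :
    wpS B (.forEach .edges fun x => coverEdge x.1 x.2) s fun s' t =>
      (LocalInv G N S p r s' ∧ s'.T = ∅ ∧ s'.sel = ∅ ∧
      (∀ ℓ < p, s'.C ℓ = s.C ℓ) ∧ (∀ ℓ, s.C ℓ ⊆ s'.C ℓ) ∧ (∀ x, s'.M x ⊆ s.M x) ∧
      (∀ ℓ, s'.D ℓ ⊆ s.D ℓ) ∧ (∀ x, s'.A x ⊆ s.A x) ∧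
      (∀ u w, (u, w) ∈ s.edges → w ∈ s'.M u → ∀ ℓ, ¬ (ℓ ∈ s'.A u ∧ ℓ ∈ s'.A w))) ∧
      s'.size ≤ (N₀ + r * e : ℕ) ∧
      t ≤ s.edges.card * (4 * r + 15) + (20 * e + 30) * (r * e) + 1 := by
  have hsize : ∀ s' : State V, LocalInv G N S p r s' → s'.T = ∅ → s'.sel = ∅ →
      (∀ ℓ < p, s'.C ℓ = s.C ℓ) → (∀ x, s'.M x ⊆ s.M x) → (∀ ℓ, s'.D ℓ ⊆ s.D ℓ) →
      (∀ x, s'.A x ⊆ s.A x) →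
      Frame (fun a => match a with
        | .C _ | .M _ | .D _ | .A _ | .T | .sel => True | _ => False) (fun _ => False) s s' →
      s'.size ≤ (N₀ + r * e : ℕ) := by
    intro s' hinv hT' hsel' hC hM hD hA hF
    have := size_le_add (s := s) (s' := s')
      ((Finset.range r).image fun j => .C (p + j)) ∅ ?_ ?_
    · refine this.trans ((add_le_add_left hs _).trans ?_)
      norm_cast
      refine Nat.add_le_add_left ?_ _
      rw [Finset.sum_image (by simp)]
      simp only [sets_C, Finset.card_empty, add_zero]
      refine (Finset.sum_le_card_nsmul _ _ e fun j _ => ?_).trans (by simp)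
      exact (Finset.card_le_card (hinv.subset _ (by omega))).trans hS
    · intro a ha
      cases a
      case C ℓ =>
        by_cases hp : ℓ < p
        · exact (hC ℓ hp).le
        · obtain ⟨k, rfl⟩ := Nat.exists_eq_add_of_le (not_lt.1 hp)
          have hk : r ≤ k := by
            by_contra hk
            exact ha (Finset.mem_image.2 ⟨k, by simpa using hk, rfl⟩)
          rw [sets_C, hinv.cover.empty _ (by omega)]
          exact Finset.empty_subset _
      case M x => exact hM x
      case D x => exact hD x
      case A x => exact hA x
      case T => rw [sets_T, hT']; exact Finset.empty_subset _
      case sel => rw [sets_sel, hsel']; exact Finset.empty_subset _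
      all_goals exact (hF.sets _ (by simp)).le
    · intro x _
      rw [hF.reg x (by simp)]
      exact id
  have hm : ∀ u w : V, Modifies (fun a => match a with
      | .C _ | .M _ | .D _ | .A _ | .T | .sel => True | _ => False) (fun _ => False)
      (coverEdge u w) := by
    simp [coverEdge, extend, Modifies]
  refine (wpS_forEach (B' := ((4 * (N₀ + r * e + (4 * r + 20 * e + 30)) + 3 : ℕ) : ℕ∞))
    (fun P s' t => ((LocalInv G N S p r s' ∧ s'.T = ∅ ∧ s'.sel = ∅ ∧
      (∀ ℓ < p, s'.C ℓ = s.C ℓ) ∧ (∀ ℓ, s.C ℓ ⊆ s'.C ℓ) ∧ (∀ x, s'.M x ⊆ s.M x) ∧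
      (∀ ℓ, s'.D ℓ ⊆ s.D ℓ) ∧ (∀ x, s'.A x ⊆ s.A x) ∧
      (∀ u w, (u, w) ∈ P → w ∈ s'.M u → ∀ ℓ, ¬ (ℓ ∈ s'.A u ∧ ℓ ∈ s'.A w))) ∧
      t ≤ P.card * (4 * r + 15) +
        (20 * e + 30) * (∑ j ∈ Finset.range r, (s'.C (p + j)).card) + 1) ∧
      Frame (fun a => match a with
        | .C _ | .M _ | .D _ | .A _ | .T | .sel => True | _ => False) (fun _ => False) s s')
    ?_ ?_ ?_ ?_).mono ?_
  · exact le_trans (by push_cast; rfl) hB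
  · exact ⟨⟨⟨h, hT, hsel, fun _ _ => rfl, fun _ => le_rfl, fun _ => le_rfl, fun _ => le_rfl,
      fun _ => le_rfl, by simp⟩, by omega⟩, .refl s⟩
  · rintro P ⟨u, w⟩ s₁ t₁ - hP - ⟨⟨⟨i1, i2, i3, i4, i5, i6, i7, i8, i9⟩, ht⟩, hF⟩
    refine (wp.space ((wp_coverEdge (G := G) (by simpa [hF.nbr] using hnbr) i1 i2 i3 hS u w).frame
      (hm u w)) (k := 3) (T := 4 * r + 20 * e + 30) ?_ ?_
      (hsize s₁ i1 i2 i3 i4 i6 i7 i8 hF) le_rfl).mono ?_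
    · exact fun s' t h => h.1.2.2
    · simp [coverEdge, extend, NestingLE]
    · rintro s₂ t₂ ⟨⟨⟨⟨j1, j2, j3, j4, j5, j6, j7, j8, j9⟩, ht', -⟩, hF'⟩, -⟩
      refine ⟨⟨⟨j1, j2, j3, fun ℓ hℓ => (j4 ℓ hℓ).trans (i4 ℓ hℓ),
        fun ℓ => (i5 ℓ).trans (j5 ℓ), fun x => (j6 x).trans (i6 x), fun x => (j7 x).trans (i7 x),
        fun x => (j8 x).trans (i8 x), fun x y hxy hy ℓ hℓ => ?_⟩, ?_⟩, hF.trans hF'⟩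
      -- An edge settled earlier stays settled, because `M` and `A` only shrink.
      · rcases (@Finset.mem_insert _ (_) _ _ _).1 hxy with hxy | hxy
        · obtain ⟨rfl, rfl⟩ := Prod.mk.inj hxy
          exact j9 hy ℓ hℓ
        · exact i9 x y hxy (j6 x hy) ℓ ⟨j8 x hℓ.1, j8 y hℓ.2⟩
      · erw [@Finset.card_insert_of_notMem _ _ _ (fun a b => Classical.propDecidable (a = b)) hP]
        nlinarith
  · rintro P s' t ⟨⟨⟨i1, i2, i3, i4, i5, i6, i7, i8, i9⟩, -⟩, hF⟩
    refine (hsize s' i1 i2 i3 i4 i6 i7 i8 hF).trans ?_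
    norm_cast
    omega
  · rintro s' t ⟨⟨⟨i1, i2, i3, i4, i5, i6, i7, i8, i9⟩, ht⟩, hF⟩
    refine ⟨⟨i1, i2, i3, i4, i5, i6, i7, i8, i9⟩, hsize s' i1 i2 i3 i4 i6 i7 i8 hF, ht.trans ?_⟩
    gcongr
    · exact le_rfl
    · refine (Finset.sum_le_card_nsmul _ _ e fun j _ => ?_).trans (by simp)
      exact (Finset.card_le_card (i1.subset _ (by omega))).trans hS

end CoverEdges

/-! ### Discarding the local structures -/

section Discard

variable {V : Type} [Fintype V]

omit [Fintype V] in
theorem wp_clearA {s : State V} {a : ℕ} (hA : ∀ u, u ∉ s.S → s.A u = ∅)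
    (ha : ∀ u, (s.A u).card ≤ a) :
    wp (.forEach .S fun u => clear (.A u)) s fun s' t =>
      (∀ u, s'.A u = ∅) ∧ t ≤ s.S.card * (2 * a + 2) + 1 := by
  refine (wp_forEach_const_frame (W := fun a => match a with | .A _ => True | _ => False)
    (R := fun _ => False) (by simp [clear, Modifies])
    (fun P s' => (∀ u, u ∈ P → s'.A u = ∅) ∧ ∀ u, s'.A u ⊆ s.A u) (2 * a + 1) ?_ ?_).mono ?_
  · simp
  · rintro P u s₁ _ _ _ hF ⟨h1, h2⟩
    refine (wp_clear (.A u)).mono ?_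
    rintro s₂ t₂ ⟨he, hF₂, ht⟩
    have hsub : ∀ x, s₂.A x ⊆ s₁.A x := by
      intro x
      by_cases hx : x = u
      · subst hx
        rw [← sets_A, he]
        exact Finset.empty_subset _
      · rw [hF₂.A x (by simpa using hx)]
    refine ⟨⟨fun x hx => ?_, fun x => (hsub x).trans (h2 x)⟩, ?_⟩
    · rcases (@Finset.mem_insert _ (_) _ _ _).1 hx with rfl | hx
      · exact he
      · exact Finset.subset_empty.1 ((hsub x).trans (h1 x hx).le)
    · have := (Finset.card_le_card (h2 u)).trans (ha u)
      rw [sets_A] at ht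
      omega
  · rintro s' t ⟨⟨⟨h1, h2⟩, ht⟩, -⟩
    refine ⟨fun u => ?_, ht⟩
    by_cases hu : u ∈ s.S
    · exact h1 u hu
    · exact Finset.subset_empty.1 ((h2 u).trans (hA u hu).le)

omit [Fintype V] in
theorem wp_clearDQ {s : State V} {p r a : ℕ} (hD : ∀ ℓ, ¬ (p ≤ ℓ ∧ ℓ < p + r) → s.D ℓ = ∅)
    (hQ : ∀ j, r ≤ j → s.Q j = ∅) (ha : ∀ ℓ, (s.D ℓ).card ≤ a) (hb : ∀ j, (s.Q j).card ≤ a) :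
    wp (.forRange r fun j => block [clear (.D (p + j)), clear (.Q j)]) s fun s' t =>
      (∀ ℓ, s'.D ℓ = ∅) ∧ (∀ j, s'.Q j = ∅) ∧ t ≤ r * (4 * a + 4) + 1 := by
  refine (wp_forRange_const_frame
    (W := fun a => match a with | .D _ | .Q _ => True | _ => False)
    (R := fun _ => False) (by simp [clear, Modifies, block])
    (fun i s' => (∀ j < i, s'.D (p + j) = ∅ ∧ s'.Q j = ∅) ∧ (∀ ℓ, s'.D ℓ ⊆ s.D ℓ) ∧
      ∀ ℓ, s'.Q ℓ ⊆ s.Q ℓ) (4 * a + 3) ?_ ?_).mono ?_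
  · simp
  · rintro i s₁ _ hF ⟨h1, h2, h3⟩
    simp only [block_cons, block_nil, wpS_seq]
    refine (wp_clear (.D (p + i))).mono ?_
    rintro s₂ t₂ ⟨he, hF₂, ht⟩
    refine (wp_clear (.Q i)).mono ?_
    rintro s₃ t₃ ⟨he', hF₃, ht'⟩
    rw [wpS_skip]
    have hD₃ : ∀ x, s₃.D x = if x = p + i then ∅ else s₁.D x := by
      intro x
      rw [hF₃.D x]
      split_ifs with h
      · subst h
        exact he
      · exact hF₂.D x (by simpa using h)
    have hQ₃ : ∀ x, s₃.Q x = if x = i then ∅ else s₁.Q x := by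
      intro x
      split_ifs with h
      · subst h
        exact he'
      · rw [hF₃.Q x (by simpa using h), hF₂.Q x]
    refine ⟨le_top, ⟨fun j hj => ?_, fun x => ?_, fun x => ?_⟩, ?_⟩
    · rw [hD₃, hQ₃]
      by_cases hji : j = i
      · simp [hji]
      · simpa [hji] using h1 j (by omega)
    · rw [hD₃]
      split_ifs
      · simp
      · exact h2 x
    · rw [hQ₃]
      split_ifs
      · simp
      · exact h3 x
    · have h4 := (Finset.card_le_card (h2 (p + i))).trans (ha _)
      have h5 := (Finset.card_le_card (h3 i)).trans (hb _)
      rw [sets_D] at ht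
      rw [sets_Q, hF₂.Q] at ht'
      omega
  · rintro s' t ⟨⟨⟨h1, h2, h3⟩, ht⟩, -⟩
    refine ⟨fun ℓ => ?_, fun j => ?_, ht⟩
    · by_cases hℓ : p ≤ ℓ ∧ ℓ < p + r
      · obtain ⟨j, rfl⟩ := Nat.exists_eq_add_of_le hℓ.1
        exact (h1 j (by omega)).1
      · exact Finset.subset_empty.1 ((h2 ℓ).trans (hD ℓ hℓ).le)
    · by_cases hj : j < r
      · exact (h1 j hj).2
      · exact Finset.subset_empty.1 ((h3 j).trans (hQ j (not_lt.1 hj)).le)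

omit [Fintype V] in
-- Only the sets `A u` with `u ∈ S` and the labels of the current iteration are visited; the
-- hypotheses say that the structures are empty elsewhere.
theorem wp_discard {s : State V} {p r a : ℕ} (hA : ∀ u, u ∉ s.S → s.A u = ∅)
    (hA' : ∀ u, (s.A u).card ≤ r)
    (hD : ∀ ℓ, ¬ (p ≤ ℓ ∧ ℓ < p + r) → s.D ℓ = ∅)
    (hQ : ∀ j, r ≤ j → s.Q j = ∅) (ha : ∀ ℓ, (s.D ℓ).card ≤ a) (hb : ∀ j, (s.Q j).card ≤ a) :
    wp (discard p r) s fun s' t => ((∀ u, s'.A u = ∅) ∧ (∀ ℓ, s'.D ℓ = ∅) ∧ (∀ j, s'.Q j = ∅) ∧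
      s'.edges = ∅ ∧ s'.S = ∅) ∧ Frame (fun a => match a with
        | .A _ | .D _ | .Q _ | .edges | .S => True | _ => False) (fun _ => False) s s' ∧
      t ≤ s.S.card * (2 * r + 4) + r * (4 * a + 4) + 2 * s.edges.card + 5 := by
  simp only [discard, block_cons, block_nil, wpS_seq]
  refine ((wp_clearA hA hA').frame (W := fun a => match a with | .A _ => True | _ => False)
    (R := fun _ => False) (by simp [clear, Modifies])).mono ?_
  rintro s₁ t₁ ⟨⟨h1, ht₁⟩, hF₁⟩
  refine ((wp_clearDQ (s := s₁) (p := p) (r := r) (a := a) (by simpa [hF₁.D] using hD)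
    (by simpa [hF₁.Q] using hQ)
    (by simpa [hF₁.D] using ha) (by simpa [hF₁.Q] using hb)).frame
      (W := fun a => match a with | .D _ | .Q _ => True | _ => False)
    (R := fun _ => False) (by simp [clear, Modifies, block])).mono ?_
  rintro s₂ t₂ ⟨⟨h2, h3, ht₂⟩, hF₂⟩
  refine (wp_clear .edges).mono ?_
  rintro s₃ t₃ ⟨h4, hF₃, ht₃⟩
  refine (wp_clear .S).mono ?_
  rintro s₄ t₄ ⟨h5, hF₄, ht₄⟩
  rw [wpS_skip]
  rw [sets_edges, hF₂.edges, hF₁.edges] at ht₃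
  rw [sets_S, hF₃.S, hF₂.S, hF₁.S] at ht₄
  refine ⟨le_top, ⟨fun u => ?_, fun ℓ => ?_, fun j => ?_, ?_, h5⟩, ?_, ?_⟩
  · rw [hF₄.A, hF₃.A, hF₂.A, h1]
  · rw [hF₄.D, hF₃.D, h2]
  · rw [hF₄.Q, hF₃.Q, h3]
  · rw [hF₄.edges]
    exact h4
  · refine (((hF₁.mono ?_ ?_).trans (hF₂.mono ?_ ?_)).trans (hF₃.mono ?_ ?_)).trans
      (hF₄.mono ?_ ?_)
    all_goals rintro (_ | _) <;> simp
  · nlinarith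

end Discard

/-! ### The main loop -/

section MainLoop

variable {V : Type} [Fintype V] {G : SimpleGraph V}

/-- The data that the main loop uses without changing them. -/
structure StaticInv (G : SimpleGraph V) (ps : V → ℕ) (e : ℕ) (s : State V) : Prop where
  nbr : ∀ x y, y ∈ s.nbr x ↔ G.Adj x y
  pos : ∀ x, s.reg (.pos x) = ps x
  back : ∀ x y, y ∈ s.back x ↔ G.Adj y x ∧ ps y < ps x
  card_back : ∀ x, (s.back x).card < e

/-- The invariant of the main loop. -/
structure MainInv (G : SimpleGraph V) (N e : ℕ) (s : State V) : Prop where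
  cover : IsPartialCover G N s.M s.C (s.reg .numC)
  pairwise : ∀ ℓ < s.reg .numC, ∀ i < s.reg .numC, ℓ ≠ i →
    ¬ G.IsClique ((s.C ℓ : Set V) ∪ s.C i)
  saturated : ∀ ℓ < s.reg .numC, ∀ u x, x ∈ s.M u →
    ¬ G.IsClique (insert u (insert x (s.C ℓ : Set V)))
  card_le : ∀ ℓ, (s.C ℓ).card ≤ e
  S : s.S = ∅
  T : s.T = ∅
  sel : s.sel = ∅
  edges : s.edges = ∅
  Q : ∀ j, s.Q j = ∅
  D : ∀ ℓ, s.D ℓ = ∅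
  A : ∀ v, s.A v = ∅

/-- The situation at the end of an iteration for the vertex `v` that started with `M` and `C`. -/
structure IterationEnd (G : SimpleGraph V) (N p r : ℕ) (ps : V → ℕ) (v : V) (M : V → Finset V)
    (C : ℕ → Finset V) (Q : ℕ → Finset V) (S : Finset V) (s : State V) : Prop where
  inv : LocalInv G N S p r s
  fit : IsFirstFit G (M v) r Q
  mem_S : ∀ u, u ∈ S ↔ u = v ∨ (G.Adj u v ∧ ps u < ps v) ∧
    (v ∈ M u ∨ ∃ x, (G.Adj x v ∧ ps x < ps v) ∧ x ∈ M u)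
  old : ∀ ℓ < p, s.C ℓ = C ℓ
  new : ∀ j < r, insert v (Q j) ⊆ s.C (p + j)
  mono : ∀ x, s.M x ⊆ M x
  edges : ∀ u w, u ∈ S → w ∈ S → G.Adj u w → ps u < ps w → w ∈ s.M u →
    ∀ ℓ, ¬ (ℓ ∈ s.A u ∧ ℓ ∈ s.A w)

variable {N p r : ℕ} {ps : V → ℕ} {v : V} {M : V → Finset V} {C Q : ℕ → Finset V}
  {S : Finset V} {s : State V}

/-- Each vertex of the initial `M v` lies in some colour class, and that class became a clique
together with `v`. -/
theorem IterationEnd.M_eq_empty (h : IterationEnd G N p r ps v M C Q S s) : s.M v = ∅ := by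
  refine Finset.eq_empty_of_forall_notMem fun x hx => ?_
  obtain ⟨j, hj, hxj⟩ := (h.fit.mem_iff x).1 (h.mono v hx)
  exact ((h.inv.cover.mem_M v x).1 hx).2 (p + j) (by omega)
    ⟨h.new j hj (by simp), h.new j hj (by simp [hxj])⟩

/-- For an old clique the claim is inherited, as `M` has shrunk. A new clique contains `v`, which
has no uncovered edge left; so both ends of an offending edge are neighbours of `v` that precede it,
since later vertices are finished. They then belong to `S` and to `D ℓ`, and share the label `ℓ`
contrary to `edges`. -/
theorem IterationEnd.saturated (h : IterationEnd G N p r ps v M C Q S s)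
    (hps : Function.Injective ps)
    (hdone : ∀ u, ps v < ps u → M u = ∅)
    (hsat : ∀ ℓ < p, ∀ u x, x ∈ M u → ¬ G.IsClique (insert u (insert x (C ℓ : Set V)))) :
    ∀ ℓ < p + r, ∀ u x, x ∈ s.M u → ¬ G.IsClique (insert u (insert x (s.C ℓ : Set V))) := by
  intro ℓ hℓ u x hx hcl
  by_cases hp : ℓ < p
  · rw [h.old ℓ hp] at hcl
    exact hsat ℓ hp u x (h.mono u hx) hcl
  rw [not_lt] at hp
  have hvC : v ∈ s.C ℓ := by
    obtain ⟨j, rfl⟩ := Nat.exists_eq_add_of_le hp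
    exact h.new j (by omega) (by simp)
  have hv := h.M_eq_empty
  have key : ∀ u x, x ∈ s.M u → u ∈ s.M x → G.IsClique (insert u (insert x (s.C ℓ : Set V))) →
      (G.Adj u v ∧ ps u < ps v) ∧ ∀ y ∈ s.C ℓ, u ≠ y → G.Adj u y := by
    intro u x hx hu hcl
    have huv : u ≠ v := by
      rintro rfl
      simp [hv] at hx
    have hadj : ∀ y ∈ s.C ℓ, u ≠ y → G.Adj u y := fun y hy hne =>
      hcl (by simp) (by simp [hy]) hne
    refine ⟨⟨hadj v hvC huv, ?_⟩, hadj⟩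
    refine lt_of_le_of_ne ?_ fun h => huv (hps h)
    by_contra hlt
    have := h.mono u hx
    simp [hdone u (not_le.1 hlt)] at this
  have hu := h.inv.cover.symm hx
  obtain ⟨h1, h2⟩ := key u x hx hu hcl
  obtain ⟨h3, h4⟩ := key x u hu hx (by rwa [Set.insert_comm])
  -- The edge `{u, x}` itself is the uncovered edge into the backward neighbourhood that membership
  -- in `S` requires.
  have huS : u ∈ S := (h.mem_S u).2 (.inr ⟨h1, .inr ⟨x, h3, h.mono u hx⟩⟩)
  have hxS : x ∈ S := (h.mem_S x).2 (.inr ⟨h3, .inr ⟨u, h1, h.mono x hu⟩⟩)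
  have huA : ℓ ∈ s.A u := (h.inv.mem_A u ℓ).2 ⟨hp, hℓ, (h.inv.mem_D ℓ hp hℓ u).2 ⟨huS, h2⟩⟩
  have hxA : ℓ ∈ s.A x := (h.inv.mem_A x ℓ).2 ⟨hp, hℓ, (h.inv.mem_D ℓ hp hℓ x).2 ⟨hxS, h4⟩⟩
  have hadj := h.inv.cover.adj hx
  rcases lt_or_gt_of_ne (fun h => hadj.ne (hps h) : ps u ≠ ps x) with hlt | hlt
  · exact h.edges u x huS hxS hadj hlt hx ℓ ⟨huA, hxA⟩
  · exact h.edges x u hxS huS hadj.symm hlt hu ℓ ⟨hxA, huA⟩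

/-- Two new cliques are separated by the non-neighbours that first fit provides. A new clique
contains `v` and some `x` of the initial `M v`, so its union with an old clique would violate the
saturation at the start of the iteration. -/
theorem IterationEnd.pairwise (h : IterationEnd G N p r ps v M C Q S s)
    (hsat : ∀ ℓ < p, ∀ u x, x ∈ M u → ¬ G.IsClique (insert u (insert x (C ℓ : Set V))))
    (hpair : ∀ ℓ < p, ∀ i < p, ℓ ≠ i → ¬ G.IsClique ((C ℓ : Set V) ∪ C i)) :
    ∀ ℓ < p + r, ∀ i < p + r, ℓ ≠ i → ¬ G.IsClique ((s.C ℓ : Set V) ∪ s.C i) := by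
  have key : ∀ ℓ < p + r, ∀ i < p + r, ℓ < i → ¬ G.IsClique ((s.C ℓ : Set V) ∪ s.C i) := by
    intro ℓ hℓ i hi hlt hcl
    by_cases hip : i < p
    · rw [h.old i hip, h.old ℓ (hlt.trans hip)] at hcl
      exact hpair ℓ (hlt.trans hip) i hip hlt.ne hcl
    obtain ⟨k, rfl⟩ := Nat.exists_eq_add_of_le (not_lt.1 hip)
    have hk : k < r := by omega
    obtain ⟨x, hx⟩ := h.fit.nonempty k hk
    by_cases hℓp : ℓ < p
    · rw [h.old ℓ hℓp] at hcl
      refine hsat ℓ hℓp v x ((h.fit.mem_iff x).2 ⟨k, hk, hx⟩) (hcl.subset ?_)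
      rintro y (rfl | rfl | hy)
      · exact .inr (h.new k hk (by simp))
      · exact .inr (h.new k hk (by simp [hx]))
      · exact .inl hy
    · obtain ⟨j, rfl⟩ := Nat.exists_eq_add_of_le (not_lt.1 hℓp)
      obtain ⟨y, hy, hxy⟩ := h.fit.firstFit j k (by omega) x hx
      refine hxy (hcl (.inr (h.new k hk (by simp [hx])))
        (.inl (h.new j (by omega) (by simp [hy]))) ?_)
      rintro rfl
      have := h.fit.disj j k x hy hx
      omega
  intro ℓ hℓ i hi hne
  rcases lt_or_gt_of_ne hne with hlt | hlt
  · exact key ℓ hℓ i hi hlt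
  · rw [Set.union_comm]
    exact key i hi ℓ hℓ hlt

omit [Fintype V] in
theorem card_localEdges {E : Finset (V × V)} (h : ∀ u w, (u, w) ∈ E → u ∈ S ∧ w ∈ S) :
    E.card ≤ S.card ^ 2 := by
  rw [sq, ← Finset.card_product]
  refine Finset.card_le_card fun x hx => ?_
  obtain ⟨u, w⟩ := x
  simpa using h u w hx

omit [Fintype V] in
-- The individual phases nest at most three loops, so a factor of four on the memory covers the
-- copies.
theorem wp.space_three {B : ℕ∞} {c : Cmd V} {s : State V} {Post : State V → ℕ → Prop}
    {B' N N' T : ℕ} (h : wp c s Post)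
    (hQ : ∀ s' t, Post s' t → t ≤ T) (hk : NestingLE 3 c) (hs : s.size ≤ N) (hN : N + T = N')
    (hB : 4 * N' + 3 ≤ B') (hB' : (B' : ℕ∞) ≤ B) :
    wpS B c s fun s' t => Post s' t ∧ s'.size ≤ N' := by
  subst hN
  exact wp.space h hQ hk hs (le_trans (by exact_mod_cast hB) hB')

end MainLoop

/-! ### One iteration of the main loop -/

section Iteration

variable {V : Type} [Fintype V] {G : SimpleGraph V}

set_option maxHeartbeats 1000000 in
-- The time is charged to the new cliques at `400 * e ^ 2` each; an iteration that finds `M v` empty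
-- costs two steps. The bounds `N₀ + …` follow the growth of memory from phase to phase.
theorem wpS_iteration {B : ℕ∞} {s : State V} {N e N₀ : ℕ} {ps : V → ℕ} (hps : Function.Injective ps)
    (hst : StaticInv G ps e s) (h : MainInv G N e s) {v : V}
    (hdone : ∀ u, ps v < ps u → s.M u = ∅) (hs : s.size ≤ N₀)
    (hB : ((4 * (N₀ + 400 * e ^ 2) : ℕ) : ℕ∞) ≤ B) :
    wpS B (iteration v) s fun s' t => MainInv G N e s' ∧ s.reg .numC ≤ s'.reg .numC ∧
      s'.M v = ∅ ∧ (∀ x, s'.M x ⊆ s.M x) ∧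
      Frame (fun a => match a with
        | .M _ | .C _ | .S | .Q _ | .D _ | .A _ | .edges | .sel | .T => True | _ => False)
        (fun q => match q with | .numC | .numQ | .placed | .bad => True | _ => False) s s' ∧
      t + 400 * e ^ 2 * s.reg .numC ≤ 2 + 400 * e ^ 2 * s'.reg .numC := by
  have he : 1 ≤ e := (Nat.zero_le _).trans_lt (hst.card_back v)
  -- An opaque name for the square keeps the later estimates linear for `omega`.
  obtain ⟨E, hE⟩ : ∃ E, E = e ^ 2 := ⟨_, rfl⟩
  rw [← hE] at hB ⊢
  have hsB : s.size ≤ B := by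
    refine hs.trans (le_trans ?_ hB)
    norm_cast
    omega
  -- Uncovered edges at `v` lead backwards, since all later vertices are finished. Hence `M v` has
  -- fewer than `e` elements.
  have hMback : s.M v ⊆ s.back v := by
    intro x hx
    refine (hst.back v x).2 ⟨(h.cover.adj hx).symm, ?_⟩
    refine lt_of_le_of_ne ?_ fun h' => (h.cover.adj hx).ne (hps h').symm
    by_contra hlt
    have := h.cover.symm hx
    simp [hdone x (not_le.1 hlt)] at this
  have hMe : (s.M v).card + 1 ≤ e := (Finset.card_le_card hMback).trans_lt (hst.card_back v)
  have hbe := hst.card_back v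
  have hE1 : e ≤ E := by nlinarith
  simp only [iteration, wpS_pick, sets_M, block_cons, block_nil]
  refine ⟨fun x₀ hx₀ => ?_, fun hM => ?_⟩
  swap
  · rw [wpS_skip]
    exact ⟨hsB, h, le_rfl, hM, fun _ => le_rfl, .refl s, by omega⟩
  simp only [wpS_seq]
  refine (wp.space_three (N := N₀) (T := 1) (N' := N₀ + 1) (c := .insert .S v)
    (Post := fun s' t => s' = s.ins .S v ∧ t = 1) ?_ ?_ ?_ hs rfl (by omega) hB).mono ?_
  · simp
  · exact fun _ _ h => h.2.le
  · simp [NestingLE]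
  rintro s₁ t₁ ⟨⟨rfl, rfl⟩, hs₁⟩
  have hF₁ : Frame (fun a => a = .S) (fun _ => False) s (s.ins .S v) :=
    ⟨fun a ha => by simp [ha], fun _ _ => by simp⟩
  have hS₁ : ∀ u, u ∈ (s.ins .S v).S ↔ u = v := by simp [h.S]
  generalize s.ins .S v = s₁ at hs₁ hF₁ hS₁ ⊢
  refine (wp.space_three (N := N₀ + 1) (T := 8 * E) (N' := N₀ + 8 * E + 1)
    ((wp_localVertices hS₁).frame
    (W := fun a => a = .S) (R := fun _ => False) (by simp [Modifies])) ?_ ?_ hs₁ (by omega)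
    (by omega) hB).mono ?_
  · rintro s' t ⟨⟨-, ht⟩, -⟩
    rw [hF₁.back] at ht
    nlinarith
  · simp [NestingLE]
  rintro s₂ t₂ ⟨⟨⟨hS₂, ht₂⟩, hF₂⟩, hs₂⟩
  rw [hF₁.back] at ht₂
  have hF₂ := hF₁.trans hF₂
  refine (wp.space_three (N := N₀ + 8 * E + 1) (T := 60 * E) (N' := N₀ + 68 * E + 1)
    ((wp_colouring (G := G) (s := s₂) (by simpa [hF₂.nbr] using hst.nbr) v
      (by simpa [hF₂.Q] using h.Q)).frame
    (W := fun a => match a with | .Q _ => True | _ => False)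
    (R := fun q => match q with | .numQ | .placed | .bad => True | _ => False) ?_) ?_ ?_ hs₂
    (by omega) (by omega) hB).mono ?_
  · simp only [colouring, block_cons, block_nil, Modifies, true_and, and_true]
    intro x
    refine ⟨fun k i _ b => ?_, fun b => ?_⟩
    · split_ifs
      · simp only [Modifies, true_and, and_true, implies_true]
        intro c
        split_ifs <;> simp [Modifies]
      · simp [Modifies]
    · split_ifs <;> simp [Modifies]
  · rintro s' t ⟨⟨-, ht⟩, -⟩
    rw [hF₂.M] at ht
    nlinarith
  · simp only [colouring, block_cons, block_nil, NestingLE, true_and, and_true]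
    refine ⟨2, rfl, fun x => ⟨fun k => ⟨1, rfl, fun j b => ?_⟩, fun b => ?_⟩⟩
    · split_ifs
      · simp only [NestingLE, true_and, and_true, implies_true]
        refine ⟨⟨0, rfl⟩, fun c => ?_⟩
        split_ifs <;> simp [NestingLE]
      · simp [NestingLE]
    · split_ifs <;> simp [NestingLE]
  rintro s₃ t₃ ⟨⟨⟨hfit, ht₃⟩, hF₃⟩, hs₃⟩
  rw [hF₂.M] at hfit ht₃
  have hnumC₃ : s₃.reg .numC = s.reg .numC := (hF₃.reg _ (by simp)).trans (hF₂.reg _ (by simp))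
  simp only [wpS_read]
  generalize s₃.reg .numQ = r at hfit ⊢
  generalize s₃.reg .numC = p at hnumC₃ ⊢
  have hp : s.reg .numC = p := hnumC₃.symm
  rw [hp]
  simp only [block_cons, block_nil, wpS_seq, augment]
  have hM₃ : s₃.M = s.M := funext fun x => (hF₃.M x).trans (hF₂.M x)
  have hC₃ : s₃.C = s.C := funext fun x => (hF₃.C x).trans (hF₂.C x)
  refine (wp.space_three (N := N₀ + 68 * E + 1) (T := 25 * E) (N' := N₀ + 93 * E + 1)
    ((wp_create (G := G) (s := s₃) (v := v) (N := N) (p := p) (r := r) (by rw [hM₃]; exact hfit)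
      (by rw [hM₃, hC₃, ← hp]; exact h.cover)).frame
    (W := fun a => match a with | .C _ | .M _ => True | _ => False)
    (R := fun _ => False) (by simp [Modifies])) ?_ (by simp [NestingLE]) hs₃
    (by omega) (by omega) hB).mono ?_
  · rintro s' t ⟨⟨-, -, -, -, ht⟩, -⟩
    rw [hM₃] at ht
    nlinarith
  rintro s₄ t₄ ⟨⟨⟨hcov₄, hold₄, hnew₄, hmono₄, ht₄⟩, hF₄⟩, hs₄⟩
  rw [hM₃] at hmono₄ ht₄
  rw [hC₃] at hold₄
  have hrM := hfit.le_card
  have hQsum := hfit.sum_card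
  have hCcard : ∀ j < r, (s₄.C (p + j)).card ≤ (s₃.Q j).card + 1 := fun j hj => by
    rw [hnew₄ j hj]
    exact Finset.card_insert_le _ _
  -- The classes partition `M v` and number at most `(M v).card`, so the new cliques have linear
  -- total size for every `r`. This keeps the admissibility tests within `O(e ^ 2)`.
  have hCsum : ∑ j ∈ Finset.range r, (s₄.C (p + j)).card ≤ 2 * e := by
    calc _ ≤ ∑ j ∈ Finset.range r, ((s₃.Q j).card + 1) :=
          Finset.sum_le_sum fun j hj => hCcard j (Finset.mem_range.1 hj)
      _ ≤ 2 * e := by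
          rw [Finset.sum_add_distrib, hQsum]
          simp
          omega
  have hD₄ : ∀ ℓ, s₄.D ℓ = ∅ := fun ℓ => by rw [hF₄.D, hF₃.D, hF₂.D, h.D]
  refine (wp.space_three (N := N₀ + 93 * E + 1) (T := 7 * E) (N' := N₀ + 100 * E + 1)
    ((wp_initD (p := p) (r := r) hD₄).frame
    (W := fun a => match a with | .D _ => True | _ => False)
    (R := fun _ => False) (by simp [Modifies])) ?_ (by simp [NestingLE]) hs₄
    (by omega) (by omega) hB).mono ?_
  · rintro s' t ⟨⟨-, ht⟩, -⟩
    rw [Finset.sum_add_distrib, ← Finset.mul_sum] at ht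
    simp at ht
    omega
  rintro s₅ t₅ ⟨⟨⟨hD₅, ht₅⟩, hF₅⟩, hs₅⟩
  rw [Finset.sum_add_distrib, ← Finset.mul_sum] at ht₅
  simp only [Finset.sum_const, Finset.card_range, smul_eq_mul] at ht₅
  have hS₄ : s₄.S = s₂.S := by rw [hF₄.S, hF₃.S]
  have hS₅ : s₅.S = s₂.S := by rw [hF₅.S, hS₄]
  have hC₅ : s₅.C = s₄.C := funext fun x => hF₅.C x
  have hM₅ : s₅.M = s₄.M := funext fun x => hF₅.M x
  have hmemS : ∀ u, u ∈ s₂.S ↔ u = v ∨ (G.Adj u v ∧ ps u < ps v) ∧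
      (v ∈ s.M u ∨ ∃ x, (G.Adj x v ∧ ps x < ps v) ∧ x ∈ s.M u) := by
    intro u
    rw [hS₂, hF₁.back]
    simp only [hst.back, hF₁.M]
  have hScard : s₂.S.card ≤ e := by
    refine (Finset.card_le_card (t := insert v (s.back v)) fun u hu => ?_).trans
      ((Finset.card_insert_le _ _).trans hbe)
    rw [Finset.mem_insert, hst.back]
    exact ((hmemS u).1 hu).imp id And.left
  have hCsub : ∀ j < r, s₅.C (p + j) ⊆ s₅.S := by
    intro j hj x hx
    rw [hC₅, hnew₄ j hj] at hx
    rw [hS₅, hmemS]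
    refine (Finset.mem_insert.1 hx).imp id fun hx => ?_
    have hxM := (hfit.mem_iff x).2 ⟨j, hj, hx⟩
    exact ⟨(hst.back v x).1 (hMback hxM), .inl (h.cover.symm hxM)⟩
  have hA₅ : ∀ x, s₅.A x = ∅ := fun ℓ => by rw [hF₅.A, hF₄.A, hF₃.A, hF₂.A, h.A]
  rw [← hC₅] at hD₅
  refine (wp.space_three (N := N₀ + 100 * E + 1) (T := 21 * E) (N' := N₀ + 121 * E + 1)
    ((wp_admissibles (G := G) (p := p) (r := r)
      (by simpa [hF₅.nbr, hF₄.nbr, hF₃.nbr, hF₂.nbr] using hst.nbr) hD₅ hA₅ hCsub).frame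
    (W := fun a => match a with | .D _ | .A _ => True | _ => False)
    (R := fun q => q = .bad) ?_) ?_ ?_ hs₅
    (by omega) (by omega) hB).mono ?_
  · simp only [block_cons, block_nil, Modifies, true_and, and_true, implies_true]
    intro i hi u k
    split_ifs <;> simp [Modifies]
  · rintro s' t ⟨⟨-, -, ht⟩, -⟩
    rw [Finset.sum_add_distrib, ← Finset.mul_sum, Finset.sum_add_distrib, ← Finset.mul_sum,
      hC₅, hS₅] at ht
    simp only [Finset.sum_const, Finset.card_range, smul_eq_mul] at ht
    have := Nat.mul_le_mul hScard (show 3 * ∑ j ∈ Finset.range r, (s₄.C (p + j)).card + r * 10 ≤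
      16 * e by omega)
    nlinarith
  · simp only [block_cons, block_nil, NestingLE, true_and, and_true, implies_true]
    refine ⟨2, rfl, fun i => ⟨⟨1, rfl, fun u => ⟨by simp, fun k => ?_⟩⟩, by simp⟩⟩
    split_ifs <;> simp [NestingLE]
  rintro s₆ t₆ ⟨⟨⟨hD₆, hA₆, ht₆⟩, hF₆⟩, hs₆⟩
  rw [Finset.sum_add_distrib, ← Finset.mul_sum, Finset.sum_add_distrib, ← Finset.mul_sum,
    hC₅, hS₅] at ht₆
  simp only [Finset.sum_const, Finset.card_range, smul_eq_mul] at ht₆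
  rw [hC₅, hS₅] at hD₆
  refine (wp.space_three (N := N₀ + 121 * E + 1) (T := 8 * E) (N' := N₀ + 129 * E + 1)
    ((wp_localEdges (G := G) (s := s₆)
      (by simpa [hF₆.nbr, hF₅.nbr, hF₄.nbr, hF₃.nbr, hF₂.nbr] using hst.nbr)
      (by rw [hF₆.edges, hF₅.edges, hF₄.edges, hF₃.edges, hF₂.edges, h.edges])).frame
    (W := fun a => a = .edges) (R := fun _ => False) ?_) ?_ ?_ hs₆
    (by omega) (by omega) hB).mono ?_
  · simp only [Modifies, and_true]
    intro u w i j
    split_ifs <;> simp [Modifies]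
  · rintro s' t ⟨⟨-, ht⟩, -⟩
    rw [hF₆.S, hS₅] at ht
    nlinarith
  · refine ⟨2, rfl, fun u => ⟨1, rfl, fun w => ?_⟩⟩
    simp only [NestingLE, and_true]
    intro i j
    split_ifs <;> simp [NestingLE]
  rintro s₇ t₇ ⟨⟨⟨hE₇, ht₇⟩, hF₇⟩, hs₇⟩
  rw [hF₆.S, hS₅] at hE₇ ht₇
  have hpos₆ : ∀ x, s₆.reg (.pos x) = ps x := fun x => by
    rw [hF₆.reg _ (by simp), hF₅.reg _ (by simp), hF₄.reg _ (by simp), hF₃.reg _ (by simp),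
      hF₂.reg _ (by simp), hst.pos]
  simp only [hpos₆] at hE₇
  have hC₇ : s₇.C = s₄.C := funext fun x => by rw [hF₇.C, hF₆.C, hC₅]
  have hM₇ : s₇.M = s₄.M := funext fun x => by rw [hF₇.M, hF₆.M, hM₅]
  have hD₇ : s₇.D = s₆.D := funext fun x => hF₇.D x
  have hA₇ : s₇.A = s₆.A := funext fun x => hF₇.A x
  rw [hC₅, hS₅] at hCsub
  have hlocal : LocalInv G N s₂.S p r s₇ := by
    refine ⟨by rwa [hM₇, hC₇], fun ℓ hℓ => ?_, fun ℓ hℓ hℓ' x => ?_, fun u ℓ => ?_⟩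
    · rw [hC₇]
      obtain ⟨j, rfl⟩ := Nat.exists_eq_add_of_le hℓ
      by_cases hj : j < r
      · exact hCsub j hj
      · rw [hcov₄.empty _ (by omega)]
        exact Finset.empty_subset _
    · rw [hD₇, hC₇, hD₆]
      constructor
      · rintro ⟨-, -, hx | ⟨hx, hx'⟩⟩
        · refine ⟨?_, fun y hy hne => hcov₄.clique ℓ hx hy hne⟩
          obtain ⟨j, rfl⟩ := Nat.exists_eq_add_of_le hℓ
          exact hCsub j (by omega) hx
        · exact ⟨hx, fun y hy _ => hx' y hy⟩
      · rintro ⟨hx, hx'⟩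
        refine ⟨hℓ, hℓ', ?_⟩
        by_cases hxC : x ∈ s₄.C ℓ
        · exact .inl hxC
        · exact .inr ⟨hx, fun y hy => hx' y hy (by rintro rfl; exact hxC hy)⟩
    · rw [hA₇, hD₇, hA₆]
  have hEcard : s₇.edges.card ≤ E := by
    refine (card_localEdges fun u w huw => ?_).trans (hE ▸ Nat.pow_le_pow_left hScard 2)
    have := (hE₇ u w).1 huw
    exact ⟨this.1, this.2.1⟩
  have hre : r * e ≤ E := by nlinarith
  refine ((wpS_coverEdges (B := B) (G := G) (s := s₇) (e := e) (N₀ := N₀ + 129 * E + 1)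
    (by simpa [hF₇.nbr, hF₆.nbr, hF₅.nbr, hF₄.nbr, hF₃.nbr, hF₂.nbr] using hst.nbr)
    hlocal (by rw [hF₇.T, hF₆.T, hF₅.T, hF₄.T, hF₃.T, hF₂.T, h.T])
    (by rw [hF₇.sel, hF₆.sel, hF₅.sel, hF₄.sel, hF₃.sel, hF₂.sel, h.sel]) hScard hs₇
    (le_trans (by norm_cast; omega) hB)).frame
    (W := fun a => match a with | .C _ | .M _ | .D _ | .A _ | .T | .sel => True | _ => False)
    (R := fun _ => False) (by simp [coverEdge, extend, Modifies])).mono ?_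
  rintro s₈ t₈ ⟨⟨⟨hloc₈, hT₈, hsel₈, hold₈, hC₈, hM₈, hD₈, hA₈, hE₈⟩, hs₈, ht₈⟩, hF₈⟩
  rw [wpS_skip]
  have hend : IterationEnd G N p r ps v s.M s.C s₃.Q s₂.S s₈ := by
    refine ⟨hloc₈, hfit, hmemS, fun ℓ hℓ => ?_, fun j hj => ?_, fun x => ?_,
      fun u w hu hw huw hlt => hE₈ u w ((hE₇ u w).2 ⟨hu, hw, huw, hlt⟩)⟩
    · rw [hold₈ ℓ hℓ, hC₇, hold₄ ℓ hℓ]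
    · rw [← hnew₄ j hj, ← hC₇]
      exact hC₈ _
    · refine (hM₈ x).trans ?_
      rw [hM₇]
      exact hmono₄ x
  have hs₈' : s₈.size ≤ ((N₀ + 131 * E : ℕ) : ℕ∞) := hs₈.trans (by norm_cast; omega)
  refine ⟨hs₈'.trans (le_trans (by norm_cast; omega) hB), ?_⟩
  refine (wp.space_three (N := N₀ + 131 * E) (T := 3 * E) (N' := N₀ + 134 * E)
    (wp_forRange_const_frame (W := fun _ => False) (R := fun q => q = .numC)
      (k := r) (body := fun _ => .incr .numC) (s := s₈) (by simp [Modifies])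
      (fun i s' => s'.reg .numC = s₈.reg .numC + i) 1 ?_ ?_) ?_ ?_ hs₈'
    (by omega) (by omega) hB).mono ?_
  · rfl
  · intro i s' _ _ hI
    simp only [wpS_incr, le_top, true_and, setReg_reg_self, hI, le_refl, and_true]
    omega
  · rintro s' t ⟨⟨-, ht⟩, -⟩
    omega
  · simp [NestingLE]
  rintro s₉ t₉ ⟨⟨⟨hnum₉, ht₉⟩, hF₉⟩, hs₉⟩
  have hr₉ : s₉.S = s₂.S := by
    rw [hF₉.S, hF₈.S, hF₇.S, hF₆.S, hS₅]
  have hQ₉ : s₉.Q = s₃.Q := funext fun x => by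
    rw [hF₉.Q, hF₈.Q, hF₇.Q, hF₆.Q, hF₅.Q, hF₄.Q]
  have hE₉ : s₉.edges = s₇.edges := by rw [hF₉.edges, hF₈.edges]
  have hA₉ : s₉.A = s₈.A := funext fun x => hF₉.A x
  have hD₉ : s₉.D = s₈.D := funext fun x => hF₉.D x
  have hDS : ∀ ℓ x, x ∈ s₈.D ℓ → p ≤ ℓ ∧ ℓ < p + r ∧ x ∈ s₂.S := by
    intro ℓ x hx
    have hx₆ := (hD₆ ℓ x).1 (by rw [← hD₇]; exact hD₈ ℓ hx)
    exact ⟨hx₆.1, hx₆.2.1, ((hloc₈.mem_D ℓ hx₆.1 hx₆.2.1 x).1 hx).1⟩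
  refine (wp.space_three (N := N₀ + 134 * E) (T := 21 * E) (N' := N₀ + 155 * E)
    (wp_discard (s := s₉) (p := p) (r := r) (a := e) ?_ ?_ ?_ ?_ ?_ ?_) ?_
    (by simp [discard, clear, NestingLE, block]) hs₉ (by omega) (by omega) hB).mono ?_
  · intro u hu
    refine Finset.eq_empty_of_forall_notMem fun ℓ hℓ => hu ?_
    rw [hA₉, hloc₈.mem_A] at hℓ
    rw [hr₉]
    exact (hDS ℓ u hℓ.2.2).2.2
  · intro u
    have : s₉.A u ⊆ Finset.Ico p (p + r) := fun ℓ hℓ => by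
      rw [hA₉, hloc₈.mem_A] at hℓ
      simp [hℓ.1, hℓ.2.1]
    simpa using Finset.card_le_card this
  · intro ℓ hℓ
    refine Finset.eq_empty_of_forall_notMem fun x hx => hℓ ?_
    rw [hD₉] at hx
    exact ⟨(hDS ℓ x hx).1, (hDS ℓ x hx).2.1⟩
  · rw [hQ₉]
    exact hfit.empty
  · intro ℓ
    refine (Finset.card_le_card fun x hx => ?_).trans hScard
    rw [hD₉] at hx
    exact (hDS ℓ x hx).2.2
  · intro j
    rw [hQ₉]
    exact (hfit.card_le j).trans (by omega)
  · rintro s' t ⟨-, -, ht⟩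
    rw [hr₉, hE₉] at ht
    nlinarith
  rintro s₁₀ t₁₀ ⟨⟨⟨hA₁₀, hD₁₀, hQ₁₀, hE₁₀, hS₁₀⟩, hF₁₀, ht₁₀⟩, hs₁₀⟩
  rw [hr₉, hE₉] at ht₁₀
  have hC' : s₁₀.C = s₈.C := funext fun x => by rw [hF₁₀.C, hF₉.C]
  have hM' : s₁₀.M = s₈.M := funext fun x => by rw [hF₁₀.M, hF₉.M]
  have hnum : s₁₀.reg .numC = p + r := by
    rw [hF₁₀.reg _ (by simp), hnum₉, hF₈.reg _ (by simp), hF₇.reg _ (by simp), hF₆.reg _ (by simp),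
      hF₅.reg _ (by simp), hF₄.reg _ (by simp), hF₃.reg _ (by simp), hF₂.reg _ (by simp), hp]
  -- At least one clique is created, so the phases of cost `O(E)` can be charged to the `r` new
  -- cliques.
  have hr : 1 ≤ r := by
    obtain ⟨j, hj, -⟩ := (hfit.mem_iff x₀).1 hx₀
    omega
  rw [wpS_skip, wpS_skip]
  refine ⟨hs₁₀.trans (le_trans (by norm_cast; omega) hB), hs₁₀.trans (le_trans (by norm_cast; omega) hB),
    ⟨?_, ?_, ?_, ?_, hS₁₀, ?_, ?_, hE₁₀, hQ₁₀, hD₁₀, hA₁₀⟩, ?_, ?_, ?_, ?_, ?_⟩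
  · rw [hM', hC', hnum]
    exact hloc₈.cover
  · rw [hC', hnum]
    exact hend.pairwise (by simpa [hp] using h.saturated) (by simpa [hp] using h.pairwise)
  · rw [hC', hM', hnum]
    exact hend.saturated hps hdone (by simpa [hp] using h.saturated)
  · intro ℓ
    rw [hC']
    by_cases hℓ : ℓ < p
    · rw [hend.old ℓ hℓ]
      exact h.card_le ℓ
    · exact (Finset.card_le_card (hloc₈.subset ℓ (not_lt.1 hℓ))).trans hScard
  · rw [hF₁₀.T, hF₉.T, hT₈]
  · rw [hF₁₀.sel, hF₉.sel, hsel₈]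
  · omega
  · rw [hM']
    exact hend.M_eq_empty
  · rw [hM']
    exact hend.mono
  · refine (((((((((hF₂.mono ?_ ?_).trans (hF₃.mono ?_ ?_)).trans (hF₄.mono ?_ ?_)).trans
      (hF₅.mono ?_ ?_)).trans (hF₆.mono ?_ ?_)).trans (hF₇.mono ?_ ?_)).trans
      (hF₈.mono ?_ ?_)).trans (hF₉.mono ?_ ?_))).trans (hF₁₀.mono ?_ ?_)
    all_goals rintro (_ | _) <;> simp
  -- The two terms of the edge loop, searching for labels and extending cliques, are the only ones
  -- of order `E * r`; all others are at most a constant times `E ≤ E * r`.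
  · have h1 : s₇.edges.card * (4 * r + 15) ≤ E * (19 * r) :=
      Nat.mul_le_mul hEcard (by omega)
    have h2 : (20 * e + 30) * (r * e) ≤ 50 * (E * r) := by
      have : e * r ≤ E * r := Nat.mul_le_mul_right r hE1
      nlinarith
    have h3 : E ≤ E * r := Nat.le_mul_of_pos_right _ hr
    have b2 : t₂ ≤ 8 * E := by nlinarith
    have b3 : t₃ ≤ 60 * E := by nlinarith
    have b4 : t₄ ≤ 25 * E := by nlinarith
    have b6 : t₆ ≤ 21 * E := by
      have := Nat.mul_le_mul hScard (show 3 * ∑ j ∈ Finset.range r, (s₄.C (p + j)).card + r * 10 ≤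
        16 * e by omega)
      nlinarith
    have b7 : t₇ ≤ 8 * E := by nlinarith
    have b10 : t₁₀ ≤ 21 * E := by nlinarith
    rw [hnum]
    have : 400 * E * (p + r) = 400 * E * p + 400 * (E * r) := by ring
    rw [this]
    have : s₇.edges.card * (4 * r + 15) ≤ 19 * (E * r) := h1.trans_eq (by ring)
    omega

end Iteration

/-! ### Memory and time of the whole main loop -/

section MainLoop

variable {V : Type} [Fintype V] {G : SimpleGraph V}

/-- The comparison is with the state before the loop, not before the last iteration, so the growth
does not accumulate: local structures are empty, `M` has shrunk, all cliques together have at most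
`N` vertices by the charge, and four registers may have become nonzero. -/
theorem MainInv.size_le {s s' : State V} {N e N₀ : ℕ} (hi : MainInv G N e s')
    (hM : ∀ x, s'.M x ⊆ s.M x) (hF : Frame (fun a => match a with
        | .M _ | .C _ | .S | .Q _ | .D _ | .A _ | .edges | .sel | .T => True | _ => False)
        (fun q => match q with | .numC | .numQ | .placed | .bad => True | _ => False) s s')
    (hs : s.size ≤ N₀) : s'.size ≤ (N₀ + N + 4 : ℕ) := by
  have := size_le_add (s := s) (s' := s')
    ((Finset.range (s'.reg .numC)).image fun j => .C j) {.numC, .numQ, .placed, .bad} ?_ ?_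
  · refine this.trans ((add_le_add_left hs _).trans ?_)
    norm_cast
    rw [add_assoc]
    refine Nat.add_le_add_left (add_le_add ?_ Finset.card_le_four) _
    rw [Finset.sum_image (by simp)]
    exact (Nat.le_add_right _ _).trans hi.cover.charge
  · intro a ha
    cases a
    case C ℓ =>
      rw [sets_C, hi.cover.empty ℓ]
      · exact Finset.empty_subset _
      · by_contra hℓ
        exact ha (Finset.mem_image.2 ⟨ℓ, by simpa using hℓ, rfl⟩)
    case M x => exact hM x
    case D x => rw [sets_D, hi.D]; exact Finset.empty_subset _
    case Q x => rw [sets_Q, hi.Q]; exact Finset.empty_subset _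
    case A x => rw [sets_A, hi.A]; exact Finset.empty_subset _
    case S => rw [sets_S, hi.S]; exact Finset.empty_subset _
    case T => rw [sets_T, hi.T]; exact Finset.empty_subset _
    case sel => rw [sets_sel, hi.sel]; exact Finset.empty_subset _
    case edges => rw [sets_edges, hi.edges]; exact Finset.empty_subset _
    all_goals exact (hF.sets _ (by simp)).le
  · intro r hr
    rw [hF.reg r]
    · exact id
    · cases r <;> simp at hr ⊢

omit [Fintype V] in
theorem StaticInv.of_frame {s s' : State V} {ps : V → ℕ} {e : ℕ} (h : StaticInv G ps e s)
    (hF : Frame (fun a => match a with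
        | .M _ | .C _ | .S | .Q _ | .D _ | .A _ | .edges | .sel | .T => True | _ => False)
        (fun q => match q with | .numC | .numQ | .placed | .bad => True | _ => False) s s') :
    StaticInv G ps e s' :=
  ⟨by simpa [hF.nbr] using h.nbr, fun x => by rw [hF.reg _ (by simp), h.pos],
    by simpa [hF.back] using h.back, by simpa [hF.back] using h.card_back⟩

/-- After `i` passes the vertices in positions above `n - i` have no uncovered edges. A pass that
creates no clique costs at most four steps, whence `4 * n`. -/
theorem wpS_mainLoop {B : ℕ∞} {s : State V} {N e N₀ n : ℕ} {ps : V → ℕ}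
    (hps : Function.Injective ps) (hpn : ∀ v, ps v ≤ n) (hord : ∀ i x, x ∈ s.ord i ↔ ps x = i)
    (hst : StaticInv G ps e s) (h : MainInv G N e s) (hp0 : ∀ v, 1 ≤ ps v)
    (hs : s.size ≤ N₀)
    (hB : ((4 * (N₀ + N + 4 + 400 * e ^ 2) + 1 : ℕ) : ℕ∞) ≤ B) :
    wpS B (.forRange (n - 1) fun k => .pick (.ord (n - k)) (fun v => iteration v) .skip) s
      fun s' t => MainInv G N e s' ∧ (∀ v, s'.M v = ∅) ∧
      Frame (fun a => match a with
        | .M _ | .C _ | .S | .Q _ | .D _ | .A _ | .edges | .sel | .T => True | _ => False)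
        (fun q => match q with | .numC | .numQ | .placed | .bad => True | _ => False) s s' ∧
      t ≤ 4 * n + 1 + 400 * e ^ 2 * s'.reg .numC ∧ s'.size ≤ (N₀ + N + 4 : ℕ) := by
  obtain ⟨E, hE⟩ : ∃ E, E = e ^ 2 := ⟨_, rfl⟩
  refine (wpS_forRange (B' := ((4 * (N₀ + N + 4 + 400 * e ^ 2) : ℕ) : ℕ∞))
    (fun i s' t => MainInv G N e s' ∧ (∀ v, n < ps v + i → s'.M v = ∅) ∧
      (∀ x, s'.M x ⊆ s.M x) ∧
      Frame (fun a => match a with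
        | .M _ | .C _ | .S | .Q _ | .D _ | .A _ | .edges | .sel | .T => True | _ => False)
        (fun q => match q with | .numC | .numQ | .placed | .bad => True | _ => False) s s' ∧
      t ≤ 4 * i + 1 + 400 * e ^ 2 * s'.reg .numC) ?_ ?_ ?_ ?_).mono ?_
  · exact le_trans (by push_cast; rfl) hB
  · exact ⟨h, fun v hv => by have := hpn v; omega, fun _ => le_rfl, .refl s, by omega⟩
  · rintro i s₁ t₁ hi ⟨h1, h2, h3, hF, ht⟩
    have hs₁ := h1.size_le h3 hF hs
    rw [wpS_pick]
    constructor
    · intro v hv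
      rw [sets_ord, hF.ord, hord] at hv
      refine (wpS_iteration hps (hst.of_frame hF) h1 (v := v) (fun u hu => h2 u (by omega)) hs₁
        le_rfl).mono ?_
      rintro s₂ t₂ ⟨j1, j2, j3, j4, hF', ht'⟩
      refine ⟨j1, fun u hu => ?_, fun x => (j4 x).trans (h3 x), hF.trans hF', ?_⟩
      · by_cases huv : u = v
        · rw [huv, j3]
        · have : ps u ≠ ps v := fun h => huv (hps h)
          exact Finset.subset_empty.1 ((j4 u).trans (h2 u (by omega)).le)
      · omega
    · intro hempty
      rw [wpS_skip]
      refine ⟨hs₁.trans (by norm_cast; omega), h1, fun u hu => h2 u ?_, h3, hF, by omega⟩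
      by_contra hlt
      have : u ∈ s₁.ord (n - i) := by
        rw [hF.ord, hord]
        omega
      rw [← sets_ord, hempty] at this
      simp at this
  · rintro i s' t ⟨h1, h2, h3, hF, ht⟩
    exact (h1.size_le h3 hF hs).trans (by norm_cast; omega)
  · rintro s' t ⟨h1, h2, h3, hF, ht⟩
    -- The loop omits the first vertex. An edge still uncovered would have both ends in position
    -- `1`, which the injectivity of `ps` excludes.
    have key : ∀ v x, x ∈ s'.M v → ps v = 1 := by
      intro v x hx
      by_contra hv
      have := hp0 v
      rw [h2 v (by omega)] at hx
      simp at hx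
    refine ⟨h1, fun v => Finset.eq_empty_of_forall_notMem fun x hx => ?_, hF, by omega,
      h1.size_le h3 hF hs⟩
    exact (h1.cover.adj hx).ne (hps ((key v x hx).trans (key x v (h1.cover.symm hx)).symm))

end MainLoop

/-! ### Peeling -/

section Peeling

variable {V : Type} [Fintype V] {G : SimpleGraph V}

/-- A supremum in `ℕ` is meaningful only for bounded sets; degrees are at most the number of
vertices. -/
theorem bddAbove_degeneracy (G : SimpleGraph V) : BddAbove {k | ∃ H : G.Subgraph,
    H.verts.Nonempty ∧ ∀ v ∈ H.verts, k ≤ (H.neighborSet v).ncard} := by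
  refine ⟨Fintype.card V, ?_⟩
  rintro k ⟨H, ⟨v, hv⟩, h⟩
  exact (h v hv).trans ((Set.ncard_le_card _).trans (Nat.card_eq_fintype_card).le)

/-- The subgraph induced by `R` competes in the maximum. -/
theorem le_degeneracy {R : Set V} (hR : R.Nonempty) {k : ℕ}
    (h : ∀ v ∈ R, k ≤ {u | G.Adj v u ∧ u ∈ R}.ncard) : k ≤ degeneracy G := by
  refine le_csSup (bddAbove_degeneracy G) ⟨(⊤ : G.Subgraph).induce R, hR, fun v hv => ?_⟩
  refine (h v hv).trans (Set.ncard_le_ncard ?_ (Set.toFinite _))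
  rintro u ⟨hu, huR⟩
  exact ⟨hv, huR, hu⟩

/-- The state after `π` has been computed. -/
structure OrderInv (G : SimpleGraph V) (s : State V) : Prop where
  inj : Function.Injective fun v => s.reg (.pos v)
  pos_le : ∀ v, s.reg (.pos v) ≤ Fintype.card V
  le_pos : ∀ v, 1 ≤ s.reg (.pos v)
  ord : ∀ i x, x ∈ s.ord i ↔ s.reg (.pos x) = i
  back : ∀ v, {u | G.Adj u v ∧ s.reg (.pos u) < s.reg (.pos v)}.ncard ≤ degeneracy G

/-- The invariant of the peeling loop after `k` moves. -/
structure PeelInv (G : SimpleGraph V) (k : ℕ) (s : State V) : Prop where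
  nbr : ∀ x y, y ∈ s.nbr x ↔ G.Adj x y
  cnt : s.reg .cnt + s.gone.card = Fintype.card V
  deg : ∀ v, v ∉ s.gone → s.reg (.deg v) = {u | G.Adj v u ∧ u ∉ s.gone}.ncard
  bucket : ∀ i v, v ∈ s.bucket i ↔ v ∉ s.gone ∧ s.reg (.deg v) = i
  ptr : ∀ v, v ∉ s.gone → s.reg .ptr ≤ s.reg (.deg v)
  inj : ∀ v u, v ∈ s.gone → u ∈ s.gone → s.reg (.pos v) = s.reg (.pos u) → v = u
  pos : ∀ v, v ∈ s.gone → s.reg .cnt < s.reg (.pos v) ∧ s.reg (.pos v) ≤ Fintype.card V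
  ord : ∀ i v, v ∈ s.ord i ↔ v ∈ s.gone ∧ s.reg (.pos v) = i
  back : ∀ v, v ∈ s.gone →
    {u | G.Adj u v ∧ (u ∈ s.gone → s.reg (.pos u) < s.reg (.pos v))}.ncard ≤ degeneracy G
  moves : s.gone = Finset.univ ∨ k ≤ 2 * s.gone.card + s.reg .ptr

omit [Fintype V] in
theorem wp_decrease {s : State V} (v : V)
    (hb : ∀ i x, x ∈ s.bucket i ↔ x ∉ s.gone ∧ s.reg (.deg x) = i) :
    wp (.forEach (.nbr v) fun u => .ifMem .gone u .skip
          (.read (.deg u) fun k' => block [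
            .erase (.bucket k') u,
            .insert (.bucket (k' - 1)) u,
            .decr (.deg u)])) s fun s' t =>
      ((∀ u, s'.reg (.deg u) =
        if u ∈ s.nbr v ∧ u ∉ s.gone then s.reg (.deg u) - 1 else s.reg (.deg u)) ∧
      (∀ i x, x ∈ s'.bucket i ↔ x ∉ s.gone ∧ s'.reg (.deg x) = i) ∧
      t ≤ (s.nbr v).card * 7 + 1) ∧
      Frame (fun a => match a with | .bucket _ => True | _ => False)
        (fun q => match q with | .deg _ => True | _ => False) s s' := by
  refine (wp_forEach_const_frame (W := fun a => match a with | .bucket _ => True | _ => False)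
    (R := fun q => match q with | .deg _ => True | _ => False) (by simp [Modifies])
    (fun P s' => (∀ u, s'.reg (.deg u) =
        if u ∈ P ∧ u ∉ s.gone then s.reg (.deg u) - 1 else s.reg (.deg u)) ∧
      (∀ i x, x ∈ s'.bucket i ↔ x ∉ s.gone ∧ s'.reg (.deg x) = i)) 6 ?_ ?_).mono ?_
  · exact ⟨by simp, hb⟩
  · rintro P u s₁ _ hP _ hF ⟨h1, h2⟩
    simp only [wpS_ifMem, wpS_skip, le_top, true_and, sets_gone, hF.gone, wpS_read, block_cons,
      block_nil, wpS_seq, wpS_erase, wpS_insert, wpS_decr]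
    refine ⟨fun hu => ⟨⟨fun x => ?_, h2⟩, by omega⟩, fun hu => ⟨⟨fun x => ?_, fun i x => ?_⟩, by omega⟩⟩
    · rw [h1]
      by_cases hx : x = u
      · subst hx
        simp [hu]
      · simp [hx]
    · by_cases hx : x = u
      · subst hx
        have : s₁.reg (.deg x) = s.reg (.deg x) := by simp [h1, hP]
        simp [this, hu]
      · simp [hx, h1]
    · by_cases hx : x = u
      · subst hx
        simp [h2, hu]
        grind
      · simp [h2, hx]
  · rintro s' t ⟨⟨⟨h1, h2⟩, ht⟩, hF⟩
    exact ⟨⟨h1, h2, ht⟩, hF⟩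

omit [Fintype V] in
theorem wp_initBuckets {s : State V} (hdeg : ∀ v, s.reg (.deg v) = 0)
    (hb : ∀ i, s.bucket i = ∅) :
    wp (.forEach .verts fun v => block [
      .forEach (.nbr v) fun _ => .incr (.deg v),
      .read (.deg v) fun k => .insert (.bucket k) v]) s fun s' t =>
      ((∀ v, s'.reg (.deg v) = if v ∈ s.verts then (s.nbr v).card else 0) ∧
      (∀ i x, x ∈ s'.bucket i ↔ x ∈ s.verts ∧ s'.reg (.deg x) = i) ∧
      t ≤ ∑ v ∈ s.verts, (2 * (s.nbr v).card + 5) + 1) ∧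
      Frame (fun a => match a with | .bucket _ => True | _ => False)
        (fun q => match q with | .deg _ => True | _ => False) s s' := by
  refine (wp_forEach_frame (W := fun a => match a with | .bucket _ => True | _ => False)
    (R := fun q => match q with | .deg _ => True | _ => False) (by simp [Modifies])
    (a := .verts)
    (fun P s' t => (∀ v, s'.reg (.deg v) = if v ∈ P then (s.nbr v).card else 0) ∧
      (∀ i x, x ∈ s'.bucket i ↔ x ∈ P ∧ s'.reg (.deg x) = i) ∧
      t ≤ ∑ v ∈ P, (2 * (s.nbr v).card + 5) + 1) ?_ ?_).mono ?_
  · simp [hdeg, hb]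
  · rintro P v s₁ t₁ _ hP _ hF ⟨h1, h2, ht⟩
    simp only [block_cons, block_nil, wpS_seq]
    have hv : s₁.reg (.deg v) = 0 := by simp [h1, hP]
    refine (wp_forEach_const_frame (s := s₁) (a := .nbr v) (W := fun _ => False)
      (R := fun q => q = .deg v) (by simp [Modifies])
      (fun P' s' => s'.reg (.deg v) = P'.card) 1 (by simp [hv]) ?_).mono ?_
    · intro P' u s₂ _ hP' _ _ hI
      simp only [wpS_incr, le_top, true_and, setReg_reg_self, hI, le_refl, and_true]
      exact (Finset.card_insert_of_notMem hP').symm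
    · rintro s₂ t₂ ⟨⟨h3, ht₂⟩, hF₂⟩
      rw [sets_nbr, hF.nbr] at h3 ht₂
      simp only [wpS_read, wpS_insert, wpS_skip, le_top, true_and]
      have hd : ∀ x, s₂.reg (.deg x) = if x ∈ insert v P then (s.nbr x).card else 0 := by
        intro x
        by_cases hx : x = v
        · subst hx
          simp [h3]
        · rw [hF₂.reg _ (by simpa using hx), h1]
          simp [hx]
      refine ⟨fun x => by simpa using hd x, fun i x => ?_, ?_⟩
      · by_cases hx : x = v
        · subst hx
          simp [hF₂.bucket, h2, hP]
          exact eq_comm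
        · have : s₂.reg (.deg x) = s₁.reg (.deg x) := hF₂.reg _ (by simpa using hx)
          simp [hF₂.bucket, h2, hx, this]
      · rw [Finset.sum_insert hP]
        omega
  · rintro s' t ⟨⟨h1, h2, ht⟩, hF⟩
    exact ⟨⟨h1, h2, ht⟩, hF⟩

/-- One removal, as a relation between the states before and after it. -/
structure Removal (v : V) (s s' : State V) : Prop where
  nbr : ∀ x, s'.nbr x = s.nbr x
  gone : ∀ x, x ∈ s'.gone ↔ x = v ∨ x ∈ s.gone
  cnt : s'.reg .cnt = s.reg .cnt - 1
  ptr : s'.reg .ptr = s.reg .ptr - 1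
  pos : ∀ x, s'.reg (.pos x) = if x = v then s.reg .cnt else s.reg (.pos x)
  ord : ∀ i x, x ∈ s'.ord i ↔ (i = s.reg .cnt ∧ x = v) ∨ x ∈ s.ord i
  deg : ∀ u, s'.reg (.deg u) =
    if u ∈ s.nbr v ∧ u ∉ s'.gone then s.reg (.deg u) - 1 else s.reg (.deg u)
  bucket : ∀ i x, x ∈ s'.bucket i ↔ x ∉ s'.gone ∧ s'.reg (.deg x) = i

/-- The pointer is at most every remaining degree, so the remaining vertices induce a subgraph of
minimum degree at least `ptr`, and `ptr ≤ degeneracy G`. The removed vertex has exactly `ptr`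
remaining neighbours; these will get smaller positions, which bounds its backward degree. Other
degrees drop by at most one, and so does the pointer, up to truncation at zero. -/
theorem PeelInv.removal {s s' : State V} {k : ℕ} (h : PeelInv G k s) {v : V}
    (hv : v ∈ s.bucket (s.reg .ptr)) (hr : Removal v s s') : PeelInv G (k + 1) s' := by
  obtain ⟨hvg, hvd⟩ := (h.bucket _ _).1 hv
  have hgone : s'.gone = insert v s.gone := by
    ext x
    simp [hr.gone]
  have hcard : s'.gone.card = s.gone.card + 1 := by
    rw [hgone, Finset.card_insert_of_notMem hvg]
  have hcnt : 1 ≤ s.reg .cnt := by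
    have := Finset.card_le_univ s'.gone
    have := h.cnt
    omega
  have hdegpos : ∀ u, u ∉ s.gone → G.Adj u v → 1 ≤ s.reg (.deg u) := by
    intro u hu huv
    rw [h.deg u hu]
    exact (Set.ncard_pos (Set.toFinite _)).2 ⟨v, huv, hvg⟩
  have hdeg : s.reg .ptr ≤ degeneracy G := by
    refine le_degeneracy (R := {u | u ∉ s.gone}) ⟨v, hvg⟩ fun u hu => ?_
    refine (h.ptr u hu).trans ?_
    rw [h.deg u hu]
    rfl
  constructor
  · simpa [hr.nbr] using h.nbr
  · rw [hr.cnt, hcard]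
    have := h.cnt
    omega
  · intro u hu
    rw [hr.gone, not_or] at hu
    rw [hr.deg, h.deg u hu.2]
    have : u ∉ s'.gone := by simp [hr.gone, hu]
    by_cases huv : G.Adj u v
    · rw [if_pos ⟨(h.nbr v u).2 huv.symm, this⟩, ← Set.ncard_sdiff_singleton_of_mem
        (show v ∈ {x | G.Adj u x ∧ x ∉ s.gone} from ⟨huv, hvg⟩)]
      congr 1
      ext x
      simp [hr.gone]
      tauto
    · rw [if_neg (fun hh => huv ((h.nbr v u).1 hh.1).symm)]
      congr 1
      ext x
      simp only [Set.mem_ofPred_eq, hr.gone, not_or]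
      refine ⟨fun hx => ⟨hx.1, ?_, hx.2⟩, fun hx => ⟨hx.1, hx.2.2⟩⟩
      rintro rfl
      exact huv hx.1
  · exact hr.bucket
  · intro u hu
    rw [hr.gone, not_or] at hu
    rw [hr.ptr, hr.deg]
    have := h.ptr u hu.2
    split_ifs <;> omega
  · intro x y hx hy hxy
    rw [hr.gone] at hx hy
    rw [hr.pos, hr.pos] at hxy
    split_ifs at hxy with h1 h2 h2
    · rw [h1, h2]
    · have := h.pos y (hy.resolve_left h2)
      omega
    · have := h.pos x (hx.resolve_left h1)
      omega
    · exact h.inj x y (hx.resolve_left h1) (hy.resolve_left h2) hxy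
  · intro x hx
    rw [hr.gone] at hx
    rw [hr.pos, hr.cnt]
    have := h.cnt
    split_ifs with h1
    · omega
    · have := h.pos x (hx.resolve_left h1)
      omega
  · intro i x
    rw [hr.ord, h.ord, hr.gone, hr.pos]
    by_cases hx : x = v
    · subst hx
      simp [hvg]
      exact eq_comm
    · simp [hx]
  · intro x hx
    rw [hr.gone] at hx
    by_cases hxv : x = v
    · subst hxv
      refine le_trans ?_ hdeg
      rw [← hvd, h.deg x hvg]
      refine Set.ncard_le_ncard ?_ (Set.toFinite _)
      rintro u ⟨hu, hu'⟩
      refine ⟨hu.symm, fun hug => ?_⟩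
      have := hu' ((hr.gone u).2 (.inr hug))
      rw [hr.pos, hr.pos, if_pos rfl, if_neg hu.ne] at this
      have := h.pos u hug
      omega
    · have hxg := hx.resolve_left hxv
      refine le_trans (Set.ncard_le_ncard ?_ (Set.toFinite _)) (h.back x hxg)
      rintro u ⟨hu, hu'⟩
      refine ⟨hu, fun hug => ?_⟩
      have := hu' ((hr.gone u).2 (.inr hug))
      rwa [hr.pos, hr.pos, if_neg hxv, if_neg (by rintro rfl; exact hvg hug)] at this
  -- The term `2 * gone.card` gains two and the pointer loses at most one.
  · refine h.moves.elim (fun hh => absurd (hh ▸ Finset.mem_univ v) hvg) fun hm => .inr ?_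
    rw [hcard, hr.ptr]
    omega

/-- The loop over the neighbours is charged to the degree of the removed vertex; over all moves
these charges add up to a sum of degrees. -/
theorem wp_move {s : State V} {k : ℕ} (h : PeelInv G k s) :
    wp (.read .ptr fun k => .pick (.bucket k)
      (fun v => block [
        .erase (.bucket k) v,
        .insert .gone v,
        .read .cnt fun i => .insert (.ord i) v,
        .copy (.pos v) .cnt,
        .decr .cnt,
        .forEach (.nbr v) fun u => .ifMem .gone u .skip
          (.read (.deg u) fun k' => block [
            .erase (.bucket k') u,
            .insert (.bucket (k' - 1)) u,
            .decr (.deg u)]),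
        .decr .ptr])
      (.incr .ptr)) s fun s' t => PeelInv G (k + 1) s' ∧
        t + ∑ v ∈ s.gone, 7 * (s.nbr v).card ≤ 19 + ∑ v ∈ s'.gone, 7 * (s.nbr v).card := by
  simp only [wpS_read, wpS_pick]
  refine ⟨fun v hv => ?_, fun hempty => ?_⟩
  · rw [sets_bucket] at hv
    obtain ⟨hvg, hvd⟩ := (h.bucket _ _).1 hv
    simp only [block_cons, block_nil, wpS_seq, wpS_erase, wpS_insert, wpS_read, wpS_copy, wpS_decr,
      wpS_skip, le_top, true_and]
    refine (wp_decrease v ?_).mono ?_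
    · intro i x
      simp [h.bucket]
      by_cases hx : x = v
      · subst hx
        simp only [hvd]
        simp
        exact fun h _ h' => h h'.symm
      · simp [hx]
    · rintro s₁ t₁ ⟨⟨h1, h2, ht⟩, hF⟩
      have hr : Removal v s (s₁.setReg .ptr (s₁.reg .ptr - 1)) := by
        refine ⟨fun x => ?_, fun x => ?_, ?_, ?_, fun x => ?_, fun i x => ?_, fun u => ?_,
          fun i x => ?_⟩
        · simp [hF.nbr]
        · simp [hF.gone]
        · rw [setReg_reg_of_ne _ _ (by simp), hF.reg _ (by simp)]
          simp
        · rw [setReg_reg_self, hF.reg _ (by simp)]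
          simp
        · rw [setReg_reg_of_ne _ _ (by simp), hF.reg _ (by simp), setReg_reg_of_ne _ _ (by simp),
            setReg_pos]
          simp
        · simp [hF.ord]
        · rw [setReg_reg_of_ne _ _ (by simp), h1]
          simp [hF.gone]
        · rw [setReg_bucket, h2]
          simp [hF.gone]
      refine ⟨h.removal hv hr, ?_⟩
      have hgone : (s₁.setReg .ptr (s₁.reg .ptr - 1)).gone = insert v s.gone := by
        ext x
        rw [hr.gone]
        simp
      rw [hgone, Finset.sum_insert hvg]
      simp at ht
      omega
  · simp only [wpS_incr, le_top, true_and, setReg_gone]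
    refine ⟨⟨?_, ?_, ?_, ?_, ?_, ?_, ?_, ?_, ?_, ?_⟩, by omega⟩
    · simpa using h.nbr
    · simpa using h.cnt
    · simpa using h.deg
    · simpa using h.bucket
    -- The bucket at the pointer is empty, so `ptr ≤ deg v` is strict for every remaining `v` and
    -- the pointer may move up.
    · intro v hv
      have := h.ptr v (by simpa using hv)
      have h2 := h.bucket (s.reg .ptr) v
      rw [← sets_bucket, hempty] at h2
      simp at h2 hv ⊢
      have := h2 hv
      omega
    · simpa using h.inj
    · simpa using h.pos
    · simpa using h.ord
    · simpa using h.back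
    · refine h.moves.imp (by simp) fun hh => ?_
      simp
      omega

theorem wp_peeling {s : State V} (hverts : s.verts = Finset.univ)
    (hnbr : ∀ x y, y ∈ s.nbr x ↔ G.Adj x y) (hn : s.reg .numV = Fintype.card V)
    (hptr : s.reg .ptr = 0) (hdeg : ∀ v, s.reg (.deg v) = 0) (hb : ∀ i, s.bucket i = ∅)
    (hgone : s.gone = ∅) (hord : ∀ i, s.ord i = ∅) :
    wp peeling s fun s' t => OrderInv G s' ∧
      Frame (fun a => match a with | .bucket _ | .gone | .ord _ => True | _ => False)
        (fun q => match q with | .deg _ | .cnt | .ptr | .pos _ => True | _ => False) s s' ∧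
      t ≤ 70 * Fintype.card V + 9 * ∑ v, (s.nbr v).card + 10 := by
  refine (wpS.frame (W := fun a => match a with | .bucket _ | .gone | .ord _ => True | _ => False)
    (R := fun q => match q with | .deg _ | .cnt | .ptr | .pos _ => True | _ => False)
    (Post := fun s' t => OrderInv G s' ∧
      t ≤ 70 * Fintype.card V + 9 * ∑ v, (s.nbr v).card + 10) ?_ ?_).mono ?_
  rotate_left
  · simp [peeling, block, Modifies, clear]
  · rintro s' t ⟨⟨h1, h2⟩, h3⟩
    exact ⟨h1, h3, h2⟩
  simp only [peeling, block_cons, block_nil, wpS_seq, wpS_copy, le_top, true_and, wpS_read]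
  refine (wp_initBuckets hdeg hb).mono ?_
  rintro s₁ t₁ ⟨⟨h1, h2, ht₁⟩, hF₁⟩
  simp only [hverts, Finset.mem_univ, if_true, true_and] at h1 h2 ht₁
  have hcard : ∀ v, (s.nbr v).card = {u | G.Adj v u}.ncard := by
    intro v
    rw [Set.ncard_eq_toFinset_card']
    congr 1
    ext u
    simp [hnbr]
  have hinit : PeelInv G 0 (s₁.setReg .cnt (s₁.reg .numV)) := by
    refine ⟨by simpa [hF₁.nbr] using hnbr, ?_, ?_, ?_, ?_, ?_, ?_, ?_, ?_, .inr (by omega)⟩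
    · simp [hF₁.gone, hgone, hF₁.reg .numV (by simp), hn]
    · intro v _
      simp [hF₁.gone, hgone, h1, hcard]
    · simp [hF₁.gone, hgone, h2]
    · simp [hF₁.reg .ptr (by simp), hptr]
    all_goals simp [hF₁.gone, hgone, hF₁.ord, hord]
  have hnum : (s₁.setReg .cnt (s₁.reg .numV)).reg .numV = Fintype.card V := by
    simp [hF₁.reg .numV (by simp), hn]
  have hnbr₂ : ∀ v, (s₁.setReg .cnt (s₁.reg .numV)).nbr v = s.nbr v := by simp [hF₁.nbr]
  have hgone₂ : (s₁.setReg .cnt (s₁.reg .numV)).gone = ∅ := by simp [hF₁.gone, hgone]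
  generalize s₁.setReg .cnt (s₁.reg .numV) = s₂ at hinit hnum hnbr₂ hgone₂ ⊢
  rw [hnum]
  refine (wp_forRange_frame
    (W := fun a => match a with | .bucket _ | .gone | .ord _ => True | _ => False)
    (R := fun q => match q with | .deg _ | .cnt | .ptr | .pos _ => True | _ => False)
    (by simp [Modifies])
    (fun i s' t => PeelInv G i s' ∧ t ≤ 20 * i + ∑ v ∈ s'.gone, 7 * (s.nbr v).card + 1)
    ?_ ?_).mono ?_
  · exact ⟨hinit, by simp⟩
  · rintro i s₃ t₃ _ hF₃ ⟨hI, ht₃⟩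
    refine (wp_move hI).mono ?_
    rintro s₄ t₄ ⟨hI', ht₄⟩
    simp only [hF₃.nbr, hnbr₂] at ht₄
    exact ⟨hI', by omega⟩
  · rintro s₃ t₃ ⟨⟨hI, ht₃⟩, -⟩
    have hall : s₃.gone = Finset.univ := by
      -- If a vertex remained, then `gone.card` and `ptr` would both be at most `n - 1`, so that `2
      -- * gone.card + ptr < 3 * n`, contrary to the count of moves.
      by_contra hne
      obtain ⟨v, hv⟩ : ∃ v, v ∉ s₃.gone := by
        by_contra! hall
        exact hne (Finset.eq_univ_iff_forall.2 hall)
      have h3 := hI.moves.resolve_left hne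
      have h4 := hI.ptr v hv
      have h5 : s₃.gone.card < Fintype.card V := Finset.card_lt_univ_of_notMem hv
      rw [hI.deg v hv] at h4
      have h6 : {u | G.Adj v u ∧ u ∉ s₃.gone}.ncard < Fintype.card V := by
        rw [← Nat.card_eq_fintype_card]
        refine Set.ncard_lt_card fun h => ?_
        exact ((h ▸ Set.mem_univ v : v ∈ {u | G.Adj v u ∧ u ∉ s₃.gone}).1).ne rfl
      omega
    refine (wp_clear .gone).mono ?_
    rintro s₄ t₄ ⟨-, hF₄, ht₄⟩
    rw [wpS_skip]
    rw [sets_gone, hall] at ht₄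
    replace ht₄ : t₄ ≤ (Finset.univ : Finset V).card * 2 + 1 := ht₄
    have hpos : ∀ v, s₄.reg (.pos v) = s₃.reg (.pos v) := fun v => hF₄.reg _ (by simp)
    have hgone₃ : ∀ v, v ∈ s₃.gone := by simp [hall]
    refine ⟨le_top, ⟨fun x y hxy => ?_, fun v => ?_, fun v => ?_, fun i x => ?_, fun v => ?_⟩, ?_⟩
    · simp only [hpos] at hxy
      exact hI.inj x y (hgone₃ x) (hgone₃ y) hxy
    · rw [hpos]
      exact (hI.pos v (hgone₃ v)).2
    · rw [hpos]
      have := (hI.pos v (hgone₃ v)).1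
      omega
    · rw [hF₄.ord, hI.ord, hpos]
      simp [hgone₃]
    · simp only [hpos]
      have := hI.back v (hgone₃ v)
      simpa [hgone₃] using this
    · rw [hall, ← Finset.mul_sum] at ht₃
      rw [Finset.sum_add_distrib, ← Finset.mul_sum] at ht₁
      simp at ht₁ ht₄
      omega

end Peeling

/-! ### The whole algorithm -/

section Setup

variable {V : Type} {G : SimpleGraph V}

theorem wp_countVertices {s : State V} (hn : s.reg .numV = 0) :
    wp (.forEach .verts fun _ => .incr .numV) s fun s' t =>
      (s'.reg .numV = s.verts.card ∧ t ≤ s.verts.card * 2 + 1) ∧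
      Frame (fun _ => False) (fun q => q = .numV) s s' := by
  refine wp_forEach_const_frame (W := fun _ => False) (R := fun q => q = .numV)
    (a := .verts) (by simp [Modifies]) (fun P s' => s'.reg .numV = P.card) 1 (by simp [hn]) ?_
  intro P u s₁ _ hP _ _ hI
  simp only [wpS_incr, le_top, true_and, setReg_reg_self, hI, le_refl, and_true]
  exact (Finset.card_insert_of_notMem hP).symm

theorem wp_initM {s : State V} (hM : ∀ v, s.M v = ∅) :
    wp (.forEach .verts fun v => .forEach (.nbr v) fun u => .insert (.M v) u) s fun s' t =>
      ((∀ v x, x ∈ s'.M v ↔ v ∈ s.verts ∧ x ∈ s.nbr v) ∧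
        t ≤ ∑ v ∈ s.verts, (2 * (s.nbr v).card + 2) + 1) ∧
      Frame (fun a => match a with | .M _ => True | _ => False) (fun _ => False) s s' := by
  refine wp_forEach_frame (W := fun a => match a with | .M _ => True | _ => False)
    (R := fun _ => False) (a := .verts) ?_
    (fun P s' t => (∀ v x, x ∈ s'.M v ↔ v ∈ P ∧ x ∈ s.nbr v) ∧
      t ≤ ∑ v ∈ P, (2 * (s.nbr v).card + 2) + 1) ?_ ?_
  · simp [Modifies]
  · simp [hM]
  rintro P v s₁ t₁ _ hP _ hF ⟨h1, ht⟩
  refine (wp_forEach_const_frame (s := s₁) (W := fun a => match a with | .M _ => True | _ => False)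
    (R := fun _ => False) (a := .nbr v) (by simp [Modifies])
    (fun P' s' => ∀ y x, x ∈ s'.M y ↔ x ∈ s₁.M y ∨ y = v ∧ x ∈ P') 1 (by simp) ?_).mono ?_
  · intro P' u s₂ _ _ _ _ hI
    simp only [wpS_insert, le_top, true_and, le_refl, and_true]
    intro y x
    simp [hI]
    tauto
  · rintro s₂ t₂ ⟨⟨h2, ht₂⟩, -⟩
    rw [sets_nbr, hF.nbr] at h2 ht₂
    rw [Finset.sum_insert hP]
    refine ⟨fun y x => ?_, by omega⟩
    simp [h2, h1]
    by_cases hy : y = v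
    · subst hy
      simp [hP]
    · simp [hy]

theorem wp_initBack {s : State V} (hb : ∀ v, s.back v = ∅) :
    wp (.forEach .verts fun v => .forEach (.nbr v) fun u =>
      .read (.pos u) fun i => .read (.pos v) fun j =>
      if i < j then .insert (.back v) u else .skip) s fun s' t =>
      ((∀ v x, x ∈ s'.back v ↔ v ∈ s.verts ∧ x ∈ s.nbr v ∧ s.reg (.pos x) < s.reg (.pos v)) ∧
        t ≤ ∑ v ∈ s.verts, (4 * (s.nbr v).card + 2) + 1) ∧
      Frame (fun a => match a with | .back _ => True | _ => False) (fun _ => False) s s' := by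
  have hm : ∀ v u : V, Modifies (fun a => match a with | .back _ => True | _ => False)
      (fun _ => False) (.read (.pos u) fun i => .read (.pos v) fun j =>
      if i < j then .insert (.back v) u else .skip) := by
    intro v u i j
    beta_reduce
    split_ifs <;> simp [Modifies]
  refine wp_forEach_frame (W := fun a => match a with | .back _ => True | _ => False)
    (R := fun _ => False) (a := .verts) ?_
    (fun P s' t => (∀ v x, x ∈ s'.back v ↔
        v ∈ P ∧ x ∈ s.nbr v ∧ s.reg (.pos x) < s.reg (.pos v)) ∧
      t ≤ ∑ v ∈ P, (4 * (s.nbr v).card + 2) + 1) ?_ ?_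
  · exact hm
  · simp [hb]
  rintro P v s₁ t₁ _ hP _ hF ⟨h1, ht⟩
  refine (wp_forEach_const_frame (s := s₁)
    (W := fun a => match a with | .back _ => True | _ => False)
    (R := fun _ => False) (a := .nbr v) (hm v)
    (fun P' s' => ∀ y x, x ∈ s'.back y ↔
      x ∈ s₁.back y ∨ y = v ∧ x ∈ P' ∧ s.reg (.pos x) < s.reg (.pos v)) 3 (by simp) ?_).mono ?_
  · intro P' u s₂ _ _ _ hF₂ hI
    simp only [wpS_read, hF₂.reg _ not_false, hF.reg _ not_false]
    split_ifs with hlt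
    · simp only [wpS_insert, le_top, true_and, le_refl, and_true]
      intro y x
      by_cases hx : x = u
      · subst hx
        simp [hI, hlt]
        tauto
      · simp [hI, hx]
    · simp only [wpS_skip, le_top, true_and, le_refl, and_true]
      intro y x
      by_cases hx : x = u
      · subst hx
        simp [hI, hlt]
      · simp [hI, hx]
  · rintro s₂ t₂ ⟨⟨h2, ht₂⟩, -⟩
    rw [sets_nbr, hF.nbr] at h2 ht₂
    rw [Finset.sum_insert hP]
    refine ⟨fun y x => ?_, by omega⟩
    simp [h2, h1]
    by_cases hy : y = v
    · subst hy
      simp [hP]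
    · simp [hy]

theorem wp_initL {s : State V} {p : ℕ} (hL : ∀ v, s.L v = ∅) :
    wp (.forRange p fun ℓ => .forEach (.C ℓ) fun v => .insert (.L v) ℓ) s fun s' t =>
      ((∀ v ℓ, ℓ ∈ s'.L v ↔ ℓ < p ∧ v ∈ s.C ℓ) ∧
        t ≤ ∑ ℓ ∈ Finset.range p, (2 * (s.C ℓ).card + 2) + 1) ∧
      Frame (fun a => match a with | .L _ => True | _ => False) (fun _ => False) s s' := by
  refine wp_forRange_frame (W := fun a => match a with | .L _ => True | _ => False)
    (R := fun _ => False) ?_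
    (fun i s' t => (∀ v ℓ, ℓ ∈ s'.L v ↔ ℓ < i ∧ v ∈ s.C ℓ) ∧
      t ≤ ∑ ℓ ∈ Finset.range i, (2 * (s.C ℓ).card + 2) + 1) ?_ ?_
  · simp [Modifies]
  · simp [hL]
  rintro i s₁ t₁ _ hF ⟨h1, ht⟩
  refine (wp_forEach_const_frame (s := s₁) (W := fun a => match a with | .L _ => True | _ => False)
    (R := fun _ => False) (a := .C i) (by simp [Modifies])
    (fun P' s' => ∀ y ℓ, ℓ ∈ s'.L y ↔ ℓ ∈ s₁.L y ∨ ℓ = i ∧ y ∈ P') 1 (by simp) ?_).mono ?_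
  · intro P' u s₂ _ _ _ _ hI
    simp only [wpS_insert, le_top, true_and, le_refl, and_true]
    intro y ℓ
    simp [hI]
    tauto
  · rintro s₂ t₂ ⟨⟨h2, ht₂⟩, -⟩
    rw [sets_C, hF.C] at h2 ht₂
    rw [Finset.sum_range_succ]
    refine ⟨fun y ℓ => ?_, by omega⟩
    rw [h2, h1]
    constructor
    · rintro (h | ⟨rfl, h⟩)
      · exact ⟨by omega, h.2⟩
      · exact ⟨by omega, h⟩
    · rintro ⟨hlt, h⟩
      rcases Nat.lt_succ_iff_lt_or_eq.1 hlt with hlt | rfl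
      · exact .inl ⟨hlt, h⟩
      · exact .inr ⟨rfl, h⟩

end Setup

/-! ### Assembly of the algorithm -/

section Whole

variable {V : Type} [Fintype V] {G : SimpleGraph V}

/-- The initial memory of the algorithm. -/
structure InitInv (G : SimpleGraph V) (s : State V) : Prop where
  verts : s.verts = Finset.univ
  nbr : ∀ x y, y ∈ s.nbr x ↔ G.Adj x y
  numV : s.reg .numV = 0
  numC : s.reg .numC = 0
  M : ∀ v, s.M v = ∅
  back : ∀ v, s.back v = ∅
  C : ∀ ℓ, s.C ℓ = ∅
  L : ∀ v, s.L v = ∅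
  S : s.S = ∅
  T : s.T = ∅
  sel : s.sel = ∅
  edges : s.edges = ∅
  Q : ∀ j, s.Q j = ∅
  D : ∀ ℓ, s.D ℓ = ∅
  A : ∀ v, s.A v = ∅

/-- The final memory of the algorithm. -/
structure FinalInv (G : SimpleGraph V) (N : ℕ) (s : State V) : Prop where
  cover : IsPartialCover G N (fun _ => ∅) s.C (s.reg .numC)
  pairwise : ∀ ℓ < s.reg .numC, ∀ i < s.reg .numC, ℓ ≠ i →
    ¬ G.IsClique ((s.C ℓ : Set V) ∪ s.C i)
  card_le : ∀ ℓ, (s.C ℓ).card ≤ degeneracy G + 1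
  mem_L : ∀ v ℓ, ℓ ∈ s.L v ↔ ℓ < s.reg .numC ∧ v ∈ s.C ℓ

/-- With `N = 2m` this says that there are at most `m` cliques. -/
theorem IsPartialCover.two_mul_le {N p : ℕ} {M : V → Finset V} {C : ℕ → Finset V}
    (h : IsPartialCover G N M C p) : 2 * p ≤ N := by
  refine le_trans ?_ ((Nat.le_add_right _ _).trans h.charge)
  calc 2 * p = ∑ ℓ ∈ Finset.range p, 2 := by simp [mul_comm]
    _ ≤ _ := Finset.sum_le_sum fun ℓ hℓ => h.two_le ℓ (Finset.mem_range.1 hℓ)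

set_option maxHeartbeats 1000000 in
-- Here `N` is the number of ordered adjacent pairs. The program for the ordering enters only
-- through its postcondition, frame and linear time. Peeling meets the bound since `70 n + 9 N + 10
-- ≤ 89 N`; for a given ordering it is `skip`.
theorem wpS_localAdmissibility {B : ℕ∞} {s : State V} {N N₀ : ℕ} (h : InitInv G s)
    (hN : ∑ v, (s.nbr v).card = N) (hn : Fintype.card V ≤ N) (hN1 : 1 ≤ N) (hs : s.size ≤ N₀)
    {order : Cmd V} (hk : NestingLE 3 order)
    (horder : ∀ s', Frame (fun a => match a with | .M _ => True | _ => False)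
        (fun q => q = .numV) s s' → s'.reg .numV = Fintype.card V →
      wp order s' fun s'' t => OrderInv G s'' ∧
        Frame (fun a => match a with | .bucket _ | .gone | .ord _ => True | _ => False)
        (fun q => match q with | .deg _ | .cnt | .ptr | .pos _ => True | _ => False) s' s'' ∧
        t ≤ 89 * N)
    (hB : ((4 * (N₀ + 113 * N + 400 * (degeneracy G + 1) ^ 2) + 3 : ℕ) : ℕ∞) ≤ B) :
    wpS B (localAdmissibility order) s fun s' t => FinalInv G N s' ∧
      t ≤ 130 * N + 400 * (degeneracy G + 1) ^ 2 * s'.reg .numC := by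
  obtain ⟨E, hE⟩ : ∃ E, E = (degeneracy G + 1) ^ 2 := ⟨_, rfl⟩
  rw [← hE] at hB ⊢
  simp only [localAdmissibility, block_cons, block_nil, wpS_seq]
  refine (wp.space_three (wp_countVertices h.numV) (T := 3 * N) (N' := N₀ + 3 * N) ?_
    (by simp [NestingLE]) hs rfl (by omega) hB).mono ?_
  · rintro s' t ⟨⟨-, ht⟩, -⟩
    rw [h.verts, Finset.card_univ] at ht
    omega
  rintro s₁ t₁ ⟨⟨⟨hnum₁, ht₁⟩, hF₁⟩, hs₁⟩
  rw [h.verts, Finset.card_univ] at ht₁ hnum₁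
  have hnbr₁ : s₁.nbr = s.nbr := funext fun x => hF₁.nbr x
  have hverts₁ : s₁.verts = Finset.univ := hF₁.verts.trans h.verts
  refine (wp.space_three (wp_initM (s := s₁) (fun v => by rw [hF₁.M, h.M])) (T := 5 * N)
    (N' := N₀ + 8 * N) ?_ (by simp [NestingLE]) hs₁ (by omega) (by omega) hB).mono ?_
  · rintro s' t ⟨⟨-, ht⟩, -⟩
    rw [hverts₁, hnbr₁, Finset.sum_add_distrib, ← Finset.mul_sum, hN] at ht
    simp at ht
    omega
  rintro s₂ t₂ ⟨⟨⟨hM₂, ht₂⟩, hF₂⟩, hs₂⟩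
  rw [hverts₁, hnbr₁, Finset.sum_add_distrib, ← Finset.mul_sum, hN] at ht₂
  simp only [hverts₁, Finset.mem_univ, true_and, hnbr₁, h.nbr] at hM₂
  have hF₂' : Frame (fun a => match a with | .M _ => True | _ => False)
      (fun q => q = .numV) s s₂ := (hF₁.mono (by simp) (by simp)).trans (hF₂.mono (by simp) (by simp))
  have hnum₂ : s₂.reg .numV = Fintype.card V := by rw [hF₂.reg _ not_false, hnum₁]
  refine (wp.space_three (horder s₂ hF₂' hnum₂) (T := 89 * N) (N' := N₀ + 97 * N)
    (fun _ _ h => h.2.2) hk hs₂ (by omega) (by omega) hB).mono ?_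
  rintro s₃ t₃ ⟨⟨hord, hF₃, ht₃⟩, hs₃⟩
  have hnbr₃ : s₃.nbr = s.nbr := funext fun x => by rw [hF₃.nbr, hF₂'.nbr]
  have hverts₃ : s₃.verts = Finset.univ := by rw [hF₃.verts, hF₂'.verts, h.verts]
  refine (wp.space_three (wp_initBack (s := s₃) (fun v => by rw [hF₃.back, hF₂'.back, h.back]))
    (T := 7 * N) (N' := N₀ + 104 * N) ?_ ?_ hs₃ (by omega) (by omega) hB).mono ?_
  · rintro s' t ⟨⟨-, ht⟩, -⟩
    rw [hverts₃, hnbr₃, Finset.sum_add_distrib, ← Finset.mul_sum, hN] at ht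
    simp at ht
    omega
  · refine ⟨2, rfl, fun v => ⟨1, rfl, fun u i j => ?_⟩⟩
    beta_reduce
    split_ifs <;> simp [NestingLE]
  rintro s₄ t₄ ⟨⟨⟨hback, ht₄⟩, hF₄⟩, hs₄⟩
  rw [hverts₃, hnbr₃, Finset.sum_add_distrib, ← Finset.mul_sum, hN] at ht₄
  simp only [hverts₃, Finset.mem_univ, true_and, hnbr₃, h.nbr] at hback
  have hpos : ∀ v, s₄.reg (.pos v) = s₃.reg (.pos v) := fun v => hF₄.reg _ not_false
  have hnum₄ : s₄.reg .numV = Fintype.card V := by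
    rw [hF₄.reg _ not_false, hF₃.reg _ (by simp), hnum₂]
  have hnumC₄ : s₄.reg .numC = 0 := by
    rw [hF₄.reg _ not_false, hF₃.reg _ (by simp), hF₂'.reg _ (by simp), h.numC]
  have hC₄ : ∀ ℓ, s₄.C ℓ = ∅ := fun ℓ => by rw [hF₄.C, hF₃.C, hF₂'.C, h.C]
  have hst : StaticInv G (fun v => s₃.reg (.pos v)) (degeneracy G + 1) s₄ := by
    refine ⟨fun x y => by rw [hF₄.nbr, hnbr₃, h.nbr], hpos, fun x y => ?_, fun x => ?_⟩
    · rw [hback, G.adj_comm]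
    · refine Nat.lt_succ_of_le (le_trans (le_of_eq ?_) (hord.back x))
      rw [← Set.ncard_coe_finset]
      congr 1
      ext y
      simp [hback, G.adj_comm]
  have hmain : MainInv G N (degeneracy G + 1) s₄ := by
    refine ⟨⟨fun u x => ?_, fun ℓ => ?_, fun ℓ _ => hC₄ ℓ, ?_, ?_⟩, ?_, ?_, ?_, ?_, ?_, ?_, ?_,
      fun _ => ?_, fun _ => ?_, fun _ => ?_⟩
    · rw [hF₄.M, hF₃.M, hM₂]
      simp [hnumC₄]
    · simp [hC₄]
    · simp [hnumC₄]
    · rw [hnumC₄, Finset.sum_range_zero, zero_add, ← hN]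
      refine Finset.sum_le_sum fun v _ => Finset.card_le_card fun x hx => ?_
      rw [hF₄.M, hF₃.M, hM₂] at hx
      rwa [h.nbr]
    · simp [hnumC₄]
    · simp [hnumC₄]
    · simp [hC₄]
    · rw [hF₄.S, hF₃.S, hF₂'.S, h.S]
    · rw [hF₄.T, hF₃.T, hF₂'.T, h.T]
    · rw [hF₄.sel, hF₃.sel, hF₂'.sel, h.sel]
    · rw [hF₄.edges, hF₃.edges, hF₂'.edges, h.edges]
    · rw [hF₄.Q, hF₃.Q, hF₂'.Q, h.Q]
    · rw [hF₄.D, hF₃.D, hF₂'.D, h.D]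
    · rw [hF₄.A, hF₃.A, hF₂'.A, h.A]
  rw [wpS_read, hnum₄]
  refine (wpS_mainLoop (B := B) (ps := fun v => s₃.reg (.pos v)) hord.inj hord.pos_le
    (fun i x => by rw [hF₄.ord, hord.ord]) hst hmain hord.le_pos hs₄
    (le_trans (Nat.cast_le.2 (by rw [← hE]; omega)) hB)).mono ?_
  rintro s₅ t₅ ⟨hI, hM₅, hF₅, ht₅, hs₅⟩
  rw [← hE] at ht₅
  have hp := hI.cover.two_mul_le
  have hcharge := (Nat.le_add_right _ _).trans hI.cover.charge
  rw [wpS_read]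
  refine (wp.space_three (wp_initL (s := s₅) (p := s₅.reg .numC)
    (fun v => by rw [hF₅.L, hF₄.L, hF₃.L, hF₂'.L, h.L]))
    (T := 4 * N) (N' := N₀ + 113 * N) ?_ (by simp [NestingLE])
    (le_trans hs₅ (Nat.cast_le.2 (show N₀ + 104 * N + N + 4 ≤ N₀ + 109 * N by omega))) (by omega)
    (by omega) hB).mono ?_
  · rintro s' t ⟨⟨-, ht⟩, -⟩
    rw [Finset.sum_add_distrib, ← Finset.mul_sum] at ht
    simp at ht
    omega
  rintro s₆ t₆ ⟨⟨⟨hL, ht₆⟩, hF₆⟩, hs₆⟩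
  rw [wpS_skip]
  have hnum : s₆.reg .numC = s₅.reg .numC := hF₆.reg _ not_false
  have hC : s₆.C = s₅.C := funext fun x => hF₆.C x
  have hM : s₅.M = fun _ => ∅ := funext hM₅
  refine ⟨hs₆.trans (le_trans (by norm_cast; omega) hB), ⟨?_, ?_, ?_, ?_⟩, ?_⟩
  · rw [hnum, hC, ← hM]
    exact hI.cover
  · rw [hnum, hC]
    exact hI.pairwise
  · rw [hC]
    exact hI.card_le
  · rw [hnum, hC]
    exact hL
  · rw [Finset.sum_add_distrib, ← Finset.mul_sum] at ht₆
    simp at ht₂ ht₄ ht₆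
    rw [hnum]
    omega

end Whole

/-! ### Edge counts -/

section Counting

variable {V : Type} [Fintype V] {G : SimpleGraph V}

theorem one_le_degeneracy [Nonempty V] (h : ∀ v, ∃ w, G.Adj v w) : 1 ≤ degeneracy G := by
  refine le_degeneracy (R := Set.univ) Set.univ_nonempty fun v _ => ?_
  obtain ⟨w, hw⟩ := h v
  exact (Set.ncard_pos (Set.toFinite _)).2 ⟨w, hw, Set.mem_univ w⟩

/-- A subgraph that attains the degeneracy `d` has a vertex with `d` neighbours in it, hence at
least `d + 1` vertices, each of degree at least `d`. This makes the `O(d²)` words of local memory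
`O(m)`. -/
theorem degeneracy_mul_le (N : V → Finset V) (hN : ∀ x y, y ∈ N x ↔ G.Adj x y) :
    degeneracy G * (degeneracy G + 1) ≤ ∑ v, (N v).card := by
  by_cases h0 : degeneracy G = 0
  · simp [h0]
  have hne : {k | ∃ H : G.Subgraph, H.verts.Nonempty ∧
      ∀ v ∈ H.verts, k ≤ (H.neighborSet v).ncard}.Nonempty := by
    by_contra hne
    refine h0 ?_
    rw [degeneracy, Set.not_nonempty_iff_eq_empty.1 hne, csSup_empty]
    rfl
  obtain ⟨H, ⟨v, hv⟩, hH⟩ := Nat.sSup_mem hne (bddAbove_degeneracy G)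
  change ∀ v ∈ H.verts, degeneracy G ≤ _ at hH
  have hcard : degeneracy G + 1 ≤ H.verts.toFinset.card := by
    have hv' : v ∉ H.neighborSet v := fun h => h.ne rfl
    refine (Nat.add_le_add_right (hH v hv) 1).trans ?_
    rw [← Set.ncard_insert_of_notMem hv' (Set.toFinite _), ← Set.ncard_eq_toFinset_card']
    refine Set.ncard_le_ncard ?_ (Set.toFinite _)
    rintro x (rfl | hx)
    · exact hv
    · exact H.edge_vert hx.symm
  calc degeneracy G * (degeneracy G + 1) ≤ ∑ v ∈ H.verts.toFinset, degeneracy G := by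
        rw [Finset.sum_const, smul_eq_mul, mul_comm]
        exact Nat.mul_le_mul_right _ hcard
    _ ≤ ∑ v ∈ H.verts.toFinset, (N v).card := by
        refine Finset.sum_le_sum fun u hu => (hH u (by simpa using hu)).trans ?_
        rw [← Set.ncard_coe_finset]
        refine Set.ncard_le_ncard (fun x hx => ?_) (Set.toFinite _)
        exact (hN u x).2 (H.adj_sub hx)
    _ ≤ ∑ v, (N v).card := Finset.sum_le_sum_of_subset (Finset.subset_univ _)

/-- Every ordered adjacent pair lies in the square of a clique with at most `d + 1` vertices. This
absorbs the terms linear in `m` into the time bound. -/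
theorem FinalInv.le_mul {s : State V} {k : ℕ} (h : FinalInv G k s) (N : V → Finset V)
    (hN : ∀ x y, y ∈ N x ↔ G.Adj x y) :
    ∑ v, (N v).card ≤ (degeneracy G + 1) ^ 2 * s.reg .numC := by
  rw [← Finset.card_sigma]
  calc _ ≤ ((Finset.range (s.reg .numC)).biUnion fun ℓ =>
          (s.C ℓ).sigma fun _ => s.C ℓ : Finset (Σ _ : V, V)).card := by
        refine Finset.card_le_card ?_
        rintro ⟨u, x⟩ hx
        simp only [Finset.mem_sigma, Finset.mem_univ, true_and, hN] at hx
        by_contra hcon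
        have := (h.cover.mem_M u x).2 ⟨hx, fun ℓ hℓ hux => hcon ?_⟩
        · simp at this
        · simp only [Finset.mem_biUnion, Finset.mem_sigma, Finset.mem_range]
          exact ⟨ℓ, hℓ, hux⟩
    _ ≤ ∑ ℓ ∈ Finset.range (s.reg .numC), (degeneracy G + 1) ^ 2 := by
        refine Finset.card_biUnion_le.trans (Finset.sum_le_sum fun ℓ _ => ?_)
        rw [Finset.card_sigma, Finset.sum_const, smul_eq_mul, sq]
        exact Nat.mul_le_mul (h.card_le ℓ) (h.card_le ℓ)
    _ = _ := by simp [mul_comm]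

end Counting

/-! ### Correctness with absolute constants -/

section Correctness

variable {V : Type} [Fintype V] [DecidableEq V] {G : SimpleGraph V} [DecidableRel G.Adj]

omit [DecidableEq V] in
theorem sum_card_neighborFinset : ∑ v, (G.neighborFinset v).card = 2 * G.edgeFinset.card := by
  simpa using G.sum_degrees_eq_twice_card_edges

/-- If the union of several cliques were a clique, so would be the union of any two of them; thus
the pairwise statement suffices. -/
theorem FinalInv.isSuccinctDCC {s : State V} (h : FinalInv G (2 * G.edgeFinset.card) s) {K : ℕ}
    (hK : 2 ≤ K) : (output s).IsSuccinctDCC G K := by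
  have hmem : ∀ ℓ, ℓ ∈ (output s).labels ↔ ℓ < s.reg .numC := by simp [output]
  have hC : (output s).C = s.C := rfl
  have hL : (output s).L = s.L := rfl
  refine ⟨⟨⟨fun ℓ _ => h.cover.clique ℓ, fun u v huv => ?_⟩, fun ℓ => ?_, fun v ℓ => ?_⟩,
    fun J hJ hcard hcl => ?_, ?_⟩
  · by_contra! hcon
    have := (h.cover.mem_M u v).2 ⟨huv, fun ℓ hℓ hux => hcon ℓ ((hmem ℓ).2 hℓ) hux.1 hux.2⟩
    simp at this
  · rw [hmem, hL]
    simp only [h.mem_L]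
    refine ⟨fun hℓ => ?_, fun ⟨v, hv⟩ => hv.1⟩
    have := h.cover.two_le ℓ hℓ
    obtain ⟨v, hv⟩ := Finset.card_pos.1 (show 0 < (s.C ℓ).card by omega)
    exact ⟨v, hℓ, hv⟩
  · rw [hmem, hL, hC, h.mem_L]
  · obtain ⟨ℓ, hℓ, i, hi, hne⟩ := Finset.one_lt_card.1 hcard
    refine h.pairwise ℓ ((hmem ℓ).1 (hJ hℓ)) i ((hmem i).1 (hJ hi)) hne (hcl.subset ?_)
    exact Set.union_subset (Set.subset_biUnion_of_mem (u := fun ℓ => ((output s).C ℓ : Set V)) hℓ)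
      (Set.subset_biUnion_of_mem (u := fun ℓ => ((output s).C ℓ : Set V)) hi)
  · exact ((Nat.le_add_right _ _).trans h.cover.charge).trans (Nat.mul_le_mul_right _ hK)

/-- The constant comes from the space bound: with `N₀ = 8m`, `N = 2m` and `(d + 1)² ≤ 8m` it is `4
(8 + 226 + 3200) m + 3`, below `14000 m`. The time needs only `4 · 530` in front of `d²|𝓒|`. -/
theorem correct_localAdmissibility [Nonempty V] (hG : ∀ v, ∃ w, G.Adj v w) {s : State V}
    (h : InitInv G s) (hs : s.size ≤ (8 * G.edgeFinset.card : ℕ)) {order : Cmd V}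
    (hk : NestingLE 3 order)
    (horder : ∀ s', Frame (fun a => match a with | .M _ => True | _ => False)
        (fun q => q = .numV) s s' → s'.reg .numV = Fintype.card V →
      wp order s' fun s'' t => OrderInv G s'' ∧
        Frame (fun a => match a with | .bucket _ | .gone | .ord _ => True | _ => False)
        (fun q => match q with | .deg _ | .cnt | .ptr | .pos _ => True | _ => False) s' s'' ∧
        t ≤ 89 * (2 * G.edgeFinset.card)) :
    Correct G 14000 (localAdmissibility order) s := by
  have hnbr : ∀ v, (s.nbr v) = G.neighborFinset v := fun v => by
    ext x
    simp [h.nbr]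
  have hN : ∑ v, (s.nbr v).card = 2 * G.edgeFinset.card := by
    simp only [hnbr, sum_card_neighborFinset]
  have hn : Fintype.card V ≤ 2 * G.edgeFinset.card := by
    rw [← hN, ← Finset.card_univ, Finset.card_eq_sum_ones]
    refine Finset.sum_le_sum fun v _ => ?_
    obtain ⟨w, hw⟩ := hG v
    exact Finset.card_pos.2 ⟨w, (h.nbr v w).2 hw⟩
  have hn1 : 1 ≤ Fintype.card V := Fintype.card_pos
  have hd := one_le_degeneracy hG
  have hd2 := degeneracy_mul_le s.nbr h.nbr
  rw [hN] at hd2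
  refine ⟨exec_nonempty _ _, fun o ho => ?_⟩
  obtain ⟨hsp, hfin, ht⟩ := wpS_localAdmissibility h hN hn (by omega) hs hk horder le_rfl o ho
  have hle := hfin.le_mul s.nbr h.nbr
  rw [hN] at hle
  have hp := hfin.cover.two_mul_le
  -- Without isolated vertices `d ≥ 1`, hence `d + 1 ≤ 2d`.
  have hE : (degeneracy G + 1) ^ 2 ≤ 4 * degeneracy G ^ 2 := by nlinarith
  refine ⟨hfin.isSuccinctDCC (by norm_num), ?_, hsp.trans ?_⟩
  · have hlabels : (output o.final).labels.card = o.final.reg .numC := by simp [output]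
    -- The minimum is `|𝓒|`, because `2|𝓒| ≤ 2m`.
    rw [hlabels, min_eq_left (by omega)]
    have := Nat.mul_le_mul_right (o.final.reg .numC) hE
    nlinarith
  · refine Nat.cast_le.2 ?_
    nlinarith

omit [DecidableEq V] in
theorem initInv_input : InitInv G (input G) := by
  constructor
  all_goals try intros; rfl
  · intro x y
    exact G.mem_neighborFinset x y

omit [DecidableEq V] in
theorem initInv_inputOrdered (π : V ≃ Fin (Fintype.card V)) : InitInv G (inputOrdered G π) := by
  constructor
  all_goals try intros; rfl
  · intro x y
    exact G.mem_neighborFinset x y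

omit [DecidableEq V] in
theorem size_input :
    (input G).size ≤ (Fintype.card V + 2 * G.edgeFinset.card : ℕ) := by
  have h0 : (⟨fun _ => ∅, fun _ => 0⟩ : State V).size = 0 := by simp [State.size]
  have := size_le_add (s := ⟨fun _ => ∅, fun _ => 0⟩) (s' := input G)
    (insert .verts (Finset.univ.image .nbr)) ∅ ?_ ?_
  · refine this.trans ?_
    rw [h0, zero_add, Finset.sum_insert (by simp), Finset.sum_image fun _ _ _ _ h => Loc.nbr.inj h]
    refine Nat.cast_le.2 (le_of_eq ?_)
    rw [Finset.card_empty, add_zero, ← sum_card_neighborFinset]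
    rfl
  · rintro (_ | _) ha <;> first | exact le_rfl | simp at ha
  · intro r _ hr
    exact hr

omit [DecidableEq V] in
-- The ordering adds one set element and one nonzero register per vertex. As `n ≤ 2m`, the total
-- stays within `8m`.
theorem size_inputOrdered (π : V ≃ Fin (Fintype.card V)) :
    (inputOrdered G π).size ≤ (3 * Fintype.card V + 2 * G.edgeFinset.card : ℕ) := by
  have := size_le_add (s := input G) (s' := inputOrdered G π)
    ((Finset.univ.image fun v => (π v : ℕ) + 1).image .ord) (Finset.univ.image .pos) ?_ ?_
  · refine (this.trans (add_le_add_left size_input _)).trans ?_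
    norm_cast
    rw [Finset.sum_image (by simp), Finset.card_image_of_injective _ (fun _ _ h => by simpa using h)]
    have h1 : ∑ i ∈ Finset.univ.image fun v => (π v : ℕ) + 1,
        ((inputOrdered G π).sets (.ord i)).card = Fintype.card V := by
      refine Eq.trans ?_ Finset.card_univ
      exact (Finset.card_eq_sum_card_image (fun v => (π v : ℕ) + 1) Finset.univ).symm
    rw [h1, Finset.card_univ]
    omega
  · intro a ha
    cases a
    case ord i =>
      intro x hx
      refine absurd ?_ ha
      simp only [inputOrdered, Finset.mem_filter, Finset.mem_univ, true_and] at hx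
      simp only [Finset.mem_image, Finset.mem_univ, true_and]
      exact ⟨i, ⟨x, hx⟩, rfl⟩
    all_goals exact le_rfl
  · intro r hr h
    cases r
    case pos v => simp at hr
    all_goals exact h

omit [DecidableEq V] in
theorem card_le_two_mul_card_edgeFinset (hG : ∀ v, ∃ w, G.Adj v w) :
    Fintype.card V ≤ 2 * G.edgeFinset.card := by
  rw [← sum_card_neighborFinset, ← Finset.card_univ, Finset.card_eq_sum_ones]
  refine Finset.sum_le_sum fun v _ => ?_
  obtain ⟨w, hw⟩ := hG v
  exact Finset.card_pos.2 ⟨w, (G.mem_neighborFinset v w).2 hw⟩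

theorem correct_peeling [Nonempty V] (hG : ∀ v, ∃ w, G.Adj v w) :
    Correct G 14000 (localAdmissibility peeling) (input G) := by
  have hn := card_le_two_mul_card_edgeFinset hG
  refine correct_localAdmissibility hG initInv_input ?_ ?_ ?_
  · exact size_input.trans (Nat.cast_le.2 (by omega))
  · simp [peeling, clear, NestingLE, block]
  · intro s hF hnum
    have hnbr : ∀ v, s.nbr v = G.neighborFinset v := fun v => hF.nbr v
    refine (wp_peeling (G := G) (hF.verts.trans rfl) (fun x y => ?_) hnum
      (hF.reg _ (by simp)) (fun v => hF.reg _ (by simp)) (fun v => hF.bucket v) hF.gone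
      (fun v => hF.ord v)).mono ?_
    · rw [hnbr, G.mem_neighborFinset]
    · rintro s' t ⟨h1, h2, h3⟩
      refine ⟨h1, h2, h3.trans ?_⟩
      simp only [hnbr, sum_card_neighborFinset]
      have : 1 ≤ Fintype.card V := Fintype.card_pos
      omega

theorem correct_given [Nonempty V] (hG : ∀ v, ∃ w, G.Adj v w) {π : V ≃ Fin (Fintype.card V)}
    (hπ : IsDegeneracyOrdering G π) :
    Correct G 14000 (localAdmissibility .skip) (inputOrdered G π) := by
  have hn := card_le_two_mul_card_edgeFinset hG
  refine correct_localAdmissibility hG (initInv_inputOrdered π) ?_ ?_ ?_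
  · exact (size_inputOrdered π).trans (Nat.cast_le.2 (by omega))
  · simp [NestingLE]
  · intro s hF hnum
    have hpos : ∀ v, s.reg (.pos v) = π v + 1 := fun v => hF.reg _ (by simp)
    refine wpS_skip.2 ⟨le_top, ⟨fun x y hxy => ?_, fun v => ?_, fun v => ?_, fun i x => ?_, fun v => ?_⟩,
      .refl s, ?_⟩
    · simp only [hpos, add_left_inj] at hxy
      exact π.injective (Fin.ext hxy)
    · rw [hpos]
      exact (π v).isLt
    · rw [hpos]
      omega
    · rw [hF.ord, hpos]
      change x ∈ Finset.univ.filter _ ↔ _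
      simp
    · simp only [hpos, add_lt_add_iff_right]
      exact hπ v
    · have : 1 ≤ Fintype.card V := Fintype.card_pos
      omega

end Correctness

end LocalAdmissibility

theorem mainTheorem7 :
    ∃ K : ℕ, ∀ (V : Type) [Fintype V] [DecidableEq V] [Nonempty V]
      (G : SimpleGraph V) [DecidableRel G.Adj], (∀ v, ∃ w, G.Adj v w) →
      LocalAdmissibility.Correct G K
        (LocalAdmissibility.localAdmissibility LocalAdmissibility.peeling)
        (LocalAdmissibility.input G) ∧
      ∀ π : V ≃ Fin (Fintype.card V), LocalAdmissibility.IsDegeneracyOrdering G π →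
        LocalAdmissibility.Correct G K
          (LocalAdmissibility.localAdmissibility LocalAdmissibility.Cmd.skip)
          (LocalAdmissibility.inputOrdered G π) :=
  ⟨14000, fun _ _ _ _ _ _ hG => ⟨LocalAdmissibility.correct_peeling hG,
    fun _ hπ => LocalAdmissibility.correct_given hG hπ⟩⟩
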